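/- **Theorem (conditional hardness of weak recovery in $O(d)$ synchronization).** *Model.* For $n,d\ge 1$ and $\lambda>0$ let $O_1,\dots,O_n$ be independent and Haar distributed on $\mathsf O(d)$, $U=(O_1,\dots,O_n)\in\mathbb R^{d\times nd}$, and $$Y=\Theta+Z,\qquad \Theta=\tfrac{\lambda}{\sqrt n}\,U^{\top}U ,$$ where $Z$ is a Gaussian orthogonal $nd\times nd$ matrix independent of $U$: symmetric, with independent centred Gaussian entries on and above the diagonal, of variance $1/d$ off the diagonal and $2/d$ on it. (For off-diagonal variance $1$, replace $\lambda$ by $\lambda/\sqrt d$; as $\lambda$ may depend on $n$ below, this case is included, the heuristic being stated in the present normalization.) Let $\mathbb P_{\lambda,d,n}$ and $\mathbb Q_{d,n}$ be the laws of $Y$ and of $Z$. An estimator $\mathcal X=\mathcal X(Y)\in\mathbb R^{nd\times nd}$ achieves *weak recovery* if, for some constant $c>0$, $\mathbb E\big[\langle\mathcal X,\Theta\rangle/(\|\mathcal X\|_F\|\Theta\|_F)\big]\ge c$ for all large $n$. *Algorithms.* An algorithm is a family, indexed by $n$ (the model parameters are known to it), of randomized programs over $\mathbb R$ with unit-cost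 steps: loading a real constant, drawing an independent standard Gaussian, $+,-,\times,\div,\sqrt{\cdot}$, and a selection "if $a>0$ then $b$ else $c$". Its running time is the number of steps. *Low-degree heuristic.* For laws $\mathbb P_n,\mathbb Q_n$ on $\mathbb R^{N_n}$ put $\mathsf{Adv}_{\le D}(\mathbb P;\mathbb Q)=\sup_{\deg f\le D}\mathbb E_{\mathbb P}[f]/\sqrt{\mathbb E_{\mathbb Q}[f^2]}$. The heuristic holds for $(\mathbb P_n,\mathbb Q_n)$ if for every sequence $D=D_n$ of degrees: (1) if $\mathsf{Adv}_{\le D}=O(1)$, there is a constant $C>0$ such that no algorithm $\mathcal A$ with running time at most $N^{D/(C\log N)}$ has $\mathbb Q(\mathcal A=1)+\mathbb P(\mathcal A=0)\to0$; (2) if $\mathsf{Adv}_{\le D}=1+o(1)$, there is a constant $C>0$ such that no such algorithm has $\mathbb Q(\mathcal A=1)+\mathbb P(\mathcal A=0)\le1-\varepsilon$ for a fixed $\varepsilon>0$ and all large $n$. *Hidden informative sample problem.* Given $M=M_n\ge1$, decide whether $Y_1,\dots,Y_M$ are i.i.d. from $\mathbb Q_{d,n}$, or independent where, for a uniformly random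 $\kappa\in\{1,\dots,M\}$, $Y_\kappa\sim\mathbb P_{\lambda',d,n}$ and $Y_j\sim\mathbb Q_{d,n}$ for $j\ne\kappa$. *Claim.* Let $d=d_n\ge1$ with $d_n=n^{o(1)}$, and $0<\lambda=\lambda_n<1-\delta$ for some constant $\delta>0$. Assume that the low-degree heuristic holds for the hidden informative sample problem, for every constant $\lambda'\in(0,1)$ and every sequence $M_n\ge 1$ with $\log M_n\le n^{o(1)}$. Then any algorithm for weak recovery requires running time $\exp(n^{\Omega(1)})$, that is: 1. no algorithm with running time at most $\exp(n^{o(1)})$ achieves weak recovery: for each algorithm achieving weak recovery there is $\varepsilon>0$ such that its running time exceeds $\exp(n^{\varepsilon})$ for infinitely many $n$; 2. if the heuristic is assumed for these problems also as $n\to\infty$ along each infinite set of sizes $n$, then for each algorithm achieving weak recovery there is $\varepsilon>0$ such that its running time is at least $\exp(n^{\varepsilon})$ for all large $n$. -/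

import Mathlib

open Filter Topology MeasureTheory ProbabilityTheory
open scoped ENNReal

noncomputable section

namespace OrthSync

/-! ### Randomized algorithms over the reals and their running time -/

/-- Where an instruction reads from: a coordinate of the input, or an earlier result. -/
inductive Operand (ι : Type) : Type
  | input (i : ι) : Operand ι
  | reg (k : ℕ) : Operand ι

/-- The elementary steps of a real random access machine with a source of Gaussian randomness:
load a constant, draw a fresh standard Gaussian, arithmetic (`x / 0 = 0`), square root
(`0` on negative reals), and branching on a comparison (if `a > 0` then `b` else `c`). -/
inductive Instr (ι : Type) : Type
  | const (r : ℝ) : Instr ι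
  | gauss : Instr ι
  | add (a b : Operand ι) : Instr ι
  | sub (a b : Operand ι) : Instr ι
  | mul (a b : Operand ι) : Instr ι
  | div (a b : Operand ι) : Instr ι
  | sqrt (a : Operand ι) : Instr ι
  | ifPos (a b c : Operand ι) : Instr ι

/-- The value of an operand; `mem` lists the results of the steps executed so far, and a register
that has not been written holds `0`. -/
def Operand.eval {ι : Type} (x : ι → ℝ) (mem : List ℝ) : Operand ι → ℝ
  | .input i => x i
  | .reg k => mem.getD k 0

open Classical in
/-- The result of one step; `g` is the Gaussian variable that is available to this step. -/
def Instr.eval {ι : Type} (x : ι → ℝ) (mem : List ℝ) (g : ℝ) : Instr ι → ℝ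
  | .const r => r
  | .gauss => g
  | .add a b => a.eval x mem + b.eval x mem
  | .sub a b => a.eval x mem - b.eval x mem
  | .mul a b => a.eval x mem * b.eval x mem
  | .div a b => a.eval x mem / b.eval x mem
  | .sqrt a => Real.sqrt (a.eval x mem)
  | .ifPos a b c => if 0 < a.eval x mem then b.eval x mem else c.eval x mem

/-- Execute the steps one after the other, each result being written to the next register.
The step that writes register `k` may use the random number `ω k`. -/
def exec {ι : Type} (x : ι → ℝ) (ω : ℕ → ℝ) : List (Instr ι) → List ℝ → List ℝ
  | [], mem => mem
  | I :: P, mem => exec x ω P (mem ++ [I.eval x mem (ω mem.length)])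

/-- A randomized algorithm with input in `ℝ^ι` and output in `ℝ^κ`, for one problem size:
the list of its elementary steps, and the places where the output coordinates are found. -/
structure Algorithm (ι κ : Type) : Type where
  steps : List (Instr ι)
  out : κ → Operand ι

/-- The running time: the number of elementary steps. -/
def Algorithm.time {ι κ : Type} (A : Algorithm ι κ) : ℕ := A.steps.length

/-- The output on input `x` with random numbers `ω`. -/
def Algorithm.output {ι κ : Type} (A : Algorithm ι κ) (x : ι → ℝ) (ω : ℕ → ℝ) : κ → ℝ :=
  fun k => (A.out k).eval x (exec x ω A.steps [])

/-- The law of the internal randomness: independent standard Gaussians. -/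
def coins : Measure (ℕ → ℝ) := Measure.infinitePi (fun _ : ℕ => gaussianReal 0 1)

/-- The `{0,1}`-valued decision of a test, encoded by the sign of its single output. -/
def Algorithm.Accepts {ι : Type} (A : Algorithm ι Unit) (x : ι → ℝ) (ω : ℕ → ℝ) : Prop :=
  0 < A.output x ω ()

/-- Sum of the two error probabilities of a test:
`Q(A = 1) + P(A = 0)`, over the sample and the internal randomness. -/
def testError {ι : Type} (P Q : Measure (ι → ℝ)) (A : Algorithm ι Unit) : ℝ :=
  (Q.prod coins).real {z | A.Accepts z.1 z.2} + (P.prod coins).real {z | ¬ A.Accepts z.1 z.2}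

/-! ### Low-degree advantage and low-degree heuristic -/

/-- The degree-`D` advantage: the supremum of `E_P[f] / sqrt (E_Q[f²])` over polynomials `f` of
degree at most `D` (with `0 / 0 = 0` and `a / 0 = ∞` for `a > 0`). Since `f = 1` competes, negative
values of `E_P[f]` do not matter. -/
def lowDegAdv {ι : Type} (D : ℕ) (P Q : Measure (ι → ℝ)) : ℝ≥0∞ :=
  ⨆ (f : MvPolynomial ι ℝ) (_ : f.totalDegree ≤ D),
    ENNReal.ofReal (∫ y, MvPolynomial.eval y f ∂P) /
      ENNReal.ofReal (Real.sqrt (∫ y, (MvPolynomial.eval y f) ^ 2 ∂Q))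

/-- The running time `N ^ (D / (C log N))`. -/
def heuristicTime (N D : ℕ) (C : ℝ) : ℝ := (N : ℝ) ^ ((D : ℝ) / (C * Real.log N))

/-- The low-degree heuristic for the testing problems `P n` against `Q n` on `ℝ^(ι n)`, as `n → ∞`
along the filter `l`: (1) bounded degree-`D` advantage excludes strong detection,
(2) degree-`D` advantage `1 + o(1)` excludes weak detection, in time `N ^ (D / (C log N))` for some
constant `C`, where `N` is the dimension of the sample. -/
def LowDegreeHeuristic (l : Filter ℕ) {ι : ℕ → Type} [∀ n, Fintype (ι n)]
    (P Q : ∀ n, Measure (ι n → ℝ)) : Prop :=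
  (∀ D : ℕ → ℕ, (∃ B : ℝ, ∀ᶠ n in l, lowDegAdv (D n) (P n) (Q n) ≤ ENNReal.ofReal B) →
    ∃ C : ℝ, 0 < C ∧ ∀ A : ∀ n, Algorithm (ι n) Unit,
      (∀ᶠ n in l, ((A n).time : ℝ) ≤ heuristicTime (Fintype.card (ι n)) (D n) C) →
      ¬ Tendsto (fun n => testError (P n) (Q n) (A n)) l (𝓝 0)) ∧
  (∀ D : ℕ → ℕ, Tendsto (fun n => lowDegAdv (D n) (P n) (Q n)) l (𝓝 1) →
    ∃ C : ℝ, 0 < C ∧ ∀ A : ∀ n, Algorithm (ι n) Unit,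
      (∀ᶠ n in l, ((A n).time : ℝ) ≤ heuristicTime (Fintype.card (ι n)) (D n) C) →
      ¬ ∃ ε : ℝ, 0 < ε ∧ ∀ᶠ n in l, testError (P n) (Q n) (A n) ≤ 1 - ε)

/-- Null law of the hidden informative sample problem: `M` independent samples from `Q`. -/
def hiddenNull {ι : Type} (M : ℕ) (Q : Measure (ι → ℝ)) : Measure (Fin M × ι → ℝ) :=
  (Measure.pi (fun _ : Fin M => Q)).map (fun y p => y p.1 p.2)

/-- Planted law of the hidden informative sample problem: for a uniformly random `κ`, the `κ`-th
sample is drawn from `P` and the others from `Q`, independently. -/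
def hiddenPlanted {ι : Type} (M : ℕ) (P Q : Measure (ι → ℝ)) : Measure (Fin M × ι → ℝ) :=
  (M : ℝ≥0∞)⁻¹ • ∑ κ : Fin M,
    (Measure.pi (Function.update (fun _ : Fin M => Q) κ P)).map (fun y p => y p.1 p.2)

/-! ### Orthogonal group synchronization -/

/-- The orthogonal group `O(d)`. -/
abbrev O (d : ℕ) : Type := Matrix.orthogonalGroup (Fin d) ℝ

instance (d : ℕ) : MeasurableSpace (O d) := borel _

instance (d : ℕ) : BorelSpace (O d) := ⟨rfl⟩

instance (d : ℕ) : CompactSpace (O d) := by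
  apply isCompact_iff_compactSpace.mp
  have hb : IsCompact (Set.pi Set.univ fun _ : Fin d => Set.pi Set.univ fun _ : Fin d =>
      Set.Icc (-1 : ℝ) 1) :=
    isCompact_univ_pi fun _ => isCompact_univ_pi fun _ => isCompact_Icc
  refine IsCompact.of_isClosed_subset hb ?_ ?_
  · have : (Matrix.orthogonalGroup (Fin d) ℝ : Set (Matrix (Fin d) (Fin d) ℝ)) =
        {A | A * A.transpose = 1} := by
      ext A
      exact Matrix.mem_orthogonalGroup_iff (Fin d) ℝ
    rw [this]
    exact isClosed_eq (by fun_prop) continuous_const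
  · intro A hA i _ j _
    have h := entry_norm_bound_of_unitary (𝕜 := ℝ) hA i j
    exact abs_le.mp h

/-- The uniform distribution on `O(d)`: the Haar measure of total mass one. -/
def haarO (d : ℕ) : Measure (O d) := Measure.haarMeasure ⊤

/-- Positions in an `nd × nd` matrix, addressed by block and by place in the block. -/
abbrev Pos (n d : ℕ) : Type := (Fin n × Fin d) × (Fin n × Fin d)

/-- The signal `Θ = (λ / √n) Uᵀ U` with `U = (O₁, …, Oₙ)`; its block `(i,j)` is
`(λ / √n) Oᵢᵀ Oⱼ`. -/
def signal {n d : ℕ} (lam : ℝ) (U : Fin n → O d) : Pos n d → ℝ :=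
  fun p => lam / Real.sqrt n *
    ((U p.1.1 : Matrix (Fin d) (Fin d) ℝ).transpose *
      (U p.2.1 : Matrix (Fin d) (Fin d) ℝ)) p.1.2 p.2.2

/-- Symmetrization: for `G` with independent standard Gaussian entries, `(G + Gᵀ) / √(2d)` is a
symmetric Gaussian matrix with independent entries on and above the diagonal, of variance `1 / d`
off the diagonal and `2 / d` on it. -/
def noise {n d : ℕ} (G : Pos n d → ℝ) : Pos n d → ℝ :=
  fun p => (G p + G p.swap) / Real.sqrt (2 * d)

/-- Joint law of the group elements and of the Gaussian variables that generate the noise. -/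
def base (n d : ℕ) : Measure ((Fin n → O d) × (Pos n d → ℝ)) :=
  (Measure.pi (fun _ : Fin n => haarO d)).prod (Measure.pi (fun _ : Pos n d => gaussianReal 0 1))

/-- The observation `Y = (λ / √n) Uᵀ U + Z`. -/
def observation {n d : ℕ} (lam : ℝ) (w : (Fin n → O d) × (Pos n d → ℝ)) : Pos n d → ℝ :=
  signal lam w.1 + noise w.2

/-- The law of the observation. -/
def planted (n d : ℕ) (lam : ℝ) : Measure (Pos n d → ℝ) := (base n d).map (observation lam)

/-- The law of the noise alone. -/
def null (n d : ℕ) : Measure (Pos n d → ℝ) :=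
  (Measure.pi (fun _ : Pos n d => gaussianReal 0 1)).map noise

/-- The Frobenius inner product. -/
def frob {ι : Type} [Fintype ι] (X Y : ι → ℝ) : ℝ := ∑ i, X i * Y i

/-- `E[⟨X, Θ⟩ / (‖X‖ ‖Θ‖)]` for the output `X` of an algorithm that is run on the observation. -/
def correlation (n d : ℕ) (lam : ℝ) (A : Algorithm (Pos n d) (Pos n d)) : ℝ :=
  ∫ z, frob (A.output (observation lam z.1) z.2) (signal lam z.1.1) /
      (Real.sqrt (frob (A.output (observation lam z.1) z.2)
          (A.output (observation lam z.1) z.2)) *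
        Real.sqrt (frob (signal lam z.1.1) (signal lam z.1.1)))
    ∂((base n d).prod coins)

/-- Weak recovery as `n → ∞`: the expected correlation is at least a positive constant. -/
def WeakRecovery (d : ℕ → ℕ) (lam : ℕ → ℝ)
    (A : ∀ n, Algorithm (Pos n (d n)) (Pos n (d n))) : Prop :=
  ∃ c : ℝ, 0 < c ∧ ∀ᶠ n in atTop, c ≤ correlation n (d n) (lam n) (A n)

/-- `a n = n^{o(1)}` as an upper bound. -/
def Subpolynomial (a : ℕ → ℝ) : Prop :=
  ∀ ε : ℝ, 0 < ε → ∀ᶠ n : ℕ in atTop, a n ≤ (n : ℝ) ^ ε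

/-- The low-degree heuristic along `l` for the hidden informative sample problems that are built
from orthogonal group synchronization: for every constant signal-to-noise ratio in `(0,1)` and
every number `M n = exp (n^{o(1)})` of samples. -/
def HeuristicForSync (l : Filter ℕ) (d : ℕ → ℕ) : Prop :=
  ∀ (lam' : ℝ) (M : ℕ → ℕ), 0 < lam' → lam' < 1 → (∀ n, 1 ≤ M n) →
    Subpolynomial (fun n => Real.log (M n)) →
    LowDegreeHeuristic l
      (fun n => hiddenPlanted (M n) (planted n (d n) lam') (null n (d n)))
      (fun n => hiddenNull (M n) (null n (d n)))

end OrthSync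

end

open Filter Topology MeasureTheory ProbabilityTheory
open scoped ENNReal

noncomputable section

namespace OrthSync

/-! ### Polynomials of Gaussian variables -/

/-! The proof reduces testing to estimation. Put λ' = 1 - δ/2, so that λ < λ'² and a = λ/λ' < λ',
and let b = √(1 - a²). Given a sample Y at strength λ' and fresh noise Z', the matrices aY - bZ' and
bY + aZ' have independent noises, because Gaussian vectors are rotation invariant; the first is
exactly an observation of strength aλ' = λ, the second carries the signal bΘ. Run the estimator on
the first and correlate its output X with the second. If Y is pure noise, this correlation is, given
X, a centred Gaussian of standard deviation at most ‖X‖√(2/d); if Y is planted, then with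
probability at least c/2 its mean is of order √(nd)‖X‖. A threshold in between is crossed by noise
with probability exp(-Ω(n)) only, which survives a union bound over M = exp(n^{o(1)}) samples.
Accepting when some sample passes therefore has total error at most 1 - c/4 for large n
(`exists_test_of_correlation`), in about M times the running time of the estimator.

This is weak detection, and it contradicts the second clause of the heuristic as soon as the
advantage of degree D ≈ n^{1/4} is 1 + o(1): that clause excludes time exp(D/C), which exceeds exp(3
n^{1/8}) for large n. The hidden sample problem is a Gaussian vector with an independent random
shift H, for which Adv² ≤ ∑_{k ≤ D} E⟨H,H'⟩^k / k! (`sq_integral_shift_le`: Cauchy–Schwarz in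
Segal–Bargmann coordinates). Two shifts overlap only if their positions agree, so every term with k
≥ 1 is divided by M (`lowDegAdv_hidden_le`). The moments thus need not be bounded, only small
compared to M: they are at most 2e²k(1-λ')^{-d²/2} when 8d²k³ ≤ n (`overlapMoment_le`), so M =
(n+1)^{d²+1} is enough, and log M = n^{o(1)} because d = n^{o(1)}.

For the moments, ⟨Θ,Θ'⟩ is a multiple of the squared norm of the d × d matrix ∑ Oᵢ Oᵢ'ᵀ, and a power
of a squared norm is, up to a constant, the Gaussian average over g of an even power of a linear
form with coefficients g. For fixed g and Oᵢ this form is a sum of n independent centred terms of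
variance ‖g‖²/d, with exponential moments that are Gaussian with the sharp constant 1/2 up to a
small error (`integral_exp_pairO_le`). The remaining Gaussian integral over g is finite for every
strength below 1; the sharp constant is what reaches that threshold. -/

lemma integrable_pow_gaussianReal (m : ℕ) : Integrable (fun x : ℝ => x ^ m) (gaussianReal 0 1) := by
  rcases Nat.eq_zero_or_pos m with rfl | hm
  · simp
  have h := (memLp_id_gaussianReal (μ := 0) (v := 1) (m : NNReal)).integrable_norm_pow
    (by simpa using hm.ne')
  refine (integrable_norm_iff (by fun_prop)).1 ?_
  simpa using h

lemma integrable_polynomial_gaussianReal (q : Polynomial ℝ) :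
    Integrable (fun x : ℝ => q.eval x) (gaussianReal 0 1) := by
  simp only [Polynomial.eval_eq_sum, Polynomial.sum]
  exact integrable_finsetSum _ fun i _ => (integrable_pow_gaussianReal i).const_mul _

/-- Passes to Lebesgue measure, where integration by parts on the line takes place. -/
lemma integrable_gaussianReal_iff {f : ℝ → ℝ} :
    Integrable f (gaussianReal 0 1) ↔ Integrable (fun x => gaussianPDFReal 0 1 x * f x) := by
  rw [gaussianReal_of_var_ne_zero 0 one_ne_zero, integrable_withDensity_iff_integrable_smul'
    (measurable_gaussianPDF 0 1) (by simp [gaussianPDF_lt_top])]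
  simp [toReal_gaussianPDF]

lemma hasDerivAt_gaussianPDFReal (x : ℝ) :
    HasDerivAt (gaussianPDFReal 0 1) (-(x * gaussianPDFReal 0 1 x)) x := by
  rw [gaussianPDFReal_def]
  have h : HasDerivAt (fun x : ℝ => -(x - 0) ^ 2 / (2 * ((1 : NNReal) : ℝ))) (-x) x := by
    have := (((hasDerivAt_id x).sub_const 0).pow 2).neg.div_const (2 * ((1 : NNReal) : ℝ))
    refine this.congr_deriv ?_
    simp
    ring
  refine (h.exp.const_mul (Real.sqrt (2 * Real.pi * ((1 : NNReal) : ℝ)))⁻¹).congr_deriv ?_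
  ring

/-- Gaussian integration by parts for polynomials. -/
lemma integral_mul_polynomial_gaussianReal (q : Polynomial ℝ) :
    ∫ x, x * q.eval x ∂gaussianReal 0 1 = ∫ x, q.derivative.eval x ∂gaussianReal 0 1 := by
  rw [integral_gaussianReal_eq_integral_smul one_ne_zero,
    integral_gaussianReal_eq_integral_smul one_ne_zero]
  -- The density satisfies `φ' = -xφ`, so `x q φ` is `-q φ'`. The three side goals are integrability
  -- of polynomials against `φ`.
  have h := integral_mul_deriv_eq_deriv_mul_of_integrable (u := fun x => q.eval x)
    (v := gaussianPDFReal 0 1) (fun x _ => q.hasDerivAt x)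
    (fun x _ => hasDerivAt_gaussianPDFReal x) ?_ ?_ ?_
  · simp only [smul_eq_mul]
    rw [← neg_inj, ← integral_neg]
    calc _ = ∫ x, q.eval x * -(x * gaussianPDFReal 0 1 x) := by congr 1; ext x; ring
      _ = _ := by rw [h]; congr 2; ext x; ring
  · have := (integrable_gaussianReal_iff.1
      (integrable_polynomial_gaussianReal (Polynomial.X * q))).neg
    refine this.congr (.of_forall fun x => ?_)
    simp; ring
  · have := (integrable_gaussianReal_iff.1 (integrable_polynomial_gaussianReal q.derivative))
    refine this.congr (.of_forall fun x => ?_)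
    simp; ring
  · have := (integrable_gaussianReal_iff.1 (integrable_polynomial_gaussianReal q))
    refine this.congr (.of_forall fun x => ?_)
    simp; ring

/-- The polynomials `h ↦ E (g + h) ^ m` for a standard Gaussian `g`. -/
def shiftMoment : ℕ → Polynomial ℝ
  | 0 => 1
  | m + 1 => Polynomial.X * shiftMoment m + (shiftMoment m).derivative

/-- The Appell property; these are the Hermite polynomials with all signs made positive. It
identifies the derivative in the recursion with a lower moment. -/
lemma derivative_shiftMoment (m : ℕ) :
    (shiftMoment (m + 1)).derivative = Polynomial.C (m + 1 : ℝ) * shiftMoment m := by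
  induction m with
  | zero => simp [shiftMoment]
  | succ m ih =>
    rw [shiftMoment, Polynomial.derivative_add, Polynomial.derivative_mul, ih,
      Polynomial.derivative_C_mul, Polynomial.derivative_X]
    conv_rhs => rw [shiftMoment]
    conv_lhs => rw [shiftMoment]
    simp only [Nat.cast_add, Nat.cast_one, map_add, map_one]
    ring

lemma natDegree_shiftMoment_le (m : ℕ) : (shiftMoment m).natDegree ≤ m := by
  induction m with
  | zero => simp [shiftMoment]
  | succ m ih =>
    refine (Polynomial.natDegree_add_le _ _).trans (max_le ?_ ?_)
    · refine Polynomial.natDegree_mul_le.trans ?_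
      have := Polynomial.natDegree_X_le (R := ℝ)
      omega
    · exact (Polynomial.natDegree_derivative_le _).trans (by omega)

/-- Split off one factor `x + h`: integration by parts turns the `x` part into a derivative, the `h`
part is the previous moment, and together they reproduce the recursion. Strong induction, since the
derivative lowers the power once more. -/
lemma integral_add_pow_gaussianReal (h : ℝ) (m : ℕ) :
    ∫ x, (x + h) ^ m ∂gaussianReal 0 1 = (shiftMoment m).eval h := by
  induction m using Nat.strong_induction_on with
  | _ m ih =>
    rcases m with _ | m
    · simp [shiftMoment]
    have e : ∀ x : ℝ, (x + h) ^ (m + 1) = x * ((Polynomial.X + Polynomial.C h) ^ m).eval x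
        + h * ((Polynomial.X + Polynomial.C h) ^ m).eval x := fun x => by simp; ring
    have i2 := integrable_polynomial_gaussianReal ((Polynomial.X + Polynomial.C h) ^ m)
    have i1 := integrable_polynomial_gaussianReal
      (Polynomial.X * (Polynomial.X + Polynomial.C h) ^ m)
    simp only [Polynomial.eval_mul, Polynomial.eval_X] at i1
    simp_rw [e]
    rw [integral_add i1 (i2.const_mul h), integral_mul_polynomial_gaussianReal,
      integral_const_mul]
    have hm := ih m (by omega)
    simp only [Polynomial.eval_pow, Polynomial.eval_add, Polynomial.eval_X, Polynomial.eval_C]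
    rw [hm]
    have : ∫ x, (Polynomial.derivative ((Polynomial.X + Polynomial.C h) ^ m)).eval x
        ∂gaussianReal 0 1 = (shiftMoment m).derivative.eval h := by
      rcases m with _ | m
      · simp [shiftMoment]
      · rw [derivative_shiftMoment, Polynomial.eval_C_mul, ← ih m (by omega),
          ← integral_const_mul]
        congr 1; ext x
        simp [Polynomial.derivative_pow]
    rw [this]
    simp [shiftMoment]
    ring

/-- The standard Gaussian measure on `ℝ^ι`. -/
abbrev gaussPi (ι : Type) [Fintype ι] : Measure (ι → ℝ) :=
  Measure.pi (fun _ : ι => gaussianReal 0 1)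

/-! ### The Segal–Bargmann transform as an isometry onto Fock space -/

section Fock

variable {ι : Type} [Fintype ι]

lemma integrable_mvPolynomial_gaussPi (p : MvPolynomial ι ℝ) :
    Integrable (fun x => MvPolynomial.eval x p) (gaussPi ι) := by
  simp only [MvPolynomial.eval_eq']
  exact integrable_finsetSum _ fun α _ =>
    (Integrable.fintype_prod fun i => integrable_pow_gaussianReal (α i)).const_mul _

/-- The polynomial `H ↦ E p(g + H)`, for a standard Gaussian vector `g`. -/
def segalBargmann : MvPolynomial ι ℝ →ₗ[ℝ] MvPolynomial ι ℝ :=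
  (MvPolynomial.basisMonomials ι ℝ).constr ℝ
    (fun α => ∏ i, Polynomial.aeval (MvPolynomial.X i) (shiftMoment (α i)))

lemma segalBargmann_monomial (α : ι →₀ ℕ) (c : ℝ) :
    segalBargmann (MvPolynomial.monomial α c) =
      c • ∏ i, Polynomial.aeval (MvPolynomial.X i) (shiftMoment (α i)) := by
  have : MvPolynomial.monomial α c = c • MvPolynomial.basisMonomials ι ℝ α := by
    simp [MvPolynomial.smul_monomial]
  rw [this, map_smul, segalBargmann, Module.Basis.constr_basis]

lemma segalBargmann_C (c : ℝ) :
    segalBargmann (MvPolynomial.C c : MvPolynomial ι ℝ) = MvPolynomial.C c := by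
  rw [← MvPolynomial.monomial_zero', segalBargmann_monomial]
  simp [shiftMoment, MvPolynomial.smul_eq_C_mul]

/-- Each power of a variable becomes a polynomial in that variable of no larger degree. This
confines the later Cauchy–Schwarz sum to multi-indices of order at most `D`. -/
lemma totalDegree_segalBargmann_le (p : MvPolynomial ι ℝ) :
    (segalBargmann p).totalDegree ≤ p.totalDegree := by
  conv_lhs => rw [p.as_sum, map_sum]
  refine MvPolynomial.totalDegree_finsetSum_le fun α hα => ?_
  rw [segalBargmann_monomial]
  refine (MvPolynomial.totalDegree_smul_le _ _).trans ?_
  refine (MvPolynomial.totalDegree_finsetProd _ _).trans ?_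
  refine le_trans (Finset.sum_le_sum fun i _ => ?_)
    ((α.sum_fintype (fun _ e => e) (by simp)).ge.trans (MvPolynomial.le_totalDegree hα))
  refine le_trans ?_ (natDegree_shiftMoment_le (α i))
  rw [Polynomial.aeval_eq_sum_range]
  refine MvPolynomial.totalDegree_finsetSum_le fun j hj => ?_
  refine (MvPolynomial.totalDegree_smul_le _ _).trans ?_
  refine (MvPolynomial.totalDegree_pow _ _).trans ?_
  rw [MvPolynomial.totalDegree_X]
  have := Finset.mem_range.1 hj
  omega

/-- By linearity a monomial suffices, and there independence of the coordinates reduces the claim to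
one-dimensional moments. -/
lemma eval_segalBargmann (H : ι → ℝ) (p : MvPolynomial ι ℝ) :
    MvPolynomial.eval H (segalBargmann p) = ∫ x, MvPolynomial.eval (x + H) p ∂gaussPi ι := by
  have key : ∀ α : ι →₀ ℕ, Integrable (fun x : ι → ℝ => ∏ i, (x i + H i) ^ α i) (gaussPi ι) := by
    intro α
    refine Integrable.fintype_prod (f := fun i (t : ℝ) => (t + H i) ^ α i) fun i => ?_
    refine (integrable_polynomial_gaussianReal
      ((Polynomial.X + Polynomial.C (H i)) ^ α i)).congr (.of_forall fun x => ?_)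
    simp
  simp only [MvPolynomial.eval_eq' _ p, Pi.add_apply]
  rw [integral_finsetSum _ fun α _ => (key α).const_mul _]
  conv_lhs => rw [p.as_sum, map_sum, map_sum]
  refine Finset.sum_congr rfl fun α _ => ?_
  rw [segalBargmann_monomial, integral_const_mul,
    integral_fintype_prod_eq_prod (f := fun i (t : ℝ) => (t + H i) ^ α i),
    MvPolynomial.smul_eval, map_prod]
  congr 1
  refine Finset.prod_congr rfl fun i _ => ?_
  rw [integral_add_pow_gaussianReal, Polynomial.aeval_def, Polynomial.hom_eval₂]
  have : (MvPolynomial.eval H).comp MvPolynomial.C = RingHom.id ℝ := by ext; simp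
  simp [Polynomial.eval₂_eq_eval_map, MvPolynomial.algebraMap_eq, this]

omit [Fintype ι] in
open Classical in
lemma pderiv_aeval_X (i j : ι) (q : Polynomial ℝ) :
    MvPolynomial.pderiv j (Polynomial.aeval (MvPolynomial.X i : MvPolynomial ι ℝ) q) =
      if i = j then Polynomial.aeval (MvPolynomial.X i) q.derivative else 0 := by
  rw [Derivation.map_aeval]
  split_ifs with h
  · subst h; simp
  · simp [MvPolynomial.pderiv_X_of_ne h]

/-- Creation plus annihilation: the recursion of `shiftMoment` in the variable `j`, the other
factors of a monomial being constants for `∂ⱼ`. -/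
lemma segalBargmann_X_mul (j : ι) (p : MvPolynomial ι ℝ) :
    segalBargmann (MvPolynomial.X j * p) =
      MvPolynomial.X j * segalBargmann p + MvPolynomial.pderiv j (segalBargmann p) := by
  classical
  induction p using MvPolynomial.induction_on' with
  | add p q hp hq => simp only [mul_add, map_add, hp, hq]; ring
  | monomial α c =>
    rw [MvPolynomial.X, MvPolynomial.monomial_mul, segalBargmann_monomial, segalBargmann_monomial]
    rw [← Finset.mul_prod_erase _ _ (Finset.mem_univ j),
      ← Finset.mul_prod_erase _ _ (Finset.mem_univ j)]
    have h1 : ∀ i ∈ Finset.univ.erase j,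
        Polynomial.aeval (MvPolynomial.X i : MvPolynomial ι ℝ)
          (shiftMoment ((Finsupp.single j 1 + α : ι →₀ ℕ) i)) =
        Polynomial.aeval (MvPolynomial.X i) (shiftMoment (α i)) := by
      intro i hi
      simp [(Finset.ne_of_mem_erase hi).symm]
    have h2 : MvPolynomial.pderiv j (∏ i ∈ Finset.univ.erase j,
        Polynomial.aeval (MvPolynomial.X i : MvPolynomial ι ℝ) (shiftMoment (α i))) = 0 := by
      refine Finset.prod_induction _ (fun x => MvPolynomial.pderiv j x = 0) ?_ (by simp) ?_
      · intro x y hx hy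
        rw [MvPolynomial.pderiv_mul, hx, hy]; simp
      · intro i hi
        rw [pderiv_aeval_X, if_neg (Finset.ne_of_mem_erase hi)]
    rw [Finset.prod_congr rfl h1, Derivation.map_smul, MvPolynomial.pderiv_mul, h2, pderiv_aeval_X,
      if_pos rfl]
    simp only [Finsupp.add_apply, Finsupp.single_eq_same, add_comm 1, shiftMoment, map_add,
      map_mul, Polynomial.aeval_X, one_mul, MvPolynomial.smul_eq_C_mul]
    rw [← MvPolynomial.X]
    ring

/-- The Fock inner product `∑ α, uₐ vₐ α!` of polynomials. -/
def fock (u v : MvPolynomial ι ℝ) : ℝ :=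
  (MvPolynomial.basisMonomials ι ℝ).constr ℝ
    (fun α => MvPolynomial.coeff α v * ∏ i, ((α i).factorial : ℝ)) u

lemma fock_add_left (u u' v : MvPolynomial ι ℝ) : fock (u + u') v = fock u v + fock u' v :=
  map_add _ _ _

lemma fock_monomial_left (α : ι →₀ ℕ) (c : ℝ) (v : MvPolynomial ι ℝ) :
    fock (MvPolynomial.monomial α c) v =
      c * (MvPolynomial.coeff α v * ∏ i, ((α i).factorial : ℝ)) := by
  have : MvPolynomial.monomial α c = c • MvPolynomial.basisMonomials ι ℝ α := by
    simp [MvPolynomial.smul_monomial]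
  rw [this, fock, map_smul, Module.Basis.constr_basis, smul_eq_mul]

lemma fock_eq_sum (u v : MvPolynomial ι ℝ) :
    fock u v = ∑ α ∈ u.support, MvPolynomial.coeff α u *
      (MvPolynomial.coeff α v * ∏ i, ((α i).factorial : ℝ)) := by
  conv_lhs => rw [u.as_sum, fock, map_sum]
  exact Finset.sum_congr rfl fun α _ => fock_monomial_left _ _ _

lemma fock_add_right (u v v' : MvPolynomial ι ℝ) : fock u (v + v') = fock u v + fock u v' := by
  simp only [fock_eq_sum, MvPolynomial.coeff_add]
  rw [← Finset.sum_add_distrib]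
  exact Finset.sum_congr rfl fun _ _ => by ring

lemma prod_factorial_add_single (α : ι →₀ ℕ) (j : ι) :
    ∏ i, (((α + Finsupp.single j 1 : ι →₀ ℕ) i).factorial : ℝ) =
      (α j + 1) * ∏ i, ((α i).factorial : ℝ) := by
  classical
  rw [← Finset.mul_prod_erase _ _ (Finset.mem_univ j),
    ← Finset.mul_prod_erase Finset.univ (fun i => ((α i).factorial : ℝ)) (Finset.mem_univ j),
    Finset.prod_congr rfl (g := fun i => ((α i).factorial : ℝ))]
  · simp [Nat.factorial_succ, mul_assoc]
  · intro i hi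
    simp [(Finset.ne_of_mem_erase hi).symm]

/-- Adjointness of `Xⱼ` and `∂ⱼ`, from `(α + eⱼ)! = (αⱼ + 1) α!`. -/
lemma fock_X_mul_left (j : ι) (u v : MvPolynomial ι ℝ) :
    fock (MvPolynomial.X j * u) v = fock u (MvPolynomial.pderiv j v) := by
  induction u using MvPolynomial.induction_on' with
  | add p q hp hq => simp only [mul_add, fock_add_left, hp, hq]
  | monomial α c =>
    rw [MvPolynomial.X, MvPolynomial.monomial_mul, fock_monomial_left, fock_monomial_left, one_mul,
      add_comm (Finsupp.single j 1), prod_factorial_add_single, MvPolynomial.coeff_pderiv]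
    ring

lemma fock_comm (u v : MvPolynomial ι ℝ) : fock u v = fock v u := by
  classical
  induction u using MvPolynomial.induction_on' with
  | add p q hp hq => simp only [fock_add_left, fock_add_right, hp, hq]
  | monomial α c =>
    induction v using MvPolynomial.induction_on' with
    | add p q hp hq => simp only [fock_add_left, fock_add_right, hp, hq]
    | monomial β b =>
      rw [fock_monomial_left, fock_monomial_left, MvPolynomial.coeff_monomial,
        MvPolynomial.coeff_monomial]
      by_cases h : α = β
      · subst h; simp; ring
      · simp [h, Ne.symm h]

/-- Multiplication by a coordinate is self-adjoint on the Gaussian side, and its transform `Xⱼ + ∂ⱼ`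
is self-adjoint on the Fock side. So the variables of `p` can be moved to `q` one at a time, until
`p` is constant and only the mean of `q` is left. -/
lemma integral_mul_eq_fock (p q : MvPolynomial ι ℝ) :
    ∫ x, MvPolynomial.eval x (p * q) ∂gaussPi ι = fock (segalBargmann p) (segalBargmann q) := by
  induction p using MvPolynomial.induction_on generalizing q with
  | C a =>
    have h := eval_segalBargmann 0 q
    simp only [add_zero] at h
    simp only [map_mul, MvPolynomial.eval_C, integral_const_mul, ← h]
    rw [segalBargmann_C, ← MvPolynomial.monomial_zero', fock_monomial_left]
    simp [MvPolynomial.eval_zero, MvPolynomial.constantCoeff_eq]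
  | add p p' hp hp' =>
    simp only [add_mul, map_add, fock_add_left, ← hp, ← hp']
    exact integral_add (integrable_mvPolynomial_gaussPi _) (integrable_mvPolynomial_gaussPi _)
  | mul_X p j hp =>
    have h : fock (MvPolynomial.pderiv j (segalBargmann p)) (segalBargmann q) =
        fock (segalBargmann p) (MvPolynomial.X j * segalBargmann q) := by
      rw [fock_comm, ← fock_X_mul_left, fock_comm]
    rw [mul_assoc, hp, mul_comm p, segalBargmann_X_mul, segalBargmann_X_mul, fock_add_left,
      fock_add_right, fock_X_mul_left, h, add_comm]

end Fock

/-! ### Low-degree second moment bound for Gaussian vectors with a random shift -/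

section Mixture

variable {ι : Type} [Fintype ι] {Ω : Type*} [MeasurableSpace Ω] {μ : Measure Ω}

lemma integrable_of_abs_le [IsFiniteMeasure μ] {f : Ω → ℝ} (hf : Measurable f) (B : ℝ)
    (hB : ∀ ω, |f ω| ≤ B) : Integrable f μ :=
  Integrable.of_bound hf.aestronglyMeasurable B (.of_forall hB)

lemma integrable_prod_pow [IsFiniteMeasure μ] {H : Ω → ι → ℝ} (hH : Measurable H) {B : ℝ}
    (hB : ∀ ω i, |H ω i| ≤ B) (α : ι → ℕ) : Integrable (fun ω => ∏ i, H ω i ^ α i) μ := by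
  refine integrable_of_abs_le ?_ (∏ i, B ^ α i) fun ω => ?_
  · exact Finset.measurable_prod _ fun i _ => ((measurable_pi_apply i).comp hH).pow_const _
  · rw [Finset.abs_prod]
    refine Finset.prod_le_prod (fun i _ => abs_nonneg _) fun i _ => ?_
    rw [abs_pow]
    exact pow_le_pow_left₀ (abs_nonneg _) (hB ω i) _

/-- Multinomial theorem: since the two copies are independent, each term integrates to the square of
a single moment, and the multinomial coefficient divided by `k!` is `1 / ∏ (f i)!`. -/
lemma integral_inner_pow [IsProbabilityMeasure μ] {H : Ω → ι → ℝ} (hH : Measurable H) {B : ℝ}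
    (hB : ∀ ω i, |H ω i| ≤ B) (k : ℕ) [DecidableEq ι] :
    (∫ ω, ∫ ω', (∑ i, H ω i * H ω' i) ^ k ∂μ ∂μ) / (k.factorial : ℝ) =
      ∑ f ∈ Finset.univ.piAntidiag k,
        (∫ ω, ∏ i, H ω i ^ f i ∂μ) ^ 2 / ∏ i, ((f i).factorial : ℝ) := by
  have h : ∀ ω ω', (∑ i, H ω i * H ω' i) ^ k = ∑ f ∈ Finset.univ.piAntidiag k,
      (Nat.multinomial Finset.univ f * ∏ i, H ω i ^ f i) * ∏ i, H ω' i ^ f i := by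
    intro ω ω'
    rw [Finset.sum_pow_eq_sum_piAntidiag]
    refine Finset.sum_congr rfl fun f _ => ?_
    rw [mul_assoc, ← Finset.prod_mul_distrib]
    simp only [mul_pow]
  simp_rw [h]
  have h2 : ∀ ω, ∫ ω', ∑ f ∈ Finset.univ.piAntidiag k,
      (Nat.multinomial Finset.univ f * ∏ i, H ω i ^ f i) * ∏ i, H ω' i ^ f i ∂μ =
      ∑ f ∈ Finset.univ.piAntidiag k, (Nat.multinomial Finset.univ f * ∏ i, H ω i ^ f i) *
        ∫ ω', ∏ i, H ω' i ^ f i ∂μ := by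
    intro ω
    rw [integral_finsetSum _ fun f _ => (integrable_prod_pow hH hB f).const_mul _]
    simp only [integral_const_mul]
  simp_rw [h2]
  rw [integral_finsetSum _ fun f _ => ((integrable_prod_pow hH hB f).const_mul _).mul_const _,
    Finset.sum_div]
  refine Finset.sum_congr rfl fun f hf => ?_
  rw [integral_mul_const, integral_const_mul]
  have hs := Nat.multinomial_spec Finset.univ f
  rw [(Finset.mem_piAntidiag.1 hf).1] at hs
  rw [← hs]
  have h1 : (∏ i, ((f i).factorial : ℝ)) ≠ 0 :=
    Finset.prod_ne_zero_iff.2 fun i _ => by exact_mod_cast (f i).factorial_ne_zero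
  have h3 : (Nat.multinomial Finset.univ f : ℝ) ≠ 0 := by
    intro h0
    have h0' : Nat.multinomial Finset.univ f = 0 := by exact_mod_cast h0
    rw [h0', mul_zero] at hs
    exact k.factorial_ne_zero hs.symm
  push_cast
  field_simp

/-- The likelihood-ratio bound on low-degree polynomials of a Gaussian vector with a random,
independent shift. -/
lemma sq_integral_shift_le [IsProbabilityMeasure μ] {H : Ω → ι → ℝ} (hH : Measurable H) {B : ℝ}
    (hB : ∀ ω i, |H ω i| ≤ B) {D : ℕ} {p : MvPolynomial ι ℝ} (hp : p.totalDegree ≤ D) :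
    (∫ ω, ∫ x, MvPolynomial.eval (x + H ω) p ∂gaussPi ι ∂μ) ^ 2 ≤
      (∫ x, MvPolynomial.eval x p ^ 2 ∂gaussPi ι) *
        ∑ k ∈ Finset.range (D + 1),
          (∫ ω, ∫ ω', (∑ i, H ω i * H ω' i) ^ k ∂μ ∂μ) / (k.factorial : ℝ) := by
  classical
  set u := segalBargmann p with hu
  have h1 : ∫ x, MvPolynomial.eval x p ^ 2 ∂gaussPi ι =
      ∑ α ∈ u.support, MvPolynomial.coeff α u ^ 2 * ∏ i, ((α i).factorial : ℝ) := by
    have := integral_mul_eq_fock p p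
    simp only [← pow_two, map_pow] at this
    rw [this, fock_eq_sum]
    exact Finset.sum_congr rfl fun α _ => by ring
  have h2 : ∫ ω, ∫ x, MvPolynomial.eval (x + H ω) p ∂gaussPi ι ∂μ =
      ∑ α ∈ u.support, MvPolynomial.coeff α u * ∫ ω, ∏ i, H ω i ^ α i ∂μ := by
    simp_rw [← eval_segalBargmann, MvPolynomial.eval_eq']
    rw [integral_finsetSum (f := fun (α : ι →₀ ℕ) ω => MvPolynomial.coeff α (segalBargmann p) *
      ∏ i, H ω i ^ α i) _ fun α _ => (integrable_prod_pow hH hB α).const_mul _]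
    simp only [integral_const_mul, hu]
  have hpos : ∀ α : ι → ℕ, (0 : ℝ) < ∏ i, ((α i).factorial : ℝ) := fun α =>
    Finset.prod_pos fun i _ => by exact_mod_cast (α i).factorial_pos
  rw [h1, h2]
  -- Cauchy–Schwarz in Fock coordinates with weights `α!`: one factor is `E p²`, the other no longer
  -- involves `p`.
  refine (Finset.sum_sq_le_sum_mul_sum_of_sq_le_mul u.support
    (f := fun α => MvPolynomial.coeff α u ^ 2 * ∏ i, ((α i).factorial : ℝ))
    (g := fun α => (∫ ω, ∏ i, H ω i ^ α i ∂μ) ^ 2 / ∏ i, ((α i).factorial : ℝ))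
    (fun α _ => mul_nonneg (sq_nonneg _) (hpos α).le)
    (fun α _ => div_nonneg (sq_nonneg _) (hpos α).le) ?_).trans ?_
  · intro α _
    have := (hpos α).ne'
    exact le_of_eq (by field_simp)
  refine mul_le_mul_of_nonneg_left ?_
    (Finset.sum_nonneg fun α _ => mul_nonneg (sq_nonneg _) (hpos α).le)
  simp_rw [integral_inner_pow hH hB]
  -- The terms are nonnegative, so the sum over the support may be enlarged to all multi-indices of
  -- order at most `D`, grouped by order.
  rw [← Finset.sum_biUnion]
  · rw [← Finset.sum_image (s := u.support) (g := fun α : ι →₀ ℕ => (α : ι → ℕ))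
      (f := fun f : ι → ℕ => (∫ ω, ∏ i, H ω i ^ f i ∂μ) ^ 2 / ∏ i, ((f i).factorial : ℝ))
      (DFunLike.coe_injective.injOn)]
    refine Finset.sum_le_sum_of_subset_of_nonneg ?_
      fun f _ _ => div_nonneg (sq_nonneg _) (hpos f).le
    intro f hf
    obtain ⟨α, hα, rfl⟩ := Finset.mem_image.1 hf
    refine Finset.mem_biUnion.2 ⟨∑ i, α i, ?_, by simp⟩
    have := (MvPolynomial.le_totalDegree hα).trans ((totalDegree_segalBargmann_le p).trans hp)
    rw [α.sum_fintype (fun _ e => e) (by simp)] at this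
    exact Finset.mem_range.2 (Nat.lt_succ_of_le this)
  · intro k _ l _ hkl
    refine Finset.disjoint_left.2 fun f hf hf' => hkl ?_
    rw [← (Finset.mem_piAntidiag.1 hf).1, (Finset.mem_piAntidiag.1 hf').1]

end Mixture

/-! ### The hidden informative sample problem as a single Gaussian problem -/

instance (d : ℕ) : IsProbabilityMeasure (haarO d) :=
  ⟨Measure.haarMeasure_self (G := O d) (K₀ := ⊤)⟩

instance (n d : ℕ) : IsProbabilityMeasure (base n d) := by unfold base; infer_instance

lemma measurable_entry {d : ℕ} (a b : Fin d) :
    Measurable (fun V : O d => (V : Matrix (Fin d) (Fin d) ℝ) a b) := by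
  have : Continuous (fun V : O d => (V : Matrix (Fin d) (Fin d) ℝ) a b) :=
    continuous_subtype_val.matrix_elem a b
  exact this.measurable

lemma measurable_signal {n d : ℕ} (lam : ℝ) :
    Measurable (signal lam : (Fin n → O d) → Pos n d → ℝ) := by
  refine measurable_pi_lambda _ fun p => ?_
  simp only [signal, Matrix.mul_apply, Matrix.transpose_apply]
  have h : ∀ i a b, Measurable (fun U : Fin n → O d => (U i : Matrix (Fin d) (Fin d) ℝ) a b) :=
    fun i a b => (measurable_entry a b).comp (measurable_pi_apply i)
  exact Measurable.const_mul (Finset.measurable_fun_sum _ fun c _ => (h _ _ _).fun_mul (h _ _ _)) _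

lemma measurable_noise {n d : ℕ} : Measurable (noise : (Pos n d → ℝ) → Pos n d → ℝ) := by
  unfold noise
  fun_prop

lemma measurable_observation {n d : ℕ} (lam : ℝ) :
    Measurable (observation lam : (Fin n → O d) × (Pos n d → ℝ) → Pos n d → ℝ) :=
  ((measurable_signal lam).comp measurable_fst).add (measurable_noise.comp measurable_snd)

instance (n d : ℕ) (lam : ℝ) : IsProbabilityMeasure (planted n d lam) :=
  Measure.isProbabilityMeasure_map (measurable_observation lam).aemeasurable

instance (n d : ℕ) : IsProbabilityMeasure (null n d) :=
  Measure.isProbabilityMeasure_map measurable_noise.aemeasurable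

lemma signal_swap {n d : ℕ} (lam : ℝ) (U : Fin n → O d) (p : Pos n d) :
    signal lam U p.swap = signal lam U p := by
  simp only [signal, Matrix.mul_apply, Matrix.transpose_apply, Prod.fst_swap, Prod.snd_swap]
  congr 1
  exact Finset.sum_congr rfl fun _ _ => mul_comm _ _

lemma abs_signal_le {n d : ℕ} (lam : ℝ) (U : Fin n → O d) (p : Pos n d) :
    |signal lam U p| ≤ |lam / Real.sqrt n| := by
  rw [signal, abs_mul]
  refine mul_le_of_le_one_right (abs_nonneg _) ?_
  have h : ((U p.1.1 : Matrix (Fin d) (Fin d) ℝ).transpose *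
      (U p.2.1 : Matrix (Fin d) (Fin d) ℝ)) ∈ Matrix.orthogonalGroup (Fin d) ℝ := by
    have := mul_mem (Unitary.star_mem (U p.1.1).2) (U p.2.1).2
    rwa [Matrix.star_eq_conjTranspose, Matrix.conjTranspose_eq_transpose_of_trivial] at this
  exact entry_norm_bound_of_unitary (𝕜 := ℝ) h _ _

/-- The noise of all samples of the hidden informative sample problem. -/
def noises {n d M : ℕ} (x : Fin M × Pos n d → ℝ) : Fin M × Pos n d → ℝ :=
  fun q => noise (fun p => x (q.1, p)) q.2

lemma measurable_noises {n d M : ℕ} :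
    Measurable (noises : (Fin M × Pos n d → ℝ) → Fin M × Pos n d → ℝ) := by
  unfold noises noise
  fun_prop

/-- The signal that, put into sample `κ`, yields the planted law after symmetrization. -/
def shift {n d M : ℕ} (lam : ℝ) (z : Fin M × (Fin M → Fin n → O d)) :
    Fin M × Pos n d → ℝ :=
  fun q => if q.1 = z.1 then Real.sqrt (d / 2) * signal lam (z.2 q.1) q.2 else 0

/-- The signal is symmetric, so symmetrization doubles it, and `2 √(d/2) = √(2d)` is the divisor in
`noise`. Shifting the independent Gaussians before symmetrization thus plants exactly `signal lam`.
-/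
lemma noises_add_shift {n d M : ℕ} (hd : 1 ≤ d) (lam : ℝ)
    (z : Fin M × (Fin M → Fin n → O d)) (x : Fin M × Pos n d → ℝ) (q : Fin M × Pos n d) :
    noises (x + shift lam z) q =
      if q.1 = z.1 then observation lam (z.2 q.1, fun p => x (q.1, p)) q.2
        else noise (fun p => x (q.1, p)) q.2 := by
  have hd' : (0 : ℝ) < d := by exact_mod_cast hd
  have hs : Real.sqrt (d / 2) * 2 = Real.sqrt (2 * d) := by
    rw [show (2 : ℝ) * d = d / 2 * 2 ^ 2 by ring, Real.sqrt_mul (by positivity),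
      Real.sqrt_sq (by norm_num)]
  have hs' : Real.sqrt (2 * d) ≠ 0 := (Real.sqrt_pos.2 (by positivity)).ne'
  simp only [noises, noise, shift, Pi.add_apply, observation]
  split_ifs with h
  · rw [signal_swap, div_eq_iff hs', add_mul, div_mul_cancel₀ _ hs', ← hs]
    ring
  · simp

/-- The joint law of the position of the informative sample and of the group elements. -/
def hiddenLaw (n d M : ℕ) : Measure (Fin M × (Fin M → Fin n → O d)) :=
  (M : ℝ≥0∞)⁻¹ • ∑ κ : Fin M,
    (Measure.pi fun _ : Fin M => Measure.pi fun _ : Fin n => haarO d).map (fun U => (κ, U))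

instance (n d M : ℕ) [NeZero M] : IsProbabilityMeasure (hiddenLaw n d M) := by
  constructor
  have h : ∀ κ : Fin M, ((Measure.pi fun _ : Fin M => Measure.pi fun _ : Fin n => haarO d).map
      (fun U => (κ, U))) Set.univ = 1 := fun κ => by
    rw [Measure.map_apply measurable_prodMk_left MeasurableSet.univ]
    simp
  simp only [hiddenLaw, Measure.smul_apply, Measure.coe_finsetSum, Finset.sum_apply, h, smul_eq_mul]
  simp [ENNReal.inv_mul_cancel, NeZero.ne]

/-- Regrouping that presents the noise of all samples as one standard Gaussian vector, independent
of all group elements. -/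
lemma map_pi_base (n d M : ℕ) :
    (Measure.pi fun _ : Fin M => base n d).map
      (fun w => ((fun j => (w j).1, fun q => (w q.1).2 q.2) :
        (Fin M → Fin n → O d) × (Fin M × Pos n d → ℝ))) =
      (Measure.pi fun _ : Fin M => Measure.pi fun _ : Fin n => haarO d).prod
        (gaussPi (Fin M × Pos n d)) := by
  have h1 := measurePreserving_arrowProdEquivProdArrow (Fin n → O d) (Pos n d → ℝ) (Fin M)
    (fun _ => Measure.pi fun _ : Fin n => haarO d) (fun _ => gaussPi (Pos n d))
  have h2 : MeasurePreserving (fun (G : Fin M → Pos n d → ℝ) (q : Fin M × Pos n d) => G q.1 q.2)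
      (Measure.pi fun _ : Fin M => gaussPi (Pos n d)) (gaussPi (Fin M × Pos n d)) := by
    refine ⟨by fun_prop, ?_⟩
    have := Measure.infinitePi_map_curry_symm (fun (_ : Fin M) (_ : Pos n d) => gaussianReal 0 1)
    simp only [Measure.infinitePi_eq_pi] at this
    exact this
  exact (((MeasurePreserving.id _).prod h2).comp h1).map_eq

/-- Every sample is given its own group elements, which the uninformative ones ignore. All
coordinates are then images of the same law `base`, and the product can be regrouped. -/
lemma pi_update_planted (n d M : ℕ) (hd : 1 ≤ d) (lam : ℝ) (κ : Fin M) :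
    (Measure.pi (Function.update (fun _ : Fin M => null n d) κ (planted n d lam))).map
      (fun y (q : Fin M × Pos n d) => y q.1 q.2) =
    ((Measure.pi fun _ : Fin M => Measure.pi fun _ : Fin n => haarO d).prod
        (gaussPi (Fin M × Pos n d))).map (fun z => noises (z.2 + shift lam (κ, z.1))) := by
  have hn : null n d = (base n d).map (fun w => noise w.2) := by
    have := (measurePreserving_snd (μ := Measure.pi fun _ : Fin n => haarO d)
      (ν := gaussPi (Pos n d))).map_eq
    rw [null]
    change (gaussPi (Pos n d)).map noise = _
    rw [← this, Measure.map_map measurable_noise measurable_snd]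
    rfl
  have hf : ∀ j : Fin M, Measurable (fun w : (Fin n → O d) × (Pos n d → ℝ) =>
      if j = κ then observation lam w else noise w.2) := by
    intro j
    split_ifs
    · exact measurable_observation lam
    · exact measurable_noise.comp measurable_snd
  have hu : Function.update (fun _ : Fin M => null n d) κ (planted n d lam) = fun j =>
      (base n d).map (fun w => if j = κ then observation lam w else noise w.2) := by
    funext j
    by_cases h : j = κ
    · subst h; simp [planted]
    · simp [h, hn]
  have : ∀ j : Fin M, IsProbabilityMeasure ((base n d).map (fun w : (Fin n → O d) ×
      (Pos n d → ℝ) => if j = κ then observation lam w else noise w.2)) :=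
    fun j => Measure.isProbabilityMeasure_map (hf j).aemeasurable
  have hm : Measurable (fun z : (Fin M → Fin n → O d) × (Fin M × Pos n d → ℝ) =>
      noises (z.2 + shift lam (κ, z.1))) := by
    refine measurable_noises.comp (measurable_snd.add (measurable_pi_lambda _ fun q => ?_))
    simp only [shift]
    split_ifs
    · exact (((measurable_pi_apply q.2).comp (measurable_signal lam)).comp
        ((measurable_pi_apply q.1).comp measurable_fst)).const_mul _
    · exact measurable_const
  rw [hu, ← Measure.pi_map_pi (fun j => (hf j).aemeasurable), ← map_pi_base,
    Measure.map_map (by fun_prop) (measurable_pi_lambda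
      (fun (w : Fin M → (Fin n → O d) × (Pos n d → ℝ)) (j : Fin M) =>
        if j = κ then observation lam (w j) else noise (w j).2) fun j =>
      (hf j).comp (measurable_pi_apply j)),
    Measure.map_map hm (by fun_prop)]
  congr 1
  funext w q
  simp only [Function.comp]
  rw [noises_add_shift hd]
  split_ifs <;> rfl

lemma hiddenNull_eq (n d M : ℕ) :
    hiddenNull M (null n d) = (gaussPi (Fin M × Pos n d)).map noises := by
  have h2 : (Measure.pi fun _ : Fin M => gaussPi (Pos n d)).map
      (fun (G : Fin M → Pos n d → ℝ) (q : Fin M × Pos n d) => G q.1 q.2) =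
      gaussPi (Fin M × Pos n d) := by
    have := Measure.infinitePi_map_curry_symm (fun (_ : Fin M) (_ : Pos n d) => gaussianReal 0 1)
    simp only [Measure.infinitePi_eq_pi] at this
    exact this
  have : IsProbabilityMeasure ((gaussPi (Pos n d)).map noise) :=
    Measure.isProbabilityMeasure_map measurable_noise.aemeasurable
  rw [hiddenNull, null, ← Measure.pi_map_pi (fun j => measurable_noise.aemeasurable), ← h2,
    Measure.map_map (by fun_prop) (measurable_pi_lambda
      (fun (w : Fin M → Pos n d → ℝ) (j : Fin M) => noise (w j)) fun j =>
      measurable_noise.comp (measurable_pi_apply j)),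
    Measure.map_map measurable_noises (by fun_prop)]
  rfl

/-! ### The low-degree advantage of the hidden informative sample problem -/

lemma integrable_abs_add_pow_gaussianReal (B : ℝ) (m : ℕ) :
    Integrable (fun x : ℝ => (|x| + |B|) ^ m) (gaussianReal 0 1) := by
  rcases Nat.eq_zero_or_pos m with rfl | hm
  · simp
  have h := (((memLp_id_gaussianReal (μ := 0) (v := 1) (m : NNReal)).norm).add
    (memLp_const |B|)).integrable_norm_pow (by simpa using hm.ne')
  refine h.congr (.of_forall fun x => ?_)
  simp [abs_of_nonneg (add_nonneg (abs_nonneg x) (abs_nonneg B))]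

/-- Each monomial is dominated by `∏ (|xᵢ| + |B|) ^ αᵢ`, which does not involve the shift. -/
lemma integrable_eval_add {ι Ω : Type} [Fintype ι] [MeasurableSpace Ω] {μ : Measure Ω}
    [IsProbabilityMeasure μ] {H : Ω → ι → ℝ} (hH : Measurable H) {B : ℝ}
    (hB : ∀ ω i, |H ω i| ≤ B) (p : MvPolynomial ι ℝ) :
    Integrable (fun z : Ω × (ι → ℝ) => MvPolynomial.eval (z.2 + H z.1) p)
      (μ.prod (gaussPi ι)) := by
  have hm : ∀ α : ι →₀ ℕ, Measurable (fun z : Ω × (ι → ℝ) => ∏ i, (z.2 + H z.1) i ^ α i) := by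
    intro α
    refine Finset.measurable_fun_prod _ fun i _ => ?_
    exact ((measurable_pi_apply i).comp (measurable_snd.add (hH.comp measurable_fst))).pow_const _
  simp only [MvPolynomial.eval_eq']
  refine integrable_finsetSum _ fun α _ => Integrable.const_mul ?_ _
  have hi : Integrable (fun z : Ω × (ι → ℝ) => ∏ i, (|z.2 i| + |B|) ^ α i)
      (μ.prod (gaussPi ι)) :=
    Integrable.comp_snd (f := fun x : ι → ℝ => ∏ i, (|x i| + |B|) ^ α i)
      (Integrable.fintype_prod fun i => integrable_abs_add_pow_gaussianReal B (α i)) μ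
  refine hi.mono' (hm α).aestronglyMeasurable (.of_forall fun z => ?_)
  rw [Real.norm_eq_abs, Finset.abs_prod]
  refine Finset.prod_le_prod (fun i _ => abs_nonneg _) fun i _ => ?_
  rw [abs_pow]
  refine pow_le_pow_left₀ (abs_nonneg _) ((abs_add_le _ _).trans ?_) _
  exact add_le_add le_rfl ((hB _ _).trans (le_abs_self B))

/-- `E (d/2 ⟨Θ, Θ'⟩) ^ k` for independent copies `Θ`, `Θ'` of the signal. -/
def overlapMoment (n d : ℕ) (lam : ℝ) (k : ℕ) : ℝ :=
  ∫ U : Fin n → O d, ∫ U' : Fin n → O d,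
    ((d : ℝ) / 2 * frob (signal lam U) (signal lam U')) ^ k
      ∂Measure.pi (fun _ => haarO d) ∂Measure.pi (fun _ => haarO d)

lemma measurable_shift {n d M : ℕ} (lam : ℝ) :
    Measurable (shift lam : Fin M × (Fin M → Fin n → O d) → Fin M × Pos n d → ℝ) := by
  refine measurable_pi_lambda _ fun q => ?_
  refine Measurable.ite (measurableSet_eq_fun measurable_const measurable_fst) ?_ measurable_const
  exact (((measurable_pi_apply q.2).comp (measurable_signal lam)).comp
    ((measurable_pi_apply q.1).comp measurable_snd)).const_mul _

lemma abs_shift_le {n d M : ℕ} (lam : ℝ) (z : Fin M × (Fin M → Fin n → O d))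
    (q : Fin M × Pos n d) : |shift lam z q| ≤ Real.sqrt (d / 2) * |lam / Real.sqrt n| := by
  simp only [shift]
  split_ifs
  · rw [abs_mul, abs_of_nonneg (Real.sqrt_nonneg _)]
    exact mul_le_mul_of_nonneg_left (abs_signal_le lam _ _) (Real.sqrt_nonneg _)
  · rw [abs_zero]; positivity

/-- Shifts placed in different samples have disjoint supports; this orthogonality is the origin of
the factor `1 / M`. -/
lemma sum_shift_mul_shift {n d M : ℕ} (lam : ℝ) (z z' : Fin M × (Fin M → Fin n → O d)) :
    ∑ q, shift lam z q * shift lam z' q =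
      if z.1 = z'.1 then (d : ℝ) / 2 * frob (signal lam (z.2 z.1)) (signal lam (z'.2 z.1))
        else 0 := by
  have hs : Real.sqrt ((d : ℝ) / 2) * Real.sqrt (d / 2) = d / 2 :=
    Real.mul_self_sqrt (by positivity)
  rw [Fintype.sum_prod_type, Finset.sum_eq_single z.1]
  · split_ifs with h
    · rw [← hs, frob, Finset.mul_sum]
      refine Finset.sum_congr rfl fun p _ => ?_
      simp only [shift, if_true, if_pos h]
      ring
    · exact Finset.sum_eq_zero fun p _ => by simp [shift, h]
  · intro j _ hj
    exact Finset.sum_eq_zero fun p _ => by simp [shift, hj]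
  · simp

lemma integral_hiddenLaw {n d M : ℕ} {f : Fin M × (Fin M → Fin n → O d) → ℝ}
    (hf : Measurable f) {B : ℝ} (hB : ∀ z, |f z| ≤ B) :
    ∫ z, f z ∂hiddenLaw n d M = (M : ℝ)⁻¹ * ∑ κ : Fin M, ∫ U : Fin M → Fin n → O d, f (κ, U)
      ∂Measure.pi fun _ => Measure.pi fun _ => haarO d := by
  rw [hiddenLaw, integral_smul_measure, integral_finsetSum_measure]
  · simp only [ENNReal.toReal_inv, ENNReal.toReal_natCast, smul_eq_mul]
    congr 1
    refine Finset.sum_congr rfl fun κ _ => ?_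
    exact integral_map measurable_prodMk_left.aemeasurable hf.aestronglyMeasurable
  · intro κ _
    have : IsProbabilityMeasure ((Measure.pi fun _ : Fin M => Measure.pi fun _ : Fin n =>
        haarO d).map (fun U => (κ, U))) :=
      Measure.isProbabilityMeasure_map measurable_prodMk_left.aemeasurable
    exact integrable_of_abs_le hf B hB

lemma abs_frob_signal_le {n d : ℕ} (lam : ℝ) (U U' : Fin n → O d) :
    |(d : ℝ) / 2 * frob (signal lam U) (signal lam U')| ≤
      d / 2 * ∑ _p : Pos n d, |lam / Real.sqrt n| * |lam / Real.sqrt n| := by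
  rw [abs_mul, abs_of_nonneg (by positivity : (0 : ℝ) ≤ d / 2), frob]
  refine mul_le_mul_of_nonneg_left ((Finset.abs_sum_le_sum_abs _ _).trans ?_) (by positivity)
  refine Finset.sum_le_sum fun p _ => ?_
  rw [abs_mul]
  exact mul_le_mul (abs_signal_le _ _ _) (abs_signal_le _ _ _) (abs_nonneg _) (abs_nonneg _)

lemma measurable_frob_signal {n d : ℕ} (lam : ℝ) :
    Measurable (fun z : (Fin n → O d) × (Fin n → O d) =>
      (d : ℝ) / 2 * frob (signal lam z.1) (signal lam z.2)) := by
  refine Measurable.const_mul (Finset.measurable_fun_sum _ fun p _ => ?_) _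
  exact (((measurable_pi_apply p).comp (measurable_signal lam)).comp measurable_fst).fun_mul
    (((measurable_pi_apply p).comp (measurable_signal lam)).comp measurable_snd)

/-- Two uniform positions agree with probability `1 / M`; where they agree, the two families of
group elements found there are independent Haar. -/
lemma integral_hiddenLaw_ite {n d M : ℕ} (hM : 1 ≤ M)
    {F : (Fin n → O d) → (Fin n → O d) → ℝ} {K : ℝ}
    (hFm : Measurable (fun z : (Fin n → O d) × (Fin n → O d) => F z.1 z.2))
    (hFb : ∀ U U', |F U U'| ≤ K) :
    ∫ z, ∫ z', (if z.1 = z'.1 then F (z.2 z.1) (z'.2 z.1) else 0)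
      ∂hiddenLaw n d M ∂hiddenLaw n d M =
      (∫ U, ∫ U', F U U' ∂Measure.pi (fun _ => haarO d) ∂Measure.pi (fun _ => haarO d)) / M := by
  have : NeZero M := ⟨by omega⟩
  have hK : 0 ≤ K := (abs_nonneg _).trans (hFb 1 1)
  have hcomp : ∀ (κ : Fin M) (G : (Fin n → O d) → ℝ), Measurable G →
      ∫ U : Fin M → Fin n → O d, G (U κ) ∂Measure.pi (fun _ => Measure.pi fun _ => haarO d) =
        ∫ U, G U ∂Measure.pi (fun _ => haarO d) := fun κ G hG =>
    integral_comp_eval (μ := fun _ : Fin M => Measure.pi fun _ : Fin n => haarO d)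
      hG.aestronglyMeasurable
  have h2 : ∀ z : Fin M × (Fin M → Fin n → O d),
      ∫ z', (if z.1 = z'.1 then F (z.2 z.1) (z'.2 z.1) else 0) ∂hiddenLaw n d M =
        (M : ℝ)⁻¹ * ∫ U', F (z.2 z.1) U' ∂Measure.pi (fun _ => haarO d) := by
    intro z
    have hm : Measurable (F (z.2 z.1)) := hFm.comp measurable_prodMk_left
    rw [integral_hiddenLaw (B := K)]
    · congr 1
      rw [Finset.sum_eq_single z.1]
      · simp only [if_true]
        exact hcomp z.1 _ hm
      · intro κ _ hκ
        simp [hκ.symm]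
      · simp
    · refine Measurable.ite (measurableSet_eq_fun measurable_const measurable_fst) ?_
        measurable_const
      exact hm.comp ((measurable_pi_apply z.1).comp measurable_snd)
    · intro z'
      split_ifs
      · exact hFb _ _
      · rwa [abs_zero]
  simp_rw [h2]
  set G : (Fin n → O d) → ℝ := fun U => ∫ U', F U U' ∂Measure.pi (fun _ => haarO d) with hGdef
  have hG : Measurable G := (hFm.stronglyMeasurable.integral_prod_right').measurable
  have hGb : ∀ U, |G U| ≤ K := by
    intro U
    have := norm_integral_le_of_norm_le_const (μ := Measure.pi (fun _ : Fin n => haarO d))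
      (f := F U) (C := K) (.of_forall fun U' => hFb U U')
    simpa using this
  change ∫ z : Fin M × (Fin M → Fin n → O d), (M : ℝ)⁻¹ * G (z.2 z.1) ∂hiddenLaw n d M =
    (∫ U, G U ∂Measure.pi (fun _ => haarO d)) / M
  rw [integral_const_mul, integral_hiddenLaw (B := K)]
  · simp only [hcomp _ G hG, Finset.sum_const, Finset.card_univ, Fintype.card_fin, nsmul_eq_mul]
    have hM' : (M : ℝ) ≠ 0 := by exact_mod_cast NeZero.ne M
    field_simp
  · refine measurable_from_prod_countable_right fun κ => ?_
    exact hG.comp (measurable_pi_apply κ)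
  · intro z
    exact hGb _

/-- The exponent is positive because `0 ^ 0 = 1`: in order zero, disjoint positions contribute too
and nothing is diluted. -/
lemma integral_shift_pow {n d M : ℕ} (hM : 1 ≤ M) (lam : ℝ) (k : ℕ) :
    ∫ z, ∫ z', (∑ q, shift lam z q * shift lam z' q) ^ (k + 1)
      ∂hiddenLaw n d M ∂hiddenLaw n d M = overlapMoment n d lam (k + 1) / M := by
  rw [overlapMoment, ← integral_hiddenLaw_ite hM ((measurable_frob_signal lam).pow_const _)
    (K := ((d : ℝ) / 2 * ∑ _p : Pos n d, |lam / Real.sqrt n| * |lam / Real.sqrt n|) ^ (k + 1))]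
  · simp only [sum_shift_mul_shift, ite_pow, zero_pow (Nat.succ_ne_zero k)]
  · intro U U'
    rw [abs_pow]
    exact pow_le_pow_left₀ (abs_nonneg _) (abs_frob_signal_le lam U U') _

/-- Substitution of the noise into a polynomial in the entries of all samples. -/
def noisePoly (n d M : ℕ) (f : MvPolynomial (Fin M × Pos n d) ℝ) :
    MvPolynomial (Fin M × Pos n d) ℝ :=
  MvPolynomial.aeval (fun q => (Real.sqrt (2 * d))⁻¹ •
    (MvPolynomial.X q + MvPolynomial.X (q.1, q.2.swap) : MvPolynomial (Fin M × Pos n d) ℝ)) f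

lemma eval_noisePoly {n d M : ℕ} (f : MvPolynomial (Fin M × Pos n d) ℝ)
    (x : Fin M × Pos n d → ℝ) :
    MvPolynomial.eval x (noisePoly n d M f) = MvPolynomial.eval (noises x) f := by
  rw [noisePoly, MvPolynomial.aeval_def, MvPolynomial.eval₂_eq', map_sum, MvPolynomial.eval_eq']
  refine Finset.sum_congr rfl fun α _ => ?_
  simp only [MvPolynomial.algebraMap_eq, noises, noise, div_eq_inv_mul, map_mul, map_prod, map_pow,
    MvPolynomial.eval_C, MvPolynomial.smul_eval, map_add, MvPolynomial.eval_X]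

lemma totalDegree_noisePoly_le {n d M : ℕ} (f : MvPolynomial (Fin M × Pos n d) ℝ) :
    (noisePoly n d M f).totalDegree ≤ f.totalDegree := by
  rw [noisePoly, MvPolynomial.aeval_def, MvPolynomial.eval₂_eq']
  refine MvPolynomial.totalDegree_finsetSum_le fun α hα => ?_
  rw [MvPolynomial.algebraMap_eq, ← MvPolynomial.smul_eq_C_mul]
  refine (MvPolynomial.totalDegree_smul_le _ _).trans
    ((MvPolynomial.totalDegree_finsetProd _ _).trans ?_)
  refine le_trans (Finset.sum_le_sum fun i _ => ?_)
    ((α.sum_fintype (fun _ e => e) (by simp)).ge.trans (MvPolynomial.le_totalDegree hα))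
  refine (MvPolynomial.totalDegree_pow _ _).trans ?_
  refine (Nat.mul_le_mul_left _ (m := 1) ?_).trans (by simp)
  refine (MvPolynomial.totalDegree_smul_le _ _).trans
    ((MvPolynomial.totalDegree_add _ _).trans ?_)
  simp [MvPolynomial.totalDegree_X]

/-- Brings the planted expectation to the form treated by `sq_integral_shift_le`. -/
lemma integral_hiddenPlanted {n d M : ℕ} (hM : 1 ≤ M) (hd : 1 ≤ d) (lam : ℝ)
    (f : MvPolynomial (Fin M × Pos n d) ℝ) :
    ∫ y, MvPolynomial.eval y f ∂hiddenPlanted M (planted n d lam) (null n d) =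
      ∫ z, ∫ x, MvPolynomial.eval (x + shift lam z) (noisePoly n d M f)
        ∂gaussPi (Fin M × Pos n d) ∂hiddenLaw n d M := by
  have : NeZero M := ⟨by omega⟩
  have hmeas : Measurable (fun y : Fin M × Pos n d → ℝ => MvPolynomial.eval y f) :=
    (MvPolynomial.continuous_eval f).measurable
  have hH : ∀ κ : Fin M, Measurable (fun U : Fin M → Fin n → O d => shift lam (κ, U)) :=
    fun κ => (measurable_shift lam).comp measurable_prodMk_left
  have hmap : ∀ κ : Fin M, Measurable (fun z : (Fin M → Fin n → O d) × (Fin M × Pos n d → ℝ) =>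
      noises (z.2 + shift lam (κ, z.1))) := fun κ =>
    measurable_noises.comp (measurable_snd.add ((hH κ).comp measurable_fst))
  have hint : ∀ κ : Fin M, Integrable (fun z : (Fin M → Fin n → O d) × (Fin M × Pos n d → ℝ) =>
      MvPolynomial.eval (z.2 + shift lam (κ, z.1)) (noisePoly n d M f))
      ((Measure.pi fun _ : Fin M => Measure.pi fun _ : Fin n => haarO d).prod
        (gaussPi (Fin M × Pos n d))) := fun κ =>
    integrable_eval_add (hH κ) (fun U q => abs_shift_le lam (κ, U) q) _
  have hint2 := integrable_eval_add (μ := hiddenLaw n d M) (measurable_shift lam)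
    (fun z q => abs_shift_le lam z q) (noisePoly n d M f)
  rw [hiddenPlanted, integral_smul_measure]
  simp_rw [pi_update_planted n d M hd lam]
  rw [integral_finsetSum_measure]
  · have h2 := hint2.integral_prod_left
    rw [hiddenLaw, integral_smul_measure, integral_finsetSum_measure]
    · congr 1
      refine Finset.sum_congr rfl fun κ _ => ?_
      rw [integral_map (hmap κ).aemeasurable hmeas.aestronglyMeasurable]
      simp_rw [← eval_noisePoly]
      rw [integral_prod _ (hint κ), integral_map measurable_prodMk_left.aemeasurable]
      refine StronglyMeasurable.aestronglyMeasurable ?_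
      refine StronglyMeasurable.integral_prod_right' (f := fun z : (Fin M × (Fin M → Fin n → O d)) ×
        (Fin M × Pos n d → ℝ) => MvPolynomial.eval (z.2 + shift lam z.1) (noisePoly n d M f)) ?_
      exact ((MvPolynomial.continuous_eval _).measurable.comp
        (measurable_snd.add ((measurable_shift lam).comp measurable_fst))).stronglyMeasurable
    · intro κ _
      rw [hiddenLaw, integrable_smul_measure (by simp) (by simp [NeZero.ne])] at h2
      exact (integrable_finsetSum_measure.1 h2) κ (Finset.mem_univ _)
  · intro κ _
    rw [integrable_map_measure hmeas.aestronglyMeasurable (hmap κ).aemeasurable]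
    refine (hint κ).congr (.of_forall fun z => ?_)
    simp [eval_noisePoly]

/-- The second moment bound for the low-degree advantage: it is governed by the overlaps of two
independent signals, which are diluted by the number of samples. -/
lemma lowDegAdv_hidden_le {n d M : ℕ} (hM : 1 ≤ M) (hd : 1 ≤ d) (lam : ℝ) (D : ℕ) :
    lowDegAdv D (hiddenPlanted M (planted n d lam) (null n d)) (hiddenNull M (null n d)) ≤
      ENNReal.ofReal (Real.sqrt (1 + (∑ k ∈ Finset.range D,
        overlapMoment n d lam (k + 1) / ((k + 1).factorial : ℝ)) / M)) := by
  have : NeZero M := ⟨by omega⟩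
  refine iSup₂_le fun f hf => ?_
  refine ENNReal.div_le_of_le_mul ?_
  rw [← ENNReal.ofReal_mul (Real.sqrt_nonneg _)]
  refine ENNReal.ofReal_le_ofReal ?_
  have h := sq_integral_shift_le (μ := hiddenLaw n d M) (measurable_shift lam)
    (fun z q => abs_shift_le lam z q) ((totalDegree_noisePoly_le f).trans hf)
  -- The term of order zero is the `1` of the bound; all others carry `1 / M`.
  rw [← integral_hiddenPlanted hM hd, Finset.sum_range_succ'] at h
  simp only [integral_shift_pow hM, pow_zero, integral_const, probReal_univ, Nat.factorial_zero,
    Nat.cast_one, div_one, smul_eq_mul, mul_one] at h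
  rw [hiddenNull_eq, integral_map measurable_noises.aemeasurable
    (f := fun y => MvPolynomial.eval y f ^ 2)
    ((MvPolynomial.continuous_eval f).pow 2).measurable.aestronglyMeasurable]
  simp_rw [← eval_noisePoly]
  rw [← Real.sqrt_mul', mul_comm]
  · refine Real.le_sqrt_of_sq_le (h.trans (le_of_eq ?_))
    congr 1
    rw [add_comm, Finset.sum_div]
    congr 1
    exact Finset.sum_congr rfl fun k _ => by ring
  · exact integral_nonneg fun x => sq_nonneg _

instance {n d M : ℕ} [NeZero M] (lam : ℝ) :
    IsProbabilityMeasure (hiddenPlanted M (planted n d lam) (null n d)) := by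
  constructor
  have h : ∀ κ : Fin M, ((Measure.pi (Function.update (fun _ : Fin M => null n d) κ
      (planted n d lam))).map (fun y (p : Fin M × Pos n d) => y p.1 p.2)) Set.univ = 1 := by
    intro κ
    have : ∀ j, IsProbabilityMeasure (Function.update (fun _ : Fin M => null n d) κ
        (planted n d lam) j) := by
      intro j
      by_cases hj : j = κ
      · subst hj; simp only [Function.update_self]; infer_instance
      · simp only [Function.update_of_ne hj]; infer_instance
    rw [Measure.map_apply (by fun_prop) MeasurableSet.univ]
    simp
  simp only [hiddenPlanted, Measure.smul_apply, Measure.coe_finsetSum, Finset.sum_apply, h,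
    smul_eq_mul]
  simp [ENNReal.inv_mul_cancel, NeZero.ne]

instance {n d M : ℕ} : IsProbabilityMeasure (hiddenNull M (null n d)) := by
  rw [hiddenNull_eq]
  exact Measure.isProbabilityMeasure_map measurable_noises.aemeasurable

/-- The constant polynomial competes. This is the lower half of the squeeze to `1`. -/
lemma one_le_lowDegAdv {ι : Type} (D : ℕ) (P Q : Measure (ι → ℝ)) [IsProbabilityMeasure P]
    [IsProbabilityMeasure Q] : 1 ≤ lowDegAdv D P Q := by
  refine le_trans ?_ (le_iSup₂ (1 : MvPolynomial ι ℝ) (by simp))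
  simp

/-! ### Moments of the Haar measure -/

instance (d : ℕ) : (haarO d).IsMulLeftInvariant := by unfold haarO; infer_instance

lemma integrable_entry_mul_entry {d : ℕ} (a b a' b' : Fin d) :
    Integrable (fun V : O d => (V : Matrix (Fin d) (Fin d) ℝ) a b *
      (V : Matrix (Fin d) (Fin d) ℝ) a' b') (haarO d) := by
  refine integrable_of_abs_le ((measurable_entry _ _).fun_mul (measurable_entry _ _)) 1 fun V => ?_
  rw [abs_mul]
  exact mul_le_one₀ (entry_norm_bound_of_unitary (𝕜 := ℝ) V.2 _ _) (abs_nonneg _)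
    (entry_norm_bound_of_unitary (𝕜 := ℝ) V.2 _ _)

lemma integrable_entry {d : ℕ} (a b : Fin d) :
    Integrable (fun V : O d => (V : Matrix (Fin d) (Fin d) ℝ) a b) (haarO d) :=
  integrable_of_abs_le (measurable_entry _ _) 1
    fun V => entry_norm_bound_of_unitary (𝕜 := ℝ) V.2 _ _

/-- The reflection that changes the sign of one coordinate. -/
def flipO {d : ℕ} (c : Fin d) : O d :=
  ⟨Matrix.diagonal fun i => if i = c then -1 else 1, by
    rw [Matrix.mem_orthogonalGroup_iff, Matrix.diagonal_transpose, Matrix.diagonal_mul_diagonal, ← Matrix.diagonal_one]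
    congr 1
    ext i
    by_cases h : i = c <;> simp [h]⟩

lemma flipO_mul_apply {d : ℕ} (c : Fin d) (V : O d) (a b : Fin d) :
    ((flipO c * V : O d) : Matrix (Fin d) (Fin d) ℝ) a b =
      (if a = c then -1 else 1) * (V : Matrix (Fin d) (Fin d) ℝ) a b := by
  simp [flipO, Matrix.diagonal_mul]

/-- The permutation of the coordinates by `σ`. -/
def permO {d : ℕ} (σ : Equiv.Perm (Fin d)) : O d :=
  ⟨Matrix.of fun i j => if σ i = j then 1 else 0, by
    rw [Matrix.mem_orthogonalGroup_iff]
    ext i j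
    simp [Matrix.mul_apply, Matrix.one_apply, eq_comm]⟩

lemma permO_mul_apply {d : ℕ} (σ : Equiv.Perm (Fin d)) (V : O d) (a b : Fin d) :
    ((permO σ * V : O d) : Matrix (Fin d) (Fin d) ℝ) a b =
      (V : Matrix (Fin d) (Fin d) ℝ) (σ a) b := by
  simp [permO, Matrix.mul_apply]

lemma sum_entry_mul_entry {d : ℕ} (V : O d) (b b' : Fin d) :
    ∑ a, (V : Matrix (Fin d) (Fin d) ℝ) a b * (V : Matrix (Fin d) (Fin d) ℝ) a b' =
      if b = b' then 1 else 0 := by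
  have h := (Matrix.mem_orthogonalGroup_iff' _ _).1 V.2
  have h2 := congr_fun (congr_fun h b) b'
  simpa [Matrix.mul_apply, Matrix.one_apply] using h2

lemma sum_entry_mul_entry_row {d : ℕ} (V : O d) (a a' : Fin d) :
    ∑ b, (V : Matrix (Fin d) (Fin d) ℝ) a b * (V : Matrix (Fin d) (Fin d) ℝ) a' b =
      if a = a' then 1 else 0 := by
  have h := (Matrix.mem_orthogonalGroup_iff _ _).1 V.2
  have h2 := congr_fun (congr_fun h a) a'
  simpa [Matrix.mul_apply, Matrix.one_apply] using h2

lemma integral_entry {d : ℕ} (a b : Fin d) :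
    ∫ V : O d, (V : Matrix (Fin d) (Fin d) ℝ) a b ∂haarO d = 0 := by
  have h := integral_mul_left_eq_self (μ := haarO d)
    (fun V : O d => (V : Matrix (Fin d) (Fin d) ℝ) a b) (flipO a)
  simp only [flipO_mul_apply, if_true, neg_mul, one_mul, integral_neg] at h
  linarith

/-- Only left invariance is used. For different rows, reversing the sign of one row negates the
integrand. In a single row the value does not depend on the row, by permuting rows, and the sum over
the rows is an inner product of two columns. -/
lemma integral_entry_mul_entry {d : ℕ} (a b a' b' : Fin d) :
    ∫ V : O d, (V : Matrix (Fin d) (Fin d) ℝ) a b * (V : Matrix (Fin d) (Fin d) ℝ) a' b' ∂haarO d =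
      if a = a' ∧ b = b' then (d : ℝ)⁻¹ else 0 := by
  by_cases ha : a = a'
  · subst ha
    have hc : ∀ c, ∫ V : O d, (V : Matrix (Fin d) (Fin d) ℝ) c b *
        (V : Matrix (Fin d) (Fin d) ℝ) c b' ∂haarO d = ∫ V : O d,
        (V : Matrix (Fin d) (Fin d) ℝ) a b * (V : Matrix (Fin d) (Fin d) ℝ) a b' ∂haarO d := by
      intro c
      have h := integral_mul_left_eq_self (μ := haarO d) (fun V : O d =>
        (V : Matrix (Fin d) (Fin d) ℝ) c b * (V : Matrix (Fin d) (Fin d) ℝ) c b')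
        (permO (Equiv.swap c a))
      simpa only [permO_mul_apply, Equiv.swap_apply_left] using h.symm
    have hs : ∑ c, ∫ V : O d, (V : Matrix (Fin d) (Fin d) ℝ) c b *
        (V : Matrix (Fin d) (Fin d) ℝ) c b' ∂haarO d = if b = b' then 1 else 0 := by
      rw [← integral_finsetSum _ fun c _ => integrable_entry_mul_entry c b c b']
      simp [sum_entry_mul_entry]
    simp only [hc, Finset.sum_const, Finset.card_univ, Fintype.card_fin, nsmul_eq_mul] at hs
    have hd : (d : ℝ) ≠ 0 := by
      have := a.pos
      positivity
    rw [← mul_right_inj' hd, hs]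
    by_cases hb : b = b' <;> simp [hb, hd]
  · have h := integral_mul_left_eq_self (μ := haarO d) (fun V : O d =>
      (V : Matrix (Fin d) (Fin d) ℝ) a b * (V : Matrix (Fin d) (Fin d) ℝ) a' b') (flipO a)
    simp only [flipO_mul_apply, if_true, if_neg (Ne.symm ha), neg_mul, one_mul, integral_neg] at h
    simp only [ha, false_and, if_false]
    linarith

/-- The pairing of a matrix with an orthogonal matrix. -/
def pairO {d : ℕ} (B : Fin d → Fin d → ℝ) (V : O d) : ℝ :=
  ∑ a, ∑ b, B a b * (V : Matrix (Fin d) (Fin d) ℝ) a b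

lemma measurable_pairO {d : ℕ} (B : Fin d → Fin d → ℝ) : Measurable (pairO B) :=
  Finset.measurable_fun_sum _ fun _ _ => Finset.measurable_fun_sum _ fun _ _ =>
    (measurable_entry _ _).const_mul _

lemma integral_pairO {d : ℕ} (B : Fin d → Fin d → ℝ) : ∫ V, pairO B V ∂haarO d = 0 := by
  simp only [pairO]
  rw [integral_finsetSum _ fun a _ => integrable_finsetSum _ fun b _ =>
    (integrable_entry a b).const_mul _]
  refine Finset.sum_eq_zero fun a _ => ?_
  rw [integral_finsetSum _ fun b _ => (integrable_entry a b).const_mul _]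
  refine Finset.sum_eq_zero fun b _ => ?_
  rw [integral_const_mul, integral_entry, mul_zero]

lemma integral_sq_pairO {d : ℕ} (B : Fin d → Fin d → ℝ) :
    ∫ V, pairO B V ^ 2 ∂haarO d = (∑ a, ∑ b, B a b ^ 2) / d := by
  have h : ∀ V : O d, pairO B V ^ 2 = ∑ q : Fin d × Fin d, ∑ q' : Fin d × Fin d,
      (B q.1 q.2 * B q'.1 q'.2) * ((V : Matrix (Fin d) (Fin d) ℝ) q.1 q.2 *
        (V : Matrix (Fin d) (Fin d) ℝ) q'.1 q'.2) := by
    intro V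
    rw [pairO, ← Fintype.sum_prod_type' (f := fun a b =>
      B a b * (V : Matrix (Fin d) (Fin d) ℝ) a b), pow_two, Finset.sum_mul_sum]
    exact Finset.sum_congr rfl fun _ _ => Finset.sum_congr rfl fun _ _ => by ring
  simp_rw [h]
  rw [integral_finsetSum _ fun q _ => integrable_finsetSum _ fun q' _ =>
    (integrable_entry_mul_entry _ _ _ _).const_mul _, ← Fintype.sum_prod_type' (f := fun a b =>
      B a b ^ 2), Finset.sum_div]
  refine Finset.sum_congr rfl fun q _ => ?_
  rw [integral_finsetSum _ fun q' _ => (integrable_entry_mul_entry _ _ _ _).const_mul _]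
  simp only [integral_const_mul, integral_entry_mul_entry, ← Prod.ext_iff, mul_ite, mul_zero,
    Finset.sum_ite_eq, Finset.mem_univ, if_true]
  ring

/-- Cauchy–Schwarz with `‖V‖² = d`. -/
lemma sq_pairO_le {d : ℕ} (B : Fin d → Fin d → ℝ) (V : O d) :
    pairO B V ^ 2 ≤ d * ∑ a, ∑ b, B a b ^ 2 := by
  rw [pairO, ← Fintype.sum_prod_type' (f := fun a b =>
    B a b * (V : Matrix (Fin d) (Fin d) ℝ) a b)]
  refine (Finset.sum_mul_sq_le_sq_mul_sq _ _ _).trans (le_of_eq ?_)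
  rw [Fintype.sum_prod_type, Fintype.sum_prod_type, mul_comm]
  congr 1
  simp only [pow_two, sum_entry_mul_entry_row, if_true]
  simp

/-- The coefficient `1 / 2` is exact, and the third order remainder goes into `r y²`. -/
lemma exp_le_of_abs_le {r y : ℝ} (hr : r ≤ 1) (hy : |y| ≤ r) :
    Real.exp y ≤ 1 + y + (1 / 2 + r) * y ^ 2 := by
  have h := Real.exp_bound (hy.trans hr) (n := 3) (by norm_num)
  have h2 := (abs_le.1 h).2
  norm_num [Finset.sum_range_succ, Nat.factorial] at h2
  have h3 : |y| ^ 3 ≤ r * y ^ 2 := by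
    rw [pow_succ', sq_abs]
    exact mul_le_mul_of_nonneg_right hy (sq_nonneg y)
  have := abs_nonneg y
  nlinarith [mul_nonneg (this.trans hy) (sq_nonneg y)]

/-- A sub-Gaussian bound with the true variance in place of the range. For the Haar pairing the
squared bound on the range is `d²` times the variance, a loss that would miss the threshold. -/
lemma integral_exp_le_of_abs_le {Ω : Type*} [MeasurableSpace Ω] {μ : Measure Ω}
    [IsProbabilityMeasure μ] {Y : Ω → ℝ} (hY : Measurable Y) {r : ℝ} (hr : r ≤ 1)
    (habs : ∀ ω, |Y ω| ≤ r) (h0 : ∫ ω, Y ω ∂μ = 0) :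
    ∫ ω, Real.exp (Y ω) ∂μ ≤ Real.exp ((1 / 2 + r) * ∫ ω, Y ω ^ 2 ∂μ) := by
  have i1 : Integrable Y μ := integrable_of_abs_le hY r habs
  have i2 : Integrable (fun V => Y V ^ 2) μ := by
    refine integrable_of_abs_le (hY.pow_const 2) (r ^ 2) fun V => ?_
    rw [abs_pow]
    exact pow_le_pow_left₀ (abs_nonneg _) (habs V) 2
  have i3 : Integrable (fun V => Real.exp (Y V)) μ := by
    refine integrable_of_abs_le hY.exp (Real.exp r) fun V => ?_
    rw [abs_of_pos (Real.exp_pos _)]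
    exact Real.exp_le_exp.2 (le_of_abs_le (habs V))
  have i4 : Integrable (fun V => 1 + Y V) μ := (integrable_const 1).add i1
  calc ∫ V, Real.exp (Y V) ∂μ
      ≤ ∫ V, (1 + Y V + (1 / 2 + r) * Y V ^ 2) ∂μ :=
        integral_mono i3 (i4.add (i2.const_mul _)) fun V => exp_le_of_abs_le hr (habs V)
    _ = 1 + (1 / 2 + r) * ∫ ω, Y ω ^ 2 ∂μ := by
        rw [integral_add i4 (i2.const_mul _), integral_add (integrable_const 1) i1,
          integral_const_mul, h0]
        simp
    _ ≤ _ := by rw [add_comm]; exact Real.add_one_le_exp _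

/-- Sub-Gaussian bound for Haar orthogonal matrices with the asymptotically sharp constant. -/
lemma integral_exp_pairO_le {d : ℕ} (B : Fin d → Fin d → ℝ) {r : ℝ} (hr0 : 0 ≤ r) (hr : r ≤ 1)
    (hB : d * ∑ a, ∑ b, B a b ^ 2 ≤ r ^ 2) :
    ∫ V, Real.exp (pairO B V) ∂haarO d ≤
      Real.exp ((1 / 2 + r) * ((∑ a, ∑ b, B a b ^ 2) / d)) := by
  rw [← integral_sq_pairO]
  exact integral_exp_le_of_abs_le (measurable_pairO B) hr
    (fun V => abs_le_of_sq_le_sq ((sq_pairO_le B V).trans hB) hr0) (integral_pairO B)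

/-! ### Moments of the overlap -/

/-! ### Linear forms and squared norms of a Gaussian vector -/

section GaussianLinear

variable {ι : Type} [Fintype ι]

lemma map_sum_mul_gaussPi (c : ι → ℝ) :
    (gaussPi ι).map (fun g => ∑ i, c i * g i) =
      gaussianReal 0 (∑ i, c i ^ 2).toNNReal := by
  have hv : 0 ≤ ∑ i, c i ^ 2 := Finset.sum_nonneg fun _ _ => sq_nonneg _
  have hm : Measurable (fun g : ι → ℝ => ∑ i, c i * g i) := by fun_prop
  have := Measure.isProbabilityMeasure_map (μ := gaussPi ι) hm.aemeasurable
  refine Measure.ext_of_charFun ?_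
  ext t
  rw [charFun_apply_real, integral_map hm.aemeasurable (by fun_prop), charFun_gaussianReal]
  have h : ∀ g : ι → ℝ, Complex.exp ((t : ℂ) * ((∑ i, c i * g i : ℝ) : ℂ) * Complex.I) =
      ∏ i, Complex.exp (((t * c i : ℝ) : ℂ) * ((g i : ℝ) : ℂ) * Complex.I) := by
    intro g
    rw [← Complex.exp_sum]
    congr 1
    push_cast
    rw [Finset.mul_sum, Finset.sum_mul]
    exact Finset.sum_congr rfl fun _ _ => by ring
  simp_rw [h]
  rw [integral_fintype_prod_eq_prod
    (f := fun i (x : ℝ) => Complex.exp (((t * c i : ℝ) : ℂ) * (x : ℂ) * Complex.I))]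
  simp_rw [← charFun_apply_real, charFun_gaussianReal]
  rw [← Complex.exp_sum]
  congr 1
  simp only [Complex.ofReal_mul, Complex.ofReal_zero, mul_zero, zero_mul, zero_sub,
    NNReal.coe_one, Complex.ofReal_one, one_mul, Real.coe_toNNReal _ hv, Complex.ofReal_sum,
    Complex.ofReal_pow, Finset.sum_neg_distrib, Finset.sum_mul, Finset.sum_div]
  congr 1
  exact Finset.sum_congr rfl fun _ _ => by ring

/-- At `h = 0` two steps of the recursion collapse to the factor `2k + 1`, giving the moments `(2k -
1)!!`. -/
lemma eval_zero_shiftMoment (k : ℕ) :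
    (shiftMoment (2 * k)).eval 0 * (2 ^ k * k.factorial : ℝ) = ((2 * k).factorial : ℝ) := by
  induction k with
  | zero => simp [shiftMoment]
  | succ k ih =>
    have h : (shiftMoment (2 * (k + 1))).eval 0 = (2 * k + 1) * (shiftMoment (2 * k)).eval 0 := by
      rw [show 2 * (k + 1) = 2 * k + 1 + 1 by ring, shiftMoment, derivative_shiftMoment]
      simp
    rw [h, show 2 * (k + 1) = 2 * k + 1 + 1 by ring, Nat.factorial_succ, Nat.factorial_succ,
      Nat.factorial_succ]
    push_cast
    rw [← ih]
    ring

/-- Linearization: a power of a squared norm becomes an average of powers of linear forms. -/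
lemma integral_sum_mul_pow (c : ι → ℝ) (k : ℕ) :
    (∫ g, (∑ i, c i * g i) ^ (2 * k) ∂gaussPi ι) * (2 ^ k * k.factorial : ℝ) =
      (∑ i, c i ^ 2) ^ k * ((2 * k).factorial : ℝ) := by
  have hv : 0 ≤ ∑ i, c i ^ 2 := Finset.sum_nonneg fun _ _ => sq_nonneg _
  have hm : Measurable (fun g : ι → ℝ => ∑ i, c i * g i) := by fun_prop
  rw [← integral_map (φ := fun g : ι → ℝ => ∑ i, c i * g i) (f := fun x : ℝ => x ^ (2 * k))
    hm.aemeasurable (by fun_prop), map_sum_mul_gaussPi]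
  have h := gaussianReal_map_const_mul (μ := 0) (v := 1) (Real.sqrt (∑ i, c i ^ 2))
  rw [mul_zero, mul_one] at h
  have h2 : NNReal.mk (Real.sqrt (∑ i, c i ^ 2) ^ 2) (sq_nonneg _) =
      (∑ i, c i ^ 2).toNNReal := by
    ext; simp [Real.sq_sqrt hv, hv]
  rw [h2] at h
  rw [← h, integral_map (by fun_prop) (by fun_prop)]
  simp_rw [mul_pow]
  rw [integral_const_mul]
  have h3 := integral_add_pow_gaussianReal 0 (2 * k)
  simp only [add_zero] at h3
  rw [h3, pow_mul, Real.sq_sqrt hv, mul_assoc, eval_zero_shiftMoment]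

/-- True for all `θ`: for `θ ≥ 1` the integral diverges and both sides take the default value `0`.
-/
lemma integral_exp_sq_gaussianReal (θ : ℝ) :
    ∫ x, Real.exp (θ * (x ^ 2 / 2)) ∂gaussianReal 0 1 = (Real.sqrt (1 - θ))⁻¹ := by
  rw [integral_gaussianReal_eq_integral_smul one_ne_zero]
  have h : ∀ x : ℝ, gaussianPDFReal 0 1 x • Real.exp (θ * (x ^ 2 / 2)) =
      (Real.sqrt (2 * Real.pi))⁻¹ * Real.exp (-((1 - θ) / 2) * x ^ 2) := by
    intro x
    rw [gaussianPDFReal_def, smul_eq_mul, mul_assoc, ← Real.exp_add]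
    simp only [NNReal.coe_one, mul_one, sub_zero]
    congr 2
    ring
  simp_rw [h]
  rw [integral_const_mul, integral_gaussian, show Real.pi / ((1 - θ) / 2) =
    2 * Real.pi / (1 - θ) by field_simp, Real.sqrt_div (by positivity)]
  have : Real.sqrt (2 * Real.pi) ≠ 0 := (Real.sqrt_pos.2 (by positivity)).ne'
  field_simp

/-- A divergent integral would be `0`, whereas the closed form is positive. -/
lemma integrable_exp_sq_gaussianReal {θ : ℝ} (hθ : θ < 1) :
    Integrable (fun x => Real.exp (θ * (x ^ 2 / 2))) (gaussianReal 0 1) := by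
  by_contra h
  have h2 := integral_exp_sq_gaussianReal θ
  rw [integral_undef h] at h2
  have : 0 < (Real.sqrt (1 - θ))⁻¹ := inv_pos.2 (Real.sqrt_pos.2 (by linarith))
  linarith

/-- From `y ^ k ≤ k! e ^ y` at `y = θ ‖g‖² / 2`; `θ` will be the signal strength. -/
lemma integral_sum_sq_pow_le {θ : ℝ} (hθ0 : 0 < θ) (hθ : θ < 1) (k : ℕ) :
    ∫ g, ((∑ i, g i ^ 2) / 2) ^ k ∂gaussPi ι ≤
      k.factorial * (θ⁻¹) ^ k * (Real.sqrt (1 - θ))⁻¹ ^ Fintype.card ι := by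
  have hprod : ∀ g : ι → ℝ, Real.exp (θ * ((∑ i, g i ^ 2) / 2)) =
      ∏ i, Real.exp (θ * (g i ^ 2 / 2)) := by
    intro g
    rw [← Real.exp_sum, ← Finset.mul_sum, Finset.sum_div]
  have hint : Integrable (fun g : ι → ℝ => Real.exp (θ * ((∑ i, g i ^ 2) / 2))) (gaussPi ι) := by
    simp_rw [hprod]
    exact Integrable.fintype_prod fun _ => integrable_exp_sq_gaussianReal hθ
  have hk : (0 : ℝ) < k.factorial := by exact_mod_cast k.factorial_pos
  have h1 : ∀ g : ι → ℝ, ((∑ i, g i ^ 2) / 2) ^ k ≤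
      (k.factorial * (θ⁻¹) ^ k) * Real.exp (θ * ((∑ i, g i ^ 2) / 2)) := by
    intro g
    have hnn : 0 ≤ (∑ i, g i ^ 2) / 2 := by positivity
    have h := Real.pow_div_factorial_le_exp _ (mul_nonneg hθ0.le hnn) k
    rw [mul_pow, div_le_iff₀ hk] at h
    rw [inv_pow]
    calc ((∑ i, g i ^ 2) / 2) ^ k = (θ ^ k)⁻¹ * (θ ^ k * ((∑ i, g i ^ 2) / 2) ^ k) := by
          field_simp
      _ ≤ (θ ^ k)⁻¹ * (Real.exp (θ * ((∑ i, g i ^ 2) / 2)) * k.factorial) := by gcongr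
      _ = _ := by ring
  calc ∫ g, ((∑ i, g i ^ 2) / 2) ^ k ∂gaussPi ι
      ≤ ∫ g, (k.factorial * (θ⁻¹) ^ k) * Real.exp (θ * ((∑ i, g i ^ 2) / 2)) ∂gaussPi ι :=
        integral_mono_of_nonneg (.of_forall fun g => by positivity) (hint.const_mul _)
          (.of_forall h1)
    _ = _ := by
        rw [integral_const_mul]
        simp_rw [hprod]
        rw [integral_fintype_prod_eq_pow (f := fun x : ℝ => Real.exp (θ * (x ^ 2 / 2))),
          integral_exp_sq_gaussianReal θ]

end GaussianLinear

/-- Stirling up to a factor linear in `k`, by induction from `(k / (k + 1)) ^ (k + 1) ≤ 1 / e`. It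
cancels the `e ^ k` of the exponential moment bound. -/
lemma factorial_mul_exp_le {k : ℕ} (hk : 1 ≤ k) :
    (k.factorial : ℝ) * Real.exp k ≤ Real.exp 1 * k * (k : ℝ) ^ k := by
  induction k, hk using Nat.le_induction with
  | base => simp
  | succ k hk ih =>
    have hk0 : (0 : ℝ) < k := by exact_mod_cast hk
    have h1 : Real.exp 1 * (k : ℝ) ^ (k + 1) ≤ ((k : ℝ) + 1) ^ (k + 1) := by
      have h2 := Real.add_one_le_exp (-(1 / ((k : ℝ) + 1)))
      have h3 : (k : ℝ) / (k + 1) ≤ Real.exp (-(1 / ((k : ℝ) + 1))) := by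
        refine le_trans (le_of_eq ?_) h2
        field_simp
        ring
      have h4 := pow_le_pow_left₀ (by positivity) h3 (k + 1)
      rw [div_pow, ← Real.exp_nat_mul] at h4
      have h5 : ((k + 1 : ℕ) : ℝ) * -(1 / ((k : ℝ) + 1)) = -1 := by
        push_cast; field_simp
      rw [h5, Real.exp_neg, div_le_iff₀ (by positivity)] at h4
      have he := Real.exp_pos 1
      calc Real.exp 1 * (k : ℝ) ^ (k + 1)
          ≤ Real.exp 1 * ((Real.exp 1)⁻¹ * ((k : ℝ) + 1) ^ (k + 1)) := by gcongr
        _ = _ := by field_simp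
    rw [Nat.factorial_succ]
    push_cast
    rw [Real.exp_add]
    calc ((k : ℝ) + 1) * k.factorial * (Real.exp k * Real.exp 1)
        = ((k : ℝ) + 1) * Real.exp 1 * (k.factorial * Real.exp k) := by ring
      _ ≤ ((k : ℝ) + 1) * Real.exp 1 * (Real.exp 1 * k * (k : ℝ) ^ k) := by gcongr
      _ = ((k : ℝ) + 1) * Real.exp 1 * (Real.exp 1 * (k : ℝ) ^ (k + 1)) := by ring
      _ ≤ ((k : ℝ) + 1) * Real.exp 1 * ((k : ℝ) + 1) ^ (k + 1) := by gcongr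
      _ = _ := by ring

/-- The matrix `∑ i, Oᵢ Oᵢ'ᵀ`. -/
def crossSum {n d : ℕ} (U U' : Fin n → O d) (q : Fin d × Fin d) : ℝ :=
  ∑ i, ∑ a, (U i : Matrix (Fin d) (Fin d) ℝ) q.1 a * (U' i : Matrix (Fin d) (Fin d) ℝ) q.2 a

/-- Cyclicity of the trace: `⟨UᵀU, U'ᵀU'⟩ = ‖U U'ᵀ‖²`. The overlap lives in dimension `d²`, whatever
`n` is. -/
lemma frob_signal_eq {n d : ℕ} (lam : ℝ) (U U' : Fin n → O d) :
    frob (signal lam U) (signal lam U') = lam ^ 2 / n * ∑ q, crossSum U U' q ^ 2 := by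
  have hs : lam / Real.sqrt n * (lam / Real.sqrt n) = lam ^ 2 / n := by
    rw [div_mul_div_comm, Real.mul_self_sqrt (by positivity), pow_two]
  have h1 : ∀ q : Fin d × Fin d, crossSum U U' q ^ 2 = ∑ x : Fin n × Fin d, ∑ y : Fin n × Fin d,
      ((U x.1 : Matrix (Fin d) (Fin d) ℝ) q.1 x.2 * (U y.1 : Matrix (Fin d) (Fin d) ℝ) q.1 y.2) *
      ((U' x.1 : Matrix (Fin d) (Fin d) ℝ) q.2 x.2 *
        (U' y.1 : Matrix (Fin d) (Fin d) ℝ) q.2 y.2) := by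
    intro q
    rw [crossSum, ← Fintype.sum_prod_type' (f := fun i a =>
      (U i : Matrix (Fin d) (Fin d) ℝ) q.1 a * (U' i : Matrix (Fin d) (Fin d) ℝ) q.2 a), pow_two,
      Finset.sum_mul_sum]
    exact Finset.sum_congr rfl fun _ _ => Finset.sum_congr rfl fun _ _ => by ring
  simp_rw [h1]
  rw [Finset.sum_comm, Finset.mul_sum, frob, Fintype.sum_prod_type]
  refine Finset.sum_congr rfl fun x _ => ?_
  rw [Finset.sum_comm, Finset.mul_sum]
  refine Finset.sum_congr rfl fun y _ => ?_
  simp only [signal, Matrix.mul_apply, Matrix.transpose_apply]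
  rw [mul_mul_mul_comm, hs, Finset.sum_mul_sum, Fintype.sum_prod_type]

lemma sum_mul_crossSum {n d : ℕ} (U U' : Fin n → O d) (g : Fin d × Fin d → ℝ) :
    ∑ q, crossSum U U' q * g q = ∑ i,
      pairO (fun e a => ∑ c, g (c, e) * (U i : Matrix (Fin d) (Fin d) ℝ) c a) (U' i) := by
  simp only [crossSum, pairO, Finset.sum_mul]
  rw [Finset.sum_comm]
  refine Finset.sum_congr rfl fun i _ => ?_
  rw [Fintype.sum_prod_type, Finset.sum_comm]
  refine Finset.sum_congr rfl fun e _ => ?_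
  rw [Finset.sum_comm]
  exact Finset.sum_congr rfl fun a _ => Finset.sum_congr rfl fun c _ => by ring

/-- Rotations preserve the Frobenius norm, so bounds conditional on `U` will not depend on `U`. -/
lemma sum_sq_rotate {d : ℕ} (V : O d) (g : Fin d × Fin d → ℝ) :
    ∑ e, ∑ a, (∑ c, g (c, e) * (V : Matrix (Fin d) (Fin d) ℝ) c a) ^ 2 = ∑ q, g q ^ 2 := by
  rw [Fintype.sum_prod_type_right]
  refine Finset.sum_congr rfl fun e _ => ?_
  have h : ∀ a, (∑ c, g (c, e) * (V : Matrix (Fin d) (Fin d) ℝ) c a) ^ 2 = ∑ c, ∑ c',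
      (g (c, e) * g (c', e)) * ((V : Matrix (Fin d) (Fin d) ℝ) c a *
        (V : Matrix (Fin d) (Fin d) ℝ) c' a) := by
    intro a
    rw [pow_two, Finset.sum_mul_sum]
    exact Finset.sum_congr rfl fun _ _ => Finset.sum_congr rfl fun _ _ => by ring
  simp_rw [h]
  rw [Finset.sum_comm]
  refine Finset.sum_congr rfl fun c _ => ?_
  rw [Finset.sum_comm]
  simp_rw [← Finset.mul_sum, sum_entry_mul_entry_row]
  simp [pow_two]

lemma pairO_smul {d : ℕ} (s : ℝ) (B : Fin d → Fin d → ℝ) (V : O d) :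
    pairO (fun a b => s * B a b) V = s * pairO B V := by
  simp only [pairO, Finset.mul_sum, mul_assoc]

lemma integrable_exp_pairO {d : ℕ} (B : Fin d → Fin d → ℝ) :
    Integrable (fun V => Real.exp (pairO B V)) (haarO d) := by
  refine integrable_of_abs_le (measurable_pairO B).exp
    (Real.exp (Real.sqrt (d * ∑ a, ∑ b, B a b ^ 2))) fun V => ?_
  rw [abs_of_pos (Real.exp_pos _)]
  exact Real.exp_le_exp.2 (Real.le_sqrt_of_sq_le (sq_pairO_le B V))

lemma exp_sum_mul_crossSum {n d : ℕ} (U U' : Fin n → O d) (g : Fin d × Fin d → ℝ) (s : ℝ) :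
    Real.exp (s * ∑ q, crossSum U U' q * g q) = ∏ i, Real.exp (pairO (fun e a =>
      s * ∑ c, g (c, e) * (U i : Matrix (Fin d) (Fin d) ℝ) c a) (U' i)) := by
  rw [sum_mul_crossSum, Finset.mul_sum, Real.exp_sum]
  simp only [pairO_smul]

lemma integrable_exp_crossSum {n d : ℕ} (U : Fin n → O d) (g : Fin d × Fin d → ℝ) (s : ℝ) :
    Integrable (fun U' => Real.exp (s * ∑ q, crossSum U U' q * g q))
      (Measure.pi fun _ => haarO d) := by
  simp_rw [exp_sum_mul_crossSum]
  exact Integrable.fintype_prod fun i => integrable_exp_pairO _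

/-- The exponential factorizes over the independent group elements, and every factor has the same
bound. -/
lemma integral_exp_crossSum_le {n d : ℕ} (U : Fin n → O d) (g : Fin d × Fin d → ℝ)
    {s r : ℝ} (hr0 : 0 ≤ r) (hr : r ≤ 1) (hs : d * (s ^ 2 * ∑ q, g q ^ 2) ≤ r ^ 2) :
    ∫ U', Real.exp (s * ∑ q, crossSum U U' q * g q) ∂Measure.pi (fun _ => haarO d) ≤
      Real.exp (n * ((1 / 2 + r) * ((s ^ 2 * ∑ q, g q ^ 2) / d))) := by
  have hsum : ∀ i, ∑ e, ∑ a, (s * ∑ c, g (c, e) * (U i : Matrix (Fin d) (Fin d) ℝ) c a) ^ 2 =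
      s ^ 2 * ∑ q, g q ^ 2 := fun i => by
    rw [← sum_sq_rotate (U i) g]
    simp only [mul_pow, ← Finset.mul_sum]
  simp_rw [exp_sum_mul_crossSum]
  rw [integral_fintype_prod_eq_prod (f := fun i V => Real.exp (pairO (fun e a =>
      s * ∑ c, g (c, e) * (U i : Matrix (Fin d) (Fin d) ℝ) c a) V)), Real.exp_nat_mul]
  calc _ ≤ ∏ _i : Fin n, Real.exp ((1 / 2 + r) * ((s ^ 2 * ∑ q, g q ^ 2) / d)) := by
        refine Finset.prod_le_prod (fun i _ => integral_nonneg fun _ => (Real.exp_pos _).le)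
          fun i _ => ?_
        refine (integral_exp_pairO_le _ hr0 hr ?_).trans (le_of_eq ?_)
        · rwa [hsum i]
        · rw [hsum i]
    _ = _ := by simp

lemma pow_le_factorial_mul_exp (s x : ℝ) (k : ℕ) :
    (s * x) ^ (2 * k) ≤ (2 * k).factorial * (Real.exp (s * x) + Real.exp (-s * x)) := by
  have h := Real.pow_div_factorial_le_exp _ (abs_nonneg (s * x)) (2 * k)
  have hf : (0 : ℝ) < (2 * k).factorial := by exact_mod_cast Nat.factorial_pos _
  rw [div_le_iff₀ hf, (even_two_mul k).pow_abs] at h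
  rw [mul_comm ((2 * k).factorial : ℝ)]
  refine h.trans (mul_le_mul_of_nonneg_right ?_ hf.le)
  have h1 := Real.exp_pos (s * x)
  have h2 := Real.exp_pos (-s * x)
  rcases abs_cases (s * x) with ⟨h3, _⟩ | ⟨h3, _⟩
  · rw [h3]; linarith
  · rw [h3, ← neg_mul]; linarith

lemma integral_crossSum_pow_le {n d k : ℕ} (hd : 1 ≤ d) (hk : 1 ≤ k)
    (hn : 8 * d ^ 2 * k ^ 3 ≤ n) (U : Fin n → O d) (g : Fin d × Fin d → ℝ) :
    ∫ U', (∑ q, crossSum U U' q * g q) ^ (2 * k) ∂Measure.pi (fun _ => haarO d) ≤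
      (2 * k).factorial * (2 * Real.exp (k + 1)) * (n * (∑ q, g q ^ 2) / (2 * d * k)) ^ k := by
  have hd0 : (0 : ℝ) < d := by exact_mod_cast hd
  have hk0 : (0 : ℝ) < k := by exact_mod_cast hk
  have hk1 : (1 : ℝ) ≤ k := by exact_mod_cast hk
  have hn' : 8 * (d : ℝ) ^ 2 * (k : ℝ) ^ 3 ≤ n := by exact_mod_cast hn
  have hn0 : (0 : ℝ) < n := lt_of_lt_of_le (by positivity) hn'
  set G := ∑ q, g q ^ 2 with hG
  have hG0 : 0 ≤ G := Finset.sum_nonneg fun _ _ => sq_nonneg _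
  rcases hG0.eq_or_lt with h0 | hGpos
  · have hg : ∀ q, g q = 0 := fun q =>
      pow_eq_zero_iff two_ne_zero |>.1
        ((Finset.sum_eq_zero_iff_of_nonneg fun _ _ => sq_nonneg _).1 h0.symm q (Finset.mem_univ q))
    simp only [hg, mul_zero, Finset.sum_const_zero]
    rw [zero_pow (by omega)]
    simp only [integral_zero]
    positivity
  -- This choice makes the Gaussian part `n s² G / (2d)` of the exponent equal to `k`.
  set s := Real.sqrt (2 * d * k / (n * G)) with hs
  have hs2 : s ^ 2 = 2 * d * k / (n * G) := Real.sq_sqrt (by positivity)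
  have hspos : 0 < s := Real.sqrt_pos.2 (by positivity)
  have hsG : s ^ 2 * G = 2 * d * k / n := by rw [hs2]; field_simp
  -- `r² = d s² G` bounds the square of a single pairing.
  set r := d * Real.sqrt (2 * k / n) with hrdef
  have hr0 : 0 ≤ r := by positivity
  have hr2 : r ^ 2 = d ^ 2 * (2 * k / n) := by
    rw [hrdef, mul_pow, Real.sq_sqrt (by positivity)]
  -- The hypothesis `8 d² k³ ≤ n` is made for this: the correction `r` to the constant `1 / 2` then
  -- costs at most a factor `e`.
  have hrk : 2 * r * k ≤ 1 := by
    refine abs_le_one_iff_mul_self_le_one.2 ?_ |> le_of_abs_le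
    calc 2 * r * k * (2 * r * k) = 4 * k ^ 2 * r ^ 2 := by ring
      _ = (8 * (d : ℝ) ^ 2 * (k : ℝ) ^ 3) / n := by rw [hr2]; ring
      _ ≤ 1 := (div_le_one hn0).2 hn'
  have hr1 : r ≤ 1 := by nlinarith
  have hexp : (n : ℝ) * ((1 / 2 + r) * ((s ^ 2 * G) / d)) ≤ k + 1 := by
    rw [hsG]
    have : (n : ℝ) * ((1 / 2 + r) * (2 * d * k / n / d)) = k + 2 * r * k := by
      field_simp
    linarith
  have hb : ∀ t : ℝ, t ^ 2 = s ^ 2 →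
      ∫ U', Real.exp (t * ∑ q, crossSum U U' q * g q) ∂Measure.pi (fun _ => haarO d) ≤
        Real.exp (k + 1) := by
    intro t ht
    refine (integral_exp_crossSum_le U g hr0 hr1 ?_).trans ?_
    · rw [ht, hsG, hr2]
      exact le_of_eq (by ring)
    · rw [ht]
      exact Real.exp_le_exp.2 hexp
  have i1 := integrable_exp_crossSum U g s
  have i2 := integrable_exp_crossSum U g (-s)
  have h1 : ∫ U', (s * ∑ q, crossSum U U' q * g q) ^ (2 * k) ∂Measure.pi (fun _ => haarO d) ≤
      (2 * k).factorial * (2 * Real.exp (k + 1)) := by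
    calc _ ≤ ∫ U', (2 * k).factorial * (Real.exp (s * ∑ q, crossSum U U' q * g q) +
          Real.exp (-s * ∑ q, crossSum U U' q * g q)) ∂Measure.pi (fun _ => haarO d) :=
          integral_mono_of_nonneg (.of_forall fun _ => (even_two_mul k).pow_nonneg _)
            ((i1.add i2).const_mul _) (.of_forall fun _ => pow_le_factorial_mul_exp _ _ _)
      _ ≤ _ := by
          rw [integral_const_mul, integral_add i1 i2]
          have h2 := hb s rfl
          have h3 := hb (-s) (by ring)
          gcongr
          linarith
  simp_rw [mul_pow] at h1
  rw [integral_const_mul, pow_mul, hs2] at h1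
  have h3 : (2 * d * k / (n * G)) ^ k * (n * G / (2 * d * k)) ^ k = 1 := by
    rw [← mul_pow]
    have : 2 * d * k / (n * G) * (n * G / (2 * d * k)) = 1 := by field_simp
    rw [this, one_pow]
  calc ∫ U', (∑ q, crossSum U U' q * g q) ^ (2 * k) ∂Measure.pi (fun _ => haarO d)
      = (2 * d * k / (n * G)) ^ k * (∫ U', (∑ q, crossSum U U' q * g q) ^ (2 * k)
          ∂Measure.pi (fun _ => haarO d)) * (n * G / (2 * d * k)) ^ k := by
        rw [mul_right_comm, h3, one_mul]
    _ ≤ _ := by gcongr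

lemma measurable_crossSum {n d : ℕ} (U : Fin n → O d) (q : Fin d × Fin d) :
    Measurable (fun U' : Fin n → O d => crossSum U U' q) := by
  have h : ∀ i a b, Measurable (fun U : Fin n → O d => (U i : Matrix (Fin d) (Fin d) ℝ) a b) :=
    fun i a b => (measurable_entry a b).comp (measurable_pi_apply i)
  exact Finset.measurable_fun_sum _ fun i _ => Finset.measurable_fun_sum _ fun a _ =>
    (h _ _ _).const_mul _

lemma abs_crossSum_le {n d : ℕ} (U U' : Fin n → O d) (q : Fin d × Fin d) :
    |crossSum U U' q| ≤ n * d := by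
  calc |crossSum U U' q| ≤ ∑ _i : Fin n, ∑ _a : Fin d, (1 : ℝ) := by
        refine (Finset.abs_sum_le_sum_abs _ _).trans (Finset.sum_le_sum fun i _ => ?_)
        refine (Finset.abs_sum_le_sum_abs _ _).trans (Finset.sum_le_sum fun a _ => ?_)
        rw [abs_mul]
        exact mul_le_one₀ (entry_norm_bound_of_unitary (𝕜 := ℝ) (U i).2 _ _) (abs_nonneg _)
          (entry_norm_bound_of_unitary (𝕜 := ℝ) (U' i).2 _ _)
    _ = n * d := by simp

lemma integrable_crossSum_pow {n d : ℕ} (U : Fin n → O d) (k : ℕ) :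
    Integrable (fun z : (Fin n → O d) × (Fin d × Fin d → ℝ) =>
      (∑ q, crossSum U z.1 q * z.2 q) ^ (2 * k))
      ((Measure.pi fun _ => haarO d).prod (gaussPi (Fin d × Fin d))) := by
  set K : ℝ := ∑ _q : Fin d × Fin d, ((n : ℝ) * d) ^ 2
  have hi : Integrable (fun z : (Fin n → O d) × (Fin d × Fin d → ℝ) =>
      K ^ k * (∑ q, z.2 q ^ 2) ^ k)
      ((Measure.pi fun _ => haarO d).prod (gaussPi (Fin d × Fin d))) := by
    refine Integrable.const_mul ?_ _
    refine Integrable.comp_snd (f := fun g : Fin d × Fin d → ℝ => (∑ q, g q ^ 2) ^ k) ?_ _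
    refine (integrable_mvPolynomial_gaussPi
      ((∑ q, MvPolynomial.X q ^ 2 : MvPolynomial (Fin d × Fin d) ℝ) ^ k)).congr
      (.of_forall fun g => ?_)
    simp
  refine hi.mono' (Measurable.aestronglyMeasurable ?_) (.of_forall fun z => ?_)
  · refine Measurable.pow_const (Finset.measurable_fun_sum _ fun q _ => ?_) _
    exact ((measurable_crossSum U q).comp measurable_fst).fun_mul
      ((measurable_pi_apply q).comp measurable_snd)
  · rw [Real.norm_eq_abs, abs_of_nonneg ((even_two_mul k).pow_nonneg _), pow_mul, ← mul_pow]
    refine pow_le_pow_left₀ (sq_nonneg _) ((Finset.sum_mul_sq_le_sq_mul_sq _ _ _).trans ?_) k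
    refine mul_le_mul_of_nonneg_right (Finset.sum_le_sum fun q _ => ?_)
      (Finset.sum_nonneg fun _ _ => sq_nonneg _)
    rw [← sq_abs]
    exact pow_le_pow_left₀ (abs_nonneg _) (abs_crossSum_le U z.1 q) 2

lemma overlap_pow_eq {n d k : ℕ} (lam : ℝ) (U U' : Fin n → O d) :
    ((d : ℝ) / 2 * frob (signal lam U) (signal lam U')) ^ k =
      ((d : ℝ) * lam ^ 2 / n) ^ k * (k.factorial / (2 * k).factorial) *
        ∫ g, (∑ q, crossSum U U' q * g q) ^ (2 * k) ∂gaussPi (Fin d × Fin d) := by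
  have h := integral_sum_mul_pow (crossSum U U') k
  have h1 : ((2 * k).factorial : ℝ) ≠ 0 := by exact_mod_cast Nat.factorial_ne_zero _
  rw [eq_comm, ← eq_div_iff h1] at h
  rw [frob_signal_eq, show (d : ℝ) / 2 * (lam ^ 2 / n * ∑ q, crossSum U U' q ^ 2) =
    (d * lam ^ 2 / n) * (1 / 2) * ∑ q, crossSum U U' q ^ 2 by ring, mul_pow, h, mul_pow]
  have h2 : (1 / 2 : ℝ) ^ k * 2 ^ k = 1 := by rw [← mul_pow]; norm_num
  calc _ = ((d : ℝ) * lam ^ 2 / n) ^ k * ((1 / 2 : ℝ) ^ k * 2 ^ k) *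
        (k.factorial / (2 * k).factorial) *
        ∫ g, (∑ q, crossSum U U' q * g q) ^ (2 * k) ∂gaussPi (Fin d × Fin d) := by ring
    _ = _ := by rw [h2, mul_one]

/-- Below the threshold `lam = 1`, the moments of the overlap of two independent signals are
small, up to degrees that are small compared to the number of group elements. -/
lemma overlapMoment_le {n d k : ℕ} (hd : 1 ≤ d) (hk : 1 ≤ k) (hn : 8 * d ^ 2 * k ^ 3 ≤ n)
    {lam : ℝ} (hl0 : 0 < lam) (hl1 : lam < 1) :
    overlapMoment n d lam k / k.factorial ≤
      2 * Real.exp 1 ^ 2 * k * (Real.sqrt (1 - lam))⁻¹ ^ (d * d) := by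
  have hd0 : (0 : ℝ) < d := by exact_mod_cast hd
  have hk0 : (0 : ℝ) < k := by exact_mod_cast hk
  have hn' : 8 * (d : ℝ) ^ 2 * (k : ℝ) ^ 3 ≤ n := by exact_mod_cast hn
  have hn0 : (0 : ℝ) < n := lt_of_lt_of_le (by positivity) hn'
  have hkf : (0 : ℝ) < k.factorial := by exact_mod_cast k.factorial_pos
  have hkf2 : (0 : ℝ) < (2 * k).factorial := by exact_mod_cast Nat.factorial_pos _
  set R := (Real.sqrt (1 - lam))⁻¹ ^ (d * d) with hR
  have hR0 : 0 ≤ R := by positivity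
  have hinner : ∀ U : Fin n → O d, ∫ U' : Fin n → O d,
      ((d : ℝ) / 2 * frob (signal lam U) (signal lam U')) ^ k ∂Measure.pi (fun _ => haarO d) ≤
      k.factorial * (2 * Real.exp 1 ^ 2 * k * R) := by
    intro U
    -- After the interchange the Haar integral is taken for a fixed `g`, where the terms are
    -- independent.
    have hswap : ∫ U' : Fin n → O d, (∫ g, (∑ q, crossSum U U' q * g q) ^ (2 * k)
        ∂gaussPi (Fin d × Fin d)) ∂Measure.pi (fun _ => haarO d) =
        ∫ g, (∫ U' : Fin n → O d, (∑ q, crossSum U U' q * g q) ^ (2 * k)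
        ∂Measure.pi (fun _ => haarO d)) ∂gaussPi (Fin d × Fin d) :=
      integral_integral_swap (integrable_crossSum_pow U k)
    -- With `θ = lam` the loss `lam ^ (-k)` is covered by the factor `lam ^ (2k)` of the overlap,
    -- with `lam ^ k ≤ 1` left over.
    have hG := integral_sum_sq_pow_le (ι := Fin d × Fin d) hl0 hl1 k
    rw [Fintype.card_prod, Fintype.card_fin, ← hR] at hG
    have hpt : ∀ g : Fin d × Fin d → ℝ, (n * (∑ q, g q ^ 2) / (2 * d * k)) ^ k =
        (n / (d * k)) ^ k * ((∑ q, g q ^ 2) / 2) ^ k := by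
      intro g
      rw [← mul_pow]
      congr 1
      field_simp
    have hint : Integrable (fun g : Fin d × Fin d → ℝ => ((∑ q, g q ^ 2) / 2) ^ k)
        (gaussPi (Fin d × Fin d)) := by
      refine (integrable_mvPolynomial_gaussPi
        ((MvPolynomial.C (1 / 2) * ∑ q, MvPolynomial.X q ^ 2 :
          MvPolynomial (Fin d × Fin d) ℝ) ^ k)).congr (.of_forall fun g => ?_)
      simp only [map_pow, map_mul, MvPolynomial.eval_C, map_sum, MvPolynomial.eval_X]
      ring
    have h1 : ∫ g, (∫ U' : Fin n → O d, (∑ q, crossSum U U' q * g q) ^ (2 * k)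
        ∂Measure.pi (fun _ => haarO d)) ∂gaussPi (Fin d × Fin d) ≤
        (2 * k).factorial * (2 * Real.exp (k + 1)) * (n / (d * k)) ^ k *
          (k.factorial * (lam⁻¹) ^ k * R) := by
      calc _ ≤ ∫ g : Fin d × Fin d → ℝ, (2 * k).factorial * (2 * Real.exp (k + 1)) *
            (n / (d * k)) ^ k * ((∑ q, g q ^ 2) / 2) ^ k ∂gaussPi (Fin d × Fin d) := by
            refine integral_mono_of_nonneg (.of_forall fun g => integral_nonneg fun _ =>
              (even_two_mul k).pow_nonneg _) (hint.const_mul _) (.of_forall fun g => ?_)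
            have := integral_crossSum_pow_le hd hk hn U g
            rw [hpt g] at this
            simpa only [mul_assoc] using this
        _ ≤ _ := by
            rw [integral_const_mul]
            gcongr
    simp_rw [overlap_pow_eq lam U]
    rw [integral_const_mul, hswap]
    calc _ ≤ ((d : ℝ) * lam ^ 2 / n) ^ k * (k.factorial / (2 * k).factorial) *
          ((2 * k).factorial * (2 * Real.exp (k + 1)) * (n / (d * k)) ^ k *
          (k.factorial * (lam⁻¹) ^ k * R)) := by gcongr
      _ = (((d : ℝ) * lam ^ 2 / n) * (n / (d * k)) * lam⁻¹) ^ k * k.factorial *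
          (2 * Real.exp (k + 1) * k.factorial * R) := by
          rw [mul_pow, mul_pow]
          field_simp
      _ = lam ^ k * k.factorial * (2 * Real.exp 1 * R * ((k.factorial * Real.exp k) /
            (k : ℝ) ^ k)) := by
          rw [show (d : ℝ) * lam ^ 2 / n * (n / (d * k)) * lam⁻¹ = lam / k by field_simp, div_pow,
            Real.exp_add]
          ring
      _ ≤ 1 * k.factorial * (2 * Real.exp 1 * R * (Real.exp 1 * k)) := by
          have h2 : k.factorial * Real.exp k / (k : ℝ) ^ k ≤ Real.exp 1 * k :=
            (div_le_iff₀ (by positivity)).2 (factorial_mul_exp_le hk)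
          have h3 : lam ^ k ≤ 1 := pow_le_one₀ hl0.le hl1.le
          gcongr
      _ = _ := by ring
  rw [div_le_iff₀ hkf, mul_comm _ (k.factorial : ℝ)]
  calc overlapMoment n d lam k ≤ ∫ _U : Fin n → O d,
        (k.factorial * (2 * Real.exp 1 ^ 2 * k * R) : ℝ) ∂Measure.pi (fun _ => haarO d) := by
        refine integral_mono_of_nonneg (.of_forall fun U => integral_nonneg fun U' => ?_)
          (integrable_const _) (.of_forall hinner)
        simp only [Pi.zero_apply]
        rw [frob_signal_eq]
        positivity
    _ = _ := by simp

/-! ### Programs -/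

section Program

variable {ι : Type}

lemma exec_append (x : ι → ℝ) (ω : ℕ → ℝ) (P Q : List (Instr ι)) (mem : List ℝ) :
    exec x ω (P ++ Q) mem = exec x ω Q (exec x ω P mem) := by
  induction P generalizing mem with
  | nil => rfl
  | cons I P ih => exact ih _

lemma prefix_exec (x : ι → ℝ) (ω : ℕ → ℝ) (P : List (Instr ι)) (mem : List ℝ) :
    mem <+: exec x ω P mem := by
  induction P generalizing mem with
  | nil => exact List.prefix_refl _
  | cons I P ih => exact (List.prefix_append _ _).trans (ih _)

lemma length_exec (x : ι → ℝ) (ω : ℕ → ℝ) (P : List (Instr ι)) (mem : List ℝ) :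
    (exec x ω P mem).length = mem.length + P.length := by
  induction P generalizing mem with
  | nil => rfl
  | cons I P ih =>
    refine (ih _).trans ?_
    simp only [List.length_append, List.length_cons, List.length_nil]
    omega

/-- The operand refers to the input or to one of the first `L` registers. -/
def Operand.Valid (L : ℕ) : Operand ι → Prop
  | .input _ => True
  | .reg k => k < L

lemma Operand.Valid.mono {L L' : ℕ} (h : L ≤ L') {o : Operand ι} (ho : o.Valid L) :
    o.Valid L' := by
  cases o with
  | input i => trivial
  | reg k => exact lt_of_lt_of_le ho h

/-- Memory only grows, so a value once computed remains readable in every continuation of the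
program. -/
lemma Operand.eval_of_prefix {x : ι → ℝ} {m m' : List ℝ} (h : m <+: m') {o : Operand ι}
    (ho : o.Valid m.length) : o.eval x m' = o.eval x m := by
  cases o with
  | input i => rfl
  | reg k =>
    obtain ⟨t, rfl⟩ := h
    exact List.getD_append _ _ _ _ ho

/-- The value `F`, a function of the input and of the random numbers, is held in a register
(or is an input) after the execution of `P`. -/
def Available (P : List (Instr ι)) (F : (ι → ℝ) → (ℕ → ℝ) → ℝ) : Prop :=
  ∃ o : Operand ι, o.Valid P.length ∧ ∀ x ω, o.eval x (exec x ω P []) = F x ω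

lemma Available.mono {P P' : List (Instr ι)} (h : P <+: P') {F : (ι → ℝ) → (ℕ → ℝ) → ℝ}
    (hF : Available P F) : Available P' F := by
  obtain ⟨o, ho, hoF⟩ := hF
  refine ⟨o, ho.mono h.length_le, fun x ω => ?_⟩
  rw [← hoF x ω]
  obtain ⟨Q, rfl⟩ := h
  rw [exec_append]
  refine Operand.eval_of_prefix (prefix_exec _ _ _ _) ?_
  simpa [length_exec] using ho

lemma available_step (P : List (Instr ι)) (I : Instr ι) :
    Available (P ++ [I]) (fun x ω => I.eval x (exec x ω P []) (ω P.length)) := by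
  refine ⟨.reg P.length, by simp [Operand.Valid], fun x ω => ?_⟩
  have h : (exec x ω P []).length = P.length := by simp [length_exec]
  simp only [exec_append, exec, Operand.eval, h]
  rw [List.getD_append_right _ _ _ _ h.le, h]
  simp

/-- The value `F` can be computed in at most `c` further steps, after any continuation of `P₀`. -/
def Computable (P₀ : List (Instr ι)) (c : ℕ) (F : (ι → ℝ) → (ℕ → ℝ) → ℝ) : Prop :=
  ∀ P, P₀ <+: P → ∃ P', P <+: P' ∧ P'.length ≤ P.length + c ∧ Available P' F

lemma Available.computable {P₀ : List (Instr ι)} {F : (ι → ℝ) → (ℕ → ℝ) → ℝ}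
    (hF : Available P₀ F) : Computable P₀ 0 F :=
  fun P hP => ⟨P, List.prefix_refl _, le_rfl, hF.mono hP⟩

lemma computable_const (P₀ : List (Instr ι)) (r : ℝ) : Computable P₀ 1 (fun _ _ => r) :=
  fun P _ => ⟨P ++ [.const r], List.prefix_append _ _, by simp, available_step P (.const r)⟩

lemma computable_input (P₀ : List (Instr ι)) (i : ι) : Computable P₀ 0 (fun x _ => x i) :=
  fun P _ => ⟨P, List.prefix_refl _, le_rfl, .input i, trivial, fun _ _ => rfl⟩

lemma Computable.binary {P₀ : List (Instr ι)} {c c' : ℕ} {F G : (ι → ℝ) → (ℕ → ℝ) → ℝ}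
    (hF : Computable P₀ c F) (hG : Computable P₀ c' G) (I : Operand ι → Operand ι → Instr ι)
    (f : ℝ → ℝ → ℝ)
    (hI : ∀ a b x mem g, (I a b).eval x mem g = f (a.eval x mem) (b.eval x mem)) :
    Computable P₀ (c + c' + 1) (fun x ω => f (F x ω) (G x ω)) := by
  intro P hP
  obtain ⟨P1, h1, l1, a1⟩ := hF P hP
  obtain ⟨P2, h2, l2, b, hb, hbG⟩ := hG P1 (hP.trans h1)
  obtain ⟨a, ha, haF⟩ := a1.mono h2
  refine ⟨P2 ++ [I a b], (h1.trans h2).trans (List.prefix_append _ _), ?_, ?_⟩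
  · simp only [List.length_append, List.length_singleton]
    omega
  · have h := available_step P2 (I a b)
    simpa only [hI, haF, hbG] using h

lemma Computable.add {P₀ : List (Instr ι)} {c c' : ℕ} {F G : (ι → ℝ) → (ℕ → ℝ) → ℝ}
    (hF : Computable P₀ c F) (hG : Computable P₀ c' G) :
    Computable P₀ (c + c' + 1) (fun x ω => F x ω + G x ω) :=
  hF.binary hG .add (· + ·) fun _ _ _ _ _ => rfl

lemma Computable.sub {P₀ : List (Instr ι)} {c c' : ℕ} {F G : (ι → ℝ) → (ℕ → ℝ) → ℝ}
    (hF : Computable P₀ c F) (hG : Computable P₀ c' G) :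
    Computable P₀ (c + c' + 1) (fun x ω => F x ω - G x ω) :=
  hF.binary hG .sub (· - ·) fun _ _ _ _ _ => rfl

lemma Computable.mul {P₀ : List (Instr ι)} {c c' : ℕ} {F G : (ι → ℝ) → (ℕ → ℝ) → ℝ}
    (hF : Computable P₀ c F) (hG : Computable P₀ c' G) :
    Computable P₀ (c + c' + 1) (fun x ω => F x ω * G x ω) :=
  hF.binary hG .mul (· * ·) fun _ _ _ _ _ => rfl

lemma Computable.div {P₀ : List (Instr ι)} {c c' : ℕ} {F G : (ι → ℝ) → (ℕ → ℝ) → ℝ}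
    (hF : Computable P₀ c F) (hG : Computable P₀ c' G) :
    Computable P₀ (c + c' + 1) (fun x ω => F x ω / G x ω) :=
  hF.binary hG .div (· / ·) fun _ _ _ _ _ => rfl

lemma Computable.sqrt {P₀ : List (Instr ι)} {c : ℕ} {F : (ι → ℝ) → (ℕ → ℝ) → ℝ}
    (hF : Computable P₀ c F) : Computable P₀ (c + 1) (fun x ω => Real.sqrt (F x ω)) := by
  intro P hP
  obtain ⟨P1, h1, l1, a, ha, haF⟩ := hF P hP
  refine ⟨P1 ++ [.sqrt a], h1.trans (List.prefix_append _ _), ?_, ?_⟩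
  · simp only [List.length_append, List.length_singleton]
    omega
  · have h := available_step P1 (.sqrt a)
    simpa only [Instr.eval, haF] using h

lemma Computable.sum {α : Type*} {P₀ : List (Instr ι)} {c : ℕ}
    {F : α → (ι → ℝ) → (ℕ → ℝ) → ℝ} (hF : ∀ a, Computable P₀ c (F a)) (s : Finset α) :
    Computable P₀ (s.card * (c + 1) + 1) (fun x ω => ∑ a ∈ s, F a x ω) := by
  classical
  induction s using Finset.induction_on with
  | empty => simpa using computable_const P₀ 0
  | insert a s ha ih =>
    simp_rw [Finset.sum_insert ha]
    convert (hF a).add ih using 1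
    rw [Finset.card_insert_of_notMem ha]
    ring

lemma Computable.forall_available {α : Type*} [Fintype α] {P₀ : List (Instr ι)} {c : ℕ}
    {F : α → (ι → ℝ) → (ℕ → ℝ) → ℝ} (hF : ∀ a, Computable P₀ c (F a)) :
    ∃ P, P₀ <+: P ∧ P.length ≤ P₀.length + Fintype.card α * c ∧ ∀ a, Available P (F a) := by
  classical
  have h : ∀ s : Finset α, ∃ P, P₀ <+: P ∧ P.length ≤ P₀.length + s.card * c ∧
      ∀ a ∈ s, Available P (F a) := by
    intro s
    induction s using Finset.induction_on with
    | empty => exact ⟨P₀, List.prefix_refl _, by simp, by simp⟩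
    | insert a s ha ih =>
      obtain ⟨P1, h1, l1, a1⟩ := ih
      obtain ⟨P2, h2, l2, a2⟩ := hF a P1 h1
      refine ⟨P2, h1.trans h2, ?_, ?_⟩
      · rw [Finset.card_insert_of_notMem ha, add_mul, one_mul]
        omega
      · intro b hb
        rcases Finset.mem_insert.1 hb with rfl | hb
        · exact a2
        · exact (a1 b hb).mono h2
  obtain ⟨P, hP, hl, ha⟩ := h Finset.univ
  exact ⟨P, hP, hl, fun a => ha a (Finset.mem_univ a)⟩

/-- The step writing register `k` uses the random number `ω k`, so successive draws occupy a block
of consecutive indices. -/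
lemma available_gauss (P : List (Instr ι)) (N : ℕ) :
    ∃ P', P <+: P' ∧ P'.length = P.length + N ∧
      ∀ k < N, Available P' (fun _ ω => ω (P.length + k)) := by
  induction N with
  | zero => exact ⟨P, List.prefix_refl _, rfl, by simp⟩
  | succ N ih =>
    obtain ⟨P1, h1, l1, a1⟩ := ih
    refine ⟨P1 ++ [.gauss], h1.trans (List.prefix_append _ _), by simp [l1]; omega, ?_⟩
    intro k hk
    rcases Nat.lt_succ_iff_lt_or_eq.1 hk with hk | rfl
    · exact (a1 k hk).mono (List.prefix_append _ _)
    · simpa only [l1, Instr.eval] using available_step P1 .gauss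

/-! ### Subroutines -/

section Simulation

variable {κ : Type}

/-- The operands of a subroutine that starts at register `L`, as seen by the calling program:
`oY` locates its input, and `oZ` a zero for registers that have not been written. -/
def Operand.relocate (o : Operand κ) (oY : κ → Operand ι) (oZ : Operand ι) (L m : ℕ) :
    Operand ι :=
  match o with
  | .input p => oY p
  | .reg k => if k < m then .reg (L + k) else oZ

/-- An instruction of a subroutine, as seen by the calling program. -/
def Instr.relocate (oY : κ → Operand ι) (oZ : Operand ι) (L m : ℕ) : Instr κ → Instr ι
  | .const r => .const r
  | .gauss => .gauss
  | .add a b => .add (a.relocate oY oZ L m) (b.relocate oY oZ L m)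
  | .sub a b => .sub (a.relocate oY oZ L m) (b.relocate oY oZ L m)
  | .mul a b => .mul (a.relocate oY oZ L m) (b.relocate oY oZ L m)
  | .div a b => .div (a.relocate oY oZ L m) (b.relocate oY oZ L m)
  | .sqrt a => .sqrt (a.relocate oY oZ L m)
  | .ifPos a b c =>
    .ifPos (a.relocate oY oZ L m) (b.relocate oY oZ L m) (c.relocate oY oZ L m)

/-- The code of a subroutine, as seen by the calling program. -/
def relocate (oY : κ → Operand ι) (oZ : Operand ι) (L : ℕ) : ℕ → List (Instr κ) → List (Instr ι)
  | _, [] => []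
  | m, I :: Q => I.relocate oY oZ L m :: relocate oY oZ L (m + 1) Q

lemma length_relocate (oY : κ → Operand ι) (oZ : Operand ι) (L m : ℕ) (Q : List (Instr κ)) :
    (relocate oY oZ L m Q).length = Q.length := by
  induction Q generalizing m with
  | nil => rfl
  | cons I Q ih => simp [relocate, ih]

/-- An unwritten register reads `0` for the subroutine, but the caller may write to that place
later; such operands are therefore redirected to a stored zero. -/
lemma Operand.eval_relocate {oY : κ → Operand ι} {oZ : Operand ι} {x : ι → ℝ} {y : κ → ℝ}
    {memP : List ℝ} (hY : ∀ p mem, (oY p).eval x (memP ++ mem) = y p)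
    (hZ : ∀ mem, oZ.eval x (memP ++ mem) = 0) (mem : List ℝ) (a : Operand κ) :
    (a.relocate oY oZ memP.length mem.length).eval x (memP ++ mem) = a.eval y mem := by
  cases a with
  | input p => exact hY p mem
  | reg k =>
    simp only [Operand.relocate]
    split_ifs with h
    · simp only [Operand.eval]
      rw [List.getD_append_right _ _ _ _ (by omega)]
      simp
    · rw [hZ]
      simp only [Operand.eval]
      rw [List.getD_eq_default _ _ (by omega)]

/-- The memory of the subroutine follows that of the caller, so registers and random numbers are
shifted by the same amount. -/
lemma exec_relocate {oY : κ → Operand ι} {oZ : Operand ι} {x : ι → ℝ} {y : κ → ℝ}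
    {memP : List ℝ} (hY : ∀ p mem, (oY p).eval x (memP ++ mem) = y p)
    (hZ : ∀ mem, oZ.eval x (memP ++ mem) = 0) (ω : ℕ → ℝ) (Q : List (Instr κ)) (mem : List ℝ) :
    exec x ω (relocate oY oZ memP.length mem.length Q) (memP ++ mem) =
      memP ++ exec y (fun k => ω (memP.length + k)) Q mem := by
  induction Q generalizing mem with
  | nil => rfl
  | cons I Q ih =>
    have h : (I.relocate oY oZ memP.length mem.length).eval x (memP ++ mem)
        (ω (memP ++ mem).length) = I.eval y mem (ω (memP.length + mem.length)) := by
      cases I <;> simp only [Instr.relocate, Instr.eval, Operand.eval_relocate hY hZ,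
        List.length_append]
    have h2 := ih (mem ++ [I.eval y mem (ω (memP.length + mem.length))])
    simp only [List.length_append, List.length_singleton] at h2
    simp only [relocate, exec]
    rw [h, List.append_assoc, h2]

/-- Calling an algorithm as a subroutine. -/
lemma available_call {ρ : Type} [Fintype ρ] (A : Algorithm κ ρ) {P : List (Instr ι)}
    {Y : κ → (ι → ℝ) → (ℕ → ℝ) → ℝ} (hY : ∀ p, Available P (Y p))
    (hZ : Available P (fun _ _ => 0)) :
    ∃ P', P <+: P' ∧ P'.length = P.length + A.time ∧ ∀ q, Available P' (fun x ω =>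
      A.output (fun p => Y p x ω) (fun k => ω (P.length + k)) q) := by
  choose oY hoY hoYe using hY
  obtain ⟨oZ, hoZ, hoZe⟩ := hZ
  refine ⟨P ++ relocate oY oZ P.length 0 A.steps, List.prefix_append _ _, ?_, fun q => ?_⟩
  · simp [length_relocate, Algorithm.time]
  have hlen : ∀ x ω, (exec x ω P []).length = P.length := fun x ω => by simp [length_exec]
  have hY' : ∀ x ω p mem, (oY p).eval x (exec x ω P [] ++ mem) = Y p x ω := fun x ω p mem => by
    rw [← hoYe p x ω]
    exact Operand.eval_of_prefix (List.prefix_append _ _) (by rw [hlen]; exact hoY p)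
  have hZ' : ∀ x ω mem, oZ.eval x (exec x ω P [] ++ mem) = 0 := fun x ω mem => by
    refine Eq.trans ?_ (hoZe x ω)
    exact Operand.eval_of_prefix (List.prefix_append _ _) (by rw [hlen]; exact hoZ)
  refine ⟨(A.out q).relocate oY oZ P.length A.time, ?_, fun x ω => ?_⟩
  · rw [List.length_append, length_relocate]
    rcases A.out q with p | k
    · exact (hoY p).mono (by omega)
    · simp only [Operand.relocate]
      split_ifs with h
      · exact Nat.add_lt_add_left h _
      · exact hoZ.mono (by omega)
  · have h := exec_relocate (hY' x ω) (hZ' x ω) ω A.steps []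
    rw [hlen, List.append_nil] at h
    rw [exec_append, List.length_nil] at *
    rw [h]
    have h2 := Operand.eval_relocate (hY' x ω) (hZ' x ω)
      (exec (fun p => Y p x ω) (fun k => ω (P.length + k)) A.steps []) (A.out q)
    rw [hlen, length_exec, List.length_nil, zero_add] at h2
    exact h2

end Simulation

end Program

/-! ### The test built from an estimator -/

section Test

variable {n d : ℕ}

/-- Split an observation `y` into two, with the help of further Gaussian variables `g`; run the
estimator on the first one, and correlate its output with the second one. -/
def splitStat (A : Algorithm (Pos n d) (Pos n d)) (a b τ : ℝ) (y g : Pos n d → ℝ) (ω : ℕ → ℝ) :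
    ℝ :=
  frob (A.output (a • y - b • noise g) ω) (b • y + a • noise g) -
    τ * Real.sqrt (frob (A.output (a • y - b • noise g) ω) (A.output (a • y - b • noise g) ω))

/-- With `N` entries: `N` Gaussian draws, `8 N` steps for the input of `A`, the run of `A`, and `12
N + 6` for the two sums, the root and the threshold. The last bound on `o'` keeps the randomness of
`A` apart from the splitting noise. -/
lemma available_splitStat {M : ℕ} (A : Algorithm (Pos n d) (Pos n d)) (a b τ : ℝ) (j : Fin M)
    (P : List (Instr (Fin M × Pos n d))) (hZ : Available P (fun _ _ => 0)) :
    ∃ P' o o', P <+: P' ∧ P'.length ≤ P.length + (A.time + 21 * Fintype.card (Pos n d) + 6) ∧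
      o + Fintype.card (Pos n d) ≤ o' ∧ Available P' (fun x ω => splitStat A a b τ
        (fun p => x (j, p)) (fun p => ω (o + Fintype.equivFin (Pos n d) p))
        (fun k => ω (o' + k))) := by
  set N := Fintype.card (Pos n d)
  obtain ⟨P1, h1, l1, hg⟩ := available_gauss P N
  have hG : ∀ p : Pos n d, Available P1 (fun _ ω => ω (P.length + Fintype.equivFin (Pos n d) p)) :=
    fun p => hg _ (Fintype.equivFin (Pos n d) p).2
  have hnoise : ∀ P2, P1 <+: P2 → ∀ p, Computable P2 3 (fun _ ω =>
      noise (fun q : Pos n d => ω (P.length + Fintype.equivFin (Pos n d) q)) p) :=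
    fun P2 hP2 p => (((hG p).mono hP2).computable.add ((hG p.swap).mono hP2).computable).div
      (computable_const P2 (Real.sqrt (2 * d)))
  obtain ⟨P2, h2, l2, hY⟩ := Computable.forall_available (P₀ := P1) (fun p : Pos n d =>
    ((computable_const P1 a).mul (computable_input P1 (j, p))).sub
      ((computable_const P1 b).mul (hnoise P1 (List.prefix_refl _) p)))
  obtain ⟨P3, h3, l3, hX⟩ := available_call A hY (hZ.mono (h1.trans h2))
  have hV : ∀ p, Computable P3 8 _ := fun p =>
    ((computable_const P3 b).mul (computable_input P3 (j, p))).add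
      ((computable_const P3 a).mul (hnoise P3 (h2.trans h3) p))
  have hS := (Computable.sum (fun p => (hX p).computable.mul (hV p)) Finset.univ).sub
    ((computable_const P3 τ).mul
      (Computable.sum (fun p => (hX p).computable.mul (hX p).computable) Finset.univ).sqrt)
  obtain ⟨P4, h4, l4, hA⟩ := hS P3 (List.prefix_refl _)
  refine ⟨P4, P.length, P2.length, h1.trans (h2.trans (h3.trans h4)), ?_, ?_, hA⟩
  · have hN : (Finset.univ : Finset (Pos n d)).card = N := rfl
    rw [hN] at l4
    change P2.length ≤ P1.length + N * 8 at l2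
    omega
  · have := h2.length_le
    omega

/-- Loop over the samples, keeping a value that is positive once some statistic was; each round adds
one branching step. The initial constant `0` also serves as the zero for subroutine calls. No
independence between rounds is recorded, as a union bound and the single informative sample suffice.
-/
lemma exists_test (A : Algorithm (Pos n d) (Pos n d)) (a b τ : ℝ) (M : ℕ) :
    ∃ (B : Algorithm (Fin M × Pos n d) Unit) (o o' : Fin M → ℕ),
      B.time ≤ M * (A.time + 21 * Fintype.card (Pos n d) + 7) + 1 ∧
      (∀ j, o j + Fintype.card (Pos n d) ≤ o' j) ∧
      ∀ x ω, B.Accepts x ω ↔ ∃ j, 0 < splitStat A a b τ (fun p => x (j, p))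
        (fun p => ω (o j + Fintype.equivFin (Pos n d) p)) (fun k => ω (o' j + k)) := by
  classical
  have key : ∀ s : Finset (Fin M), ∃ (P : List (Instr (Fin M × Pos n d))) (o o' : Fin M → ℕ)
      (F : (Fin M × Pos n d → ℝ) → (ℕ → ℝ) → ℝ),
      P.length ≤ s.card * (A.time + 21 * Fintype.card (Pos n d) + 7) + 1 ∧
      (∀ j, o j + Fintype.card (Pos n d) ≤ o' j) ∧ Available P (fun _ _ => 0) ∧ Available P F ∧
      ∀ x ω, 0 < F x ω ↔ ∃ j ∈ s, 0 < splitStat A a b τ (fun p => x (j, p))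
        (fun p => ω (o j + Fintype.equivFin (Pos n d) p)) (fun k => ω (o' j + k)) := by
    intro s
    induction s using Finset.induction_on with
    | empty =>
      have h0 : Available ([] ++ [Instr.const 0] : List (Instr (Fin M × Pos n d)))
          (fun _ _ => 0) := available_step [] (.const 0)
      exact ⟨[] ++ [.const 0], 0, fun _ => Fintype.card (Pos n d), fun _ _ => 0, by simp,
        by simp, h0, h0, by simp⟩
    | insert j s hj ih =>
      obtain ⟨P, o, o', F, hl, ho, hZ, hF, hFe⟩ := ih
      obtain ⟨P1, u, u', h1, l1, hu, hS⟩ := available_splitStat A a b τ j P hZ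
      obtain ⟨f, _, hf⟩ := hF.mono h1
      obtain ⟨t, _, ht⟩ := hS
      have hstep := available_step P1 (.ifPos t t f)
      simp only [Instr.eval, hf, ht] at hstep
      refine ⟨P1 ++ [.ifPos t t f], Function.update o j u, Function.update o' j u', _, ?_, ?_,
        (hZ.mono h1).mono (List.prefix_append _ _), hstep, ?_⟩
      · rw [Finset.card_insert_of_notMem hj, List.length_append, List.length_singleton]
        linarith
      · intro i
        by_cases hi : i = j
        · subst hi; simpa using hu
        · simpa [hi] using ho i
      · intro x ω
        have hs : ∀ i ∈ s, i ≠ j := fun i hi h => hj (h ▸ hi)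
        rw [Finset.exists_mem_insert]
        simp only [Function.update_self]
        have hrest : (∃ i ∈ s, 0 < splitStat A a b τ (fun p => x (i, p))
            (fun p => ω (Function.update o j u i + Fintype.equivFin (Pos n d) p))
            (fun k => ω (Function.update o' j u' i + k))) ↔ 0 < F x ω := by
          rw [hFe]
          refine exists_congr fun i => and_congr_right fun hi => ?_
          rw [Function.update_of_ne (hs i hi), Function.update_of_ne (hs i hi)]
        rw [hrest]
        split_ifs with h
        · simp [h]
        · simp [h]
  obtain ⟨P, o, o', F, hl, ho, -, ⟨f, _, hf⟩, hFe⟩ := key Finset.univ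
  refine ⟨⟨P, fun _ => f⟩, o, o', by simpa [Algorithm.time] using hl, ho, fun x ω => ?_⟩
  simp only [Algorithm.Accepts, Algorithm.output, hf, hFe, Finset.mem_univ, true_and]

end Test

/-! ### Measurability of algorithms and of their randomness -/

section Measurability

variable {ι Ω : Type} [MeasurableSpace Ω]

lemma measurable_operand_eval {x : Ω → ι → ℝ} (hx : Measurable x) {mem : Ω → List ℝ}
    (hm : ∀ k, Measurable fun z => (mem z).getD k 0) (o : Operand ι) :
    Measurable fun z => o.eval (x z) (mem z) := by
  cases o with
  | input i => exact (measurable_pi_apply i).comp hx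
  | reg k => exact hm k

lemma measurable_instr_eval {x : Ω → ι → ℝ} (hx : Measurable x) {mem : Ω → List ℝ}
    (hm : ∀ k, Measurable fun z => (mem z).getD k 0) {g : Ω → ℝ} (hg : Measurable g)
    (I : Instr ι) : Measurable fun z => I.eval (x z) (mem z) (g z) := by
  have h := measurable_operand_eval hx hm
  cases I with
  | const r => exact measurable_const
  | gauss => exact hg
  | add a b => exact (h a).fun_add (h b)
  | sub a b => exact (h a).fun_sub (h b)
  | mul a b => exact (h a).fun_mul (h b)
  | div a b => exact (h a).fun_div (h b)
  | sqrt a => exact (h a).sqrt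
  | ifPos a b c => exact Measurable.ite (measurableSet_lt measurable_const (h a)) (h b) (h c)

/-- The memory has deterministic length, so measurability can be followed register by register. -/
lemma measurable_exec {x : Ω → ι → ℝ} (hx : Measurable x) {ω : Ω → ℕ → ℝ} (hω : Measurable ω)
    (P : List (Instr ι)) {mem : Ω → List ℝ} {L : ℕ} (hL : ∀ z, (mem z).length = L)
    (hm : ∀ k, Measurable fun z => (mem z).getD k 0) (k : ℕ) :
    Measurable fun z => (exec (x z) (ω z) P (mem z)).getD k 0 := by
  induction P generalizing mem L with
  | nil => exact hm k
  | cons I P ih =>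
    simp only [exec]
    refine ih (L := L + 1) (fun z => by simp [hL]) fun k => ?_
    rcases lt_trichotomy k L with h | h | h
    · have e : ∀ z, (mem z ++ [I.eval (x z) (mem z) (ω z (mem z).length)]).getD k 0 =
          (mem z).getD k 0 := fun z => List.getD_append _ _ _ _ (by rw [hL]; exact h)
      simp only [e]
      exact hm k
    · have e : ∀ z, (mem z ++ [I.eval (x z) (mem z) (ω z (mem z).length)]).getD k 0 =
          I.eval (x z) (mem z) (ω z L) := fun z => by
        rw [List.getD_append_right _ _ _ _ (by rw [hL]; exact h.ge), hL, h]
        simp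
      simp only [e]
      exact measurable_instr_eval hx hm ((measurable_pi_apply L).comp hω) I
    · have e : ∀ z, (mem z ++ [I.eval (x z) (mem z) (ω z (mem z).length)]).getD k 0 = 0 :=
        fun z => List.getD_eq_default _ _ (by simp [hL]; omega)
      simp only [e]
      exact measurable_const

lemma measurable_output {κ : Type} (A : Algorithm ι κ) {x : Ω → ι → ℝ} (hx : Measurable x)
    {ω : Ω → ℕ → ℝ} (hω : Measurable ω) : Measurable fun z => A.output (x z) (ω z) :=
  measurable_pi_lambda _ fun k => measurable_operand_eval hx
    (fun k => measurable_exec hx hω A.steps (L := 0) (fun _ => rfl) (by simp) k) (A.out k)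

lemma measurable_frob [Fintype ι] {X Y : Ω → ι → ℝ} (hX : Measurable X) (hY : Measurable Y) :
    Measurable fun z => frob (X z) (Y z) :=
  Finset.measurable_fun_sum _ fun i _ =>
    ((measurable_pi_apply i).comp hX).fun_mul ((measurable_pi_apply i).comp hY)

end Measurability

instance : IsProbabilityMeasure coins := by unfold coins; infer_instance

/-- Disjoint parts of the internal randomness are independent. -/
lemma measurePreserving_coins {κ : Type} [Fintype κ] {N o o' : ℕ} (e : κ ≃ Fin N)
    (h : o + N ≤ o') :
    MeasurePreserving (fun (ω : ℕ → ℝ) => ((fun p => ω (o + e p), fun k => ω (o' + k)) :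
      (κ → ℝ) × (ℕ → ℝ))) coins ((gaussPi κ).prod coins) := by
  classical
  refine ⟨by fun_prop, ?_⟩
  have hinj : Function.Injective (Sum.elim (fun p => o + (e p : ℕ)) (fun k => o' + k) :
      κ ⊕ ℕ → ℕ) := by
    rintro (p | k) (q | l) hpq
    · simp only [Sum.elim_inl, add_right_inj] at hpq
      exact congrArg _ (e.injective (Fin.ext hpq))
    · simp only [Sum.elim_inl, Sum.elim_inr] at hpq
      have := (e p).2
      omega
    · simp only [Sum.elim_inl, Sum.elim_inr] at hpq
      have := (e q).2
      omega
    · simp only [Sum.elim_inr, add_right_inj] at hpq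
      rw [hpq]
  have h1 := Measure.map_infinitePi_infinitePi_of_inj
    (P := fun _ : ℕ => gaussianReal 0 1) hinj
  have hm : Measurable (fun (z : (κ → ℝ) × (ℕ → ℝ)) => (Sum.elim z.1 z.2 : κ ⊕ ℕ → ℝ)) := by
    refine measurable_pi_lambda _ fun s => ?_
    cases s
    · exact (measurable_pi_apply _).comp measurable_fst
    · exact (measurable_pi_apply _).comp measurable_snd
  have h2 : ((gaussPi κ).prod coins).map
      (fun (z : (κ → ℝ) × (ℕ → ℝ)) => (Sum.elim z.1 z.2 : κ ⊕ ℕ → ℝ)) =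
      Measure.infinitePi (fun _ : κ ⊕ ℕ => gaussianReal 0 1) := by
    refine Measure.eq_infinitePi _ fun s t ht => ?_
    rw [Measure.map_apply hm (MeasurableSet.pi s.countable_toSet fun i _ => ht i)]
    have hpre : (fun (z : (κ → ℝ) × (ℕ → ℝ)) => (Sum.elim z.1 z.2 : κ ⊕ ℕ → ℝ)) ⁻¹'
        Set.pi s t = (Set.pi s.toLeft fun p => t (Sum.inl p)) ×ˢ
          (Set.pi s.toRight fun k => t (Sum.inr k)) := by
      ext z
      simp [Set.mem_pi]
    have h3 : gaussPi κ = Measure.infinitePi (fun _ : κ => gaussianReal 0 1) :=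
      (Measure.infinitePi_eq_pi _).symm
    rw [hpre, Measure.prod_prod, h3, coins, Measure.infinitePi_pi _ fun p _ => ht _,
      Measure.infinitePi_pi _ fun p _ => ht _, Finset.prod_sum_eq_prod_toLeft_mul_prod_toRight]
  have hsplit : Measurable (fun (w : κ ⊕ ℕ → ℝ) => ((fun p => w (Sum.inl p),
      fun k => w (Sum.inr k)) : (κ → ℝ) × (ℕ → ℝ))) := by fun_prop
  have h4 : (fun (ω : ℕ → ℝ) => ((fun p => ω (o + e p), fun k => ω (o' + k)) :
      (κ → ℝ) × (ℕ → ℝ))) = (fun (w : κ ⊕ ℕ → ℝ) => ((fun p => w (Sum.inl p),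
      fun k => w (Sum.inr k)) : (κ → ℝ) × (ℕ → ℝ))) ∘
      fun ω i => ω ((Sum.elim (fun p => o + (e p : ℕ)) (fun k => o' + k) : κ ⊕ ℕ → ℕ) i) := by
    funext ω
    rfl
  rw [h4, ← Measure.map_map hsplit (by fun_prop), coins, h1, ← h2, Measure.map_map hsplit hm]
  exact Measure.map_id

/-! ### Rotation invariance and tails of Gaussian vectors -/

section GaussianTail

variable {ι : Type} [Fintype ι]

lemma map_strongDual_gaussPi (L : StrongDual ℝ (ι → ℝ)) :
    ∃ v, (gaussPi ι).map L = gaussianReal 0 v := by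
  classical
  refine ⟨_, Eq.trans (congrArg (fun f => (gaussPi ι).map f) ?_)
    (map_sum_mul_gaussPi fun i => L (Pi.single i 1))⟩
  funext g
  conv_lhs => rw [← Finset.univ_sum_single g, map_sum]
  refine Finset.sum_congr rfl fun i _ => ?_
  have : Pi.single i (g i) = g i • (Pi.single i 1 : ι → ℝ) := by
    rw [← Pi.single_smul, smul_eq_mul, mul_one]
  rw [this, map_smul, smul_eq_mul, mul_comm]

/-- `(a, b)` is a point of the unit circle and the map is a rotation. Independence of the two
outputs is what allows one half of a sample to validate an estimate made from the other. -/
lemma measurePreserving_rotation_gaussPi {a b : ℝ} (hab : a ^ 2 + b ^ 2 = 1) :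
    MeasurePreserving (fun z : (ι → ℝ) × (ι → ℝ) => (a • z.1 - b • z.2, b • z.1 + a • z.2))
      ((gaussPi ι).prod (gaussPi ι)) ((gaussPi ι).prod (gaussPi ι)) := by
  obtain ⟨θ, rfl, rfl⟩ : ∃ θ, Real.cos θ = a ∧ Real.sin θ = b := by
    have h := Complex.cos_arg (x := ⟨a, b⟩) (by
      intro h0
      have h1 := congrArg Complex.re h0
      have h2 := congrArg Complex.im h0
      simp only [Complex.zero_re, Complex.zero_im] at h1 h2
      rw [h1, h2] at hab
      norm_num at hab)
    have h' := Complex.sin_arg (⟨a, b⟩ : ℂ)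
    have hn : ‖(⟨a, b⟩ : ℂ)‖ = 1 := by
      rw [Complex.norm_eq_sqrt_sq_add_sq, hab, Real.sqrt_one]
    rw [hn, div_one] at h h'
    exact ⟨_, h, h'⟩
  refine ⟨by fun_prop, ?_⟩
  have : IsGaussian (gaussPi ι) := isGaussian_of_map_eq_gaussianReal fun L =>
    ⟨0, map_strongDual_gaussPi L⟩
  have h0 : ∀ L : StrongDual ℝ (ι → ℝ), (gaussPi ι)[L] = 0 := by
    intro L
    obtain ⟨v, hv⟩ := map_strongDual_gaussPi L
    have h := integral_id_gaussianReal (μ := 0) (v := v)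
    rwa [← hv, integral_map (by fun_prop) (by fun_prop)] at h
  have h := IsGaussian.map_rotation_eq_self_of_forall_strongDual_eq_zero h0 (-θ)
  refine Eq.trans (congrArg (fun f => ((gaussPi ι).prod (gaussPi ι)).map f) ?_) h
  funext z
  rw [ContinuousLinearMap.rotation_apply, Real.cos_neg, Real.sin_neg, neg_neg, neg_smul,
    sub_eq_add_neg]

/-- Chernoff bound at the parameter `r / V`. -/
lemma gaussPi_real_le {c : ι → ℝ} {V r : ℝ} (hV : ∑ i, c i ^ 2 ≤ V) (hV0 : 0 < V) (hr : 0 ≤ r) :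
    (gaussPi ι).real {g | r ≤ ∑ i, c i * g i} ≤ Real.exp (-(r ^ 2 / (2 * V))) := by
  have hv : 0 ≤ ∑ i, c i ^ 2 := Finset.sum_nonneg fun _ _ => sq_nonneg _
  have hexp : ∀ t : ℝ, Integrable (fun g : ι → ℝ => Real.exp (t * ∑ i, c i * g i)) (gaussPi ι) := by
    intro t
    have hm : Measurable (fun g : ι → ℝ => ∑ i, c i * g i) := by fun_prop
    have h := integrable_exp_mul_gaussianReal (μ := 0) (v := (∑ i, c i ^ 2).toNNReal) t
    rw [← map_sum_mul_gaussPi, integrable_map_measure (by fun_prop) hm.aemeasurable] at h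
    exact h
  have h := measure_ge_le_exp_mul_mgf (μ := gaussPi ι) (X := fun g => ∑ i, c i * g i) r
    (t := r / V) (by positivity) (hexp _)
  refine h.trans ?_
  rw [mgf_gaussianReal (map_sum_mul_gaussPi c), ← Real.exp_add, Real.coe_toNNReal _ hv]
  refine Real.exp_le_exp.2 ?_
  have h2 : (∑ i, c i ^ 2) * (r / V) ^ 2 / 2 ≤ V * (r / V) ^ 2 / 2 := by gcongr
  have h3 : -(r / V) * r + V * (r / V) ^ 2 / 2 = -(r ^ 2 / (2 * V)) := by field_simp; ring
  linarith

lemma frob_self_nonneg (X : ι → ℝ) : 0 ≤ frob X X :=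
  Finset.sum_nonneg fun _ _ => mul_self_nonneg _

/-- Gaussian tail bound for the correlation of a fixed matrix with the noise. -/
lemma gaussPi_real_frob_noise_le {n d : ℕ} (hd : 1 ≤ d) {X : Pos n d → ℝ} (hX : 0 < frob X X)
    {τ : ℝ} (hτ : 0 ≤ τ) :
    (gaussPi (Pos n d)).real {h | τ * Real.sqrt (frob X X) ≤ frob X (noise h)} ≤
      Real.exp (-(τ ^ 2 * d / 4)) := by
  have hd0 : (0 : ℝ) < d := by exact_mod_cast hd
  have hswap : ∀ F : Pos n d → ℝ, ∑ p : Pos n d, F p.swap = ∑ p, F p := fun F =>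
    (Equiv.prodComm (Fin n × Fin d) (Fin n × Fin d)).sum_comp F
  have hlin : ∀ h : Pos n d → ℝ, frob X (noise h) =
      ∑ p, ((X p + X p.swap) / Real.sqrt (2 * d)) * h p := by
    intro h
    have h1 : frob X (noise h) = ∑ p, X p * h p / Real.sqrt (2 * d) +
        ∑ p, X p * h p.swap / Real.sqrt (2 * d) := by
      rw [frob, ← Finset.sum_add_distrib]
      exact Finset.sum_congr rfl fun p _ => by simp only [noise]; ring
    rw [h1, ← hswap fun p => X p * h p.swap / Real.sqrt (2 * d), ← Finset.sum_add_distrib]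
    exact Finset.sum_congr rfl fun p _ => by rw [Prod.swap_swap]; ring
  -- `X` need not be symmetric; `(x + y)² ≤ 2 (x² + y²)` bounds the variance in any case.
  have hV : ∑ p, ((X p + X p.swap) / Real.sqrt (2 * d)) ^ 2 ≤ 2 * frob X X / d := by
    have h1 : ∀ p, ((X p + X p.swap) / Real.sqrt (2 * d)) ^ 2 ≤
        (X p * X p + X p.swap * X p.swap) / d := by
      intro p
      rw [div_pow, Real.sq_sqrt (by positivity), div_le_div_iff₀ (by positivity) hd0]
      nlinarith [mul_nonneg (sq_nonneg (X p - X p.swap)) hd0.le]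
    refine (Finset.sum_le_sum fun p _ => h1 p).trans (le_of_eq ?_)
    rw [← Finset.sum_div, Finset.sum_add_distrib, hswap fun p => X p * X p, frob]
    ring
  simp_rw [hlin]
  refine (gaussPi_real_le hV (by positivity) (by positivity)).trans (le_of_eq ?_)
  rw [mul_pow, Real.sq_sqrt hX.le]
  congr 2
  field_simp
  ring

end GaussianTail


/-! ### Error probabilities of the test -/

section TestError

/-- Fubini, bounding the sections over the bad set `G` by one. -/
lemma measureReal_prod_le {α β : Type*} [MeasurableSpace α] [MeasurableSpace β] {μ : Measure α}
    {ν : Measure β} [IsProbabilityMeasure μ] [IsProbabilityMeasure ν] {S : Set (α × β)}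
    (hS : MeasurableSet S) {G : Set α} (hG : MeasurableSet G) {e : ℝ} (he : 0 ≤ e)
    (h : ∀ x, x ∉ G → ν.real (Prod.mk x ⁻¹' S) ≤ e) : (μ.prod ν).real S ≤ μ.real G + e := by
  have h1 : (μ.prod ν) S ≤ μ G + ENNReal.ofReal e := by
    rw [Measure.prod_apply hS]
    calc ∫⁻ x, ν (Prod.mk x ⁻¹' S) ∂μ
        ≤ ∫⁻ x, (G.indicator 1 x + ENNReal.ofReal e) ∂μ := by
          refine lintegral_mono fun x => ?_
          by_cases hx : x ∈ G
          · simp only [hx, Set.indicator_of_mem, Pi.one_apply]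
            exact prob_le_one.trans le_self_add
          · simp only [hx, not_false_eq_true, Set.indicator_of_notMem, zero_add]
            rw [← ofReal_measureReal]
            exact ENNReal.ofReal_le_ofReal (h x hx)
      _ = μ G + ENNReal.ofReal e := by
          rw [lintegral_add_right _ measurable_const, lintegral_indicator_one hG,
            lintegral_const, measure_univ, mul_one]
  rw [measureReal_def]
  refine (ENNReal.toReal_mono (by finiteness) h1).trans (le_of_eq ?_)
  rw [ENNReal.toReal_add (by finiteness) (by finiteness), ENNReal.toReal_ofReal he,
    measureReal_def]

variable {n d : ℕ}

lemma signal_smul (a lam : ℝ) (U : Fin n → O d) : a • signal lam U = signal (a * lam) U := by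
  funext p
  simp only [signal, Pi.smul_apply, smul_eq_mul]
  ring

lemma signal_zero (U : Fin n → O d) : signal 0 U = 0 := by
  funext p
  simp [signal]

lemma noise_add (g h : Pos n d → ℝ) : noise (g + h) = noise g + noise h := by
  funext p
  simp only [noise, Pi.add_apply]
  ring

lemma noise_smul (a : ℝ) (g : Pos n d → ℝ) : noise (a • g) = a • noise g := by
  funext p
  simp only [noise, Pi.smul_apply, smul_eq_mul]
  ring

/-- Lets the null law be treated by the same splitting formula, at signal strength zero. -/
lemma planted_zero (n d : ℕ) : planted n d 0 = null n d := by
  have h : (observation 0 : (Fin n → O d) × (Pos n d → ℝ) → Pos n d → ℝ) = noise ∘ Prod.snd := by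
    funext w
    simp [observation, signal_zero]
  rw [planted, h, ← Measure.map_map measurable_noise measurable_snd, base, Measure.map_snd_prod,
    measure_univ, one_smul, null]

/-- Each of the `n²` blocks is an orthogonal matrix times `lam / √n`, of squared norm `lam² d / n`.
The norm of the signal is thus deterministic. -/
lemma frob_signal_self (lam : ℝ) (U : Fin n → O d) :
    frob (signal lam U) (signal lam U) = lam ^ 2 * (n * d) := by
  have hb : ∀ i j : Fin n, ∑ k : Fin d, ∑ l : Fin d,
      (((U i : Matrix (Fin d) (Fin d) ℝ).transpose * (U j : Matrix (Fin d) (Fin d) ℝ)) k l) ^ 2 =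
        d := by
    intro i j
    have h : (U i : Matrix (Fin d) (Fin d) ℝ).transpose * (U j : Matrix (Fin d) (Fin d) ℝ) ∈
        Matrix.orthogonalGroup (Fin d) ℝ := ((U i)⁻¹ * U j).2
    have h1 := (Matrix.mem_orthogonalGroup_iff (Fin d) ℝ).1 h
    set V := (U i : Matrix (Fin d) (Fin d) ℝ).transpose * (U j : Matrix (Fin d) (Fin d) ℝ)
    have h2 : ∀ k, ∑ l, V k l ^ 2 = 1 := by
      intro k
      have := congrFun (congrFun h1 k) k
      rw [Matrix.mul_apply, Matrix.one_apply_eq] at this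
      rw [← this]
      exact Finset.sum_congr rfl fun l _ => by rw [pow_two]; rfl
    simp [h2]
  have hs : lam / Real.sqrt n * (lam / Real.sqrt n) = lam ^ 2 / n := by
    rw [div_mul_div_comm, Real.mul_self_sqrt (by positivity), pow_two]
  have h1 : frob (signal lam U) (signal lam U) = ∑ i : Fin n, ∑ j : Fin n, ∑ k : Fin d,
      ∑ l : Fin d, lam ^ 2 / n * (((U i : Matrix (Fin d) (Fin d) ℝ).transpose *
        (U j : Matrix (Fin d) (Fin d) ℝ)) k l) ^ 2 := by
    simp only [frob, Fintype.sum_prod_type]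
    refine Finset.sum_congr rfl fun i _ => ?_
    rw [Finset.sum_comm]
    refine Finset.sum_congr rfl fun j _ => Finset.sum_congr rfl fun k _ =>
      Finset.sum_congr rfl fun l _ => ?_
    rw [← hs, signal]
    ring
  rw [h1]
  simp_rw [← Finset.mul_sum, hb]
  rw [Finset.sum_const, Finset.sum_const, Finset.card_univ, Fintype.card_fin, nsmul_eq_mul,
    nsmul_eq_mul]
  rcases Nat.eq_zero_or_pos n with rfl | hn
  · simp
  · have : (n : ℝ) ≠ 0 := by exact_mod_cast hn.ne'
    field_simp

/-- Two rotated copies of the Gaussian variables, one for the observation that is handed to the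
algorithm, the other for its validation. -/
lemma measurePreserving_split {a b : ℝ} (hab : a ^ 2 + b ^ 2 = 1) :
    MeasurePreserving (fun z : ((Fin n → O d) × (Pos n d → ℝ)) × ((Pos n d → ℝ) × (ℕ → ℝ)) =>
      (((z.1.1, a • z.1.2 - b • z.2.1), z.2.2), b • z.1.2 + a • z.2.1))
      ((base n d).prod ((gaussPi (Pos n d)).prod coins))
      (((base n d).prod coins).prod (gaussPi (Pos n d))) := by
  set H := Measure.pi (fun _ : Fin n => haarO d)
  set γ := gaussPi (Pos n d)
  have hr : MeasurePreserving (fun z : (Pos n d → ℝ) × (Pos n d → ℝ) =>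
      (a • z.1 - b • z.2, b • z.1 + a • z.2)) (γ.prod γ) (γ.prod γ) :=
    measurePreserving_rotation_gaussPi hab
  have e1 : MeasurePreserving MeasurableEquiv.prodAssoc
      ((H.prod γ).prod (γ.prod coins)) (H.prod (γ.prod (γ.prod coins))) :=
    measurePreserving_prodAssoc _ _ _
  have e2 : MeasurePreserving (MeasurableEquiv.prodAssoc
      (α := Pos n d → ℝ) (β := Pos n d → ℝ) (γ := ℕ → ℝ)).symm
      (γ.prod (γ.prod coins)) ((γ.prod γ).prod coins) :=
    (measurePreserving_prodAssoc γ γ coins).symm _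
  have e3 := hr.prod (MeasurePreserving.id coins)
  have e4 : MeasurePreserving (MeasurableEquiv.prodAssoc
      (α := Pos n d → ℝ) (β := Pos n d → ℝ) (γ := ℕ → ℝ))
      ((γ.prod γ).prod coins) (γ.prod (γ.prod coins)) :=
    measurePreserving_prodAssoc _ _ _
  have e5 := (MeasurePreserving.id γ).prod (Measure.measurePreserving_swap (μ := γ) (ν := coins))
  have e6 : MeasurePreserving (MeasurableEquiv.prodAssoc
      (α := Pos n d → ℝ) (β := ℕ → ℝ) (γ := Pos n d → ℝ)).symm
      (γ.prod (coins.prod γ)) ((γ.prod coins).prod γ) :=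
    (measurePreserving_prodAssoc γ coins γ).symm _
  have e := (MeasurePreserving.id H).prod
    (e6.comp (e5.comp (e4.comp (e3.comp e2))))
  have e7 : MeasurePreserving (MeasurableEquiv.prodAssoc
      (α := Fin n → O d) (β := (Pos n d → ℝ) × (ℕ → ℝ)) (γ := Pos n d → ℝ)).symm
      (H.prod ((γ.prod coins).prod γ)) ((H.prod (γ.prod coins)).prod γ) :=
    (measurePreserving_prodAssoc H (γ.prod coins) γ).symm _
  have e8 := MeasurePreserving.prod ((measurePreserving_prodAssoc H γ coins).symm _)
    (MeasurePreserving.id γ)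
  exact e8.comp (e7.comp (e.comp e1))

end TestError


/-! ### The statistic of one sample -/

section ErrorBounds

variable {n d : ℕ}

/-- The correlation of a matrix with the signal. -/
def cosine {ι : Type} [Fintype ι] (X Y : ι → ℝ) : ℝ :=
  frob X Y / (Real.sqrt (frob X X) * Real.sqrt (frob Y Y))

lemma abs_cosine_le {ι : Type} [Fintype ι] (X Y : ι → ℝ) : |cosine X Y| ≤ 1 := by
  have h : |frob X Y| ≤ Real.sqrt (frob X X) * Real.sqrt (frob Y Y) := by
    rw [← Real.sqrt_mul (frob_self_nonneg X)]
    refine Real.abs_le_sqrt ?_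
    have := Finset.sum_mul_sq_le_sq_mul_sq Finset.univ X Y
    simpa only [frob, ← pow_two] using this
  rw [cosine, abs_div, abs_of_nonneg (by positivity :
    (0 : ℝ) ≤ Real.sqrt (frob X X) * Real.sqrt (frob Y Y))]
  exact div_le_one_of_le₀ h (by positivity)

lemma measurable_cosine {ι Ω : Type} [MeasurableSpace Ω] [Fintype ι] {X Y : Ω → ι → ℝ}
    (hX : Measurable X) (hY : Measurable Y) : Measurable fun z => cosine (X z) (Y z) :=
  (measurable_frob hX hY).div ((measurable_frob hX hX).sqrt.mul (measurable_frob hY hY).sqrt)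

/-- A random variable that is at most `1` and has mean at least `c` is often at least `c / 2`. -/
lemma measureReal_lt_half_le {Ω : Type*} [MeasurableSpace Ω] {μ : Measure Ω}
    [IsProbabilityMeasure μ] {f : Ω → ℝ} (hf : Measurable f) (h1 : ∀ x, |f x| ≤ 1) {c : ℝ}
    (hc : c ≤ ∫ x, f x ∂μ) (hc0 : 0 ≤ c) : μ.real {x | f x < c / 2} ≤ 1 - c / 2 := by
  have hm : MeasurableSet {x | f x < c / 2} := measurableSet_lt hf measurable_const
  have h2 : ∫ x, f x ∂μ ≤ ∫ x, (c / 2 + {x | f x < c / 2}ᶜ.indicator (fun _ => (1 : ℝ)) x) ∂μ := by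
    refine integral_mono (integrable_of_abs_le hf 1 h1)
      ((integrable_const _).add ((integrable_const _).indicator hm.compl)) fun x => ?_
    by_cases hx : f x < c / 2
    · simp [hx, hx.le]
    · have : x ∈ {x | f x < c / 2}ᶜ := hx
      simp only [this, Set.indicator_of_mem]
      linarith [(abs_le.1 (h1 x)).2]
  rw [integral_add (integrable_const _) ((integrable_const _).indicator hm.compl),
    integral_const, integral_indicator hm.compl, setIntegral_const, probReal_univ,
    probReal_compl_eq_one_sub hm] at h2
  simp only [smul_eq_mul, mul_one, one_mul] at h2
  linarith

variable (A : Algorithm (Pos n d) (Pos n d)) (a b τ : ℝ)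

lemma measurable_splitStat {Ω : Type} [MeasurableSpace Ω] {y g : Ω → Pos n d → ℝ}
    (hy : Measurable y) (hg : Measurable g) {ω : Ω → ℕ → ℝ} (hω : Measurable ω) :
    Measurable fun z => splitStat A a b τ (y z) (g z) (ω z) := by
  have hn := measurable_noise.comp hg
  have h1 : Measurable fun z => A.output (a • y z - b • noise (g z)) (ω z) :=
    measurable_output A ((hy.const_smul a).sub (hn.const_smul b)) hω
  exact (measurable_frob h1 ((hy.const_smul b).add (hn.const_smul a))).sub
    ((measurable_frob h1 h1).sqrt.const_mul τ)

/-- The statistic after rotation of the Gaussian variables. -/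
lemma splitStat_observation (lam : ℝ)
    (z : ((Fin n → O d) × (Pos n d → ℝ)) × ((Pos n d → ℝ) × (ℕ → ℝ))) :
    splitStat A a b τ (observation lam z.1) z.2.1 z.2.2 =
      frob (A.output (observation (a * lam) (z.1.1, a • z.1.2 - b • z.2.1)) z.2.2)
        (b • signal lam z.1.1 + noise (b • z.1.2 + a • z.2.1)) -
      τ * Real.sqrt (frob
        (A.output (observation (a * lam) (z.1.1, a • z.1.2 - b • z.2.1)) z.2.2)
        (A.output (observation (a * lam) (z.1.1, a • z.1.2 - b • z.2.1)) z.2.2)) := by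
  have h1 : a • observation lam z.1 - b • noise z.2.1 =
      observation (a * lam) (z.1.1, a • z.1.2 - b • z.2.1) := by
    simp only [observation, ← signal_smul, sub_eq_add_neg, noise_add, smul_add, noise_smul,
      ← neg_smul]
    abel
  have h2 : b • observation lam z.1 + a • noise z.2.1 =
      b • signal lam z.1.1 + noise (b • z.1.2 + a • z.2.1) := by
    simp only [observation, noise_add, smul_add, noise_smul]
    abel
  rw [splitStat, h1, h2]

/-- A validation of the output with independent noise. -/
def validation (lam : ℝ) (z : (((Fin n → O d) × (Pos n d → ℝ)) × (ℕ → ℝ)) × (Pos n d → ℝ)) : ℝ :=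
  frob (A.output (observation (a * lam) z.1.1) z.1.2) (b • signal lam z.1.1.1 + noise z.2) -
    τ * Real.sqrt (frob (A.output (observation (a * lam) z.1.1) z.1.2)
      (A.output (observation (a * lam) z.1.1) z.1.2))

lemma measurable_validation (lam : ℝ) : Measurable (validation A a b τ lam) := by
  have h1 : Measurable fun z : (((Fin n → O d) × (Pos n d → ℝ)) × (ℕ → ℝ)) × (Pos n d → ℝ) =>
      A.output (observation (a * lam) z.1.1) z.1.2 :=
    measurable_output A ((measurable_observation _).comp (by fun_prop)) (by fun_prop)
  have h2 : Measurable fun z : (((Fin n → O d) × (Pos n d → ℝ)) × (ℕ → ℝ)) × (Pos n d → ℝ) =>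
      signal lam z.1.1.1 := (measurable_signal lam).comp (by fun_prop)
  exact (measurable_frob h1 ((h2.const_smul b).add (measurable_noise.comp measurable_snd))).sub
    ((measurable_frob h1 h1).sqrt.const_mul τ)

variable {a b τ}

/-- The law of the statistic of one sample. -/
lemma measureReal_splitStat (hab : a ^ 2 + b ^ 2 = 1) (lam : ℝ) {T : Set ℝ}
    (hT : MeasurableSet T) :
    ((planted n d lam).prod ((gaussPi (Pos n d)).prod coins)).real
        {z | splitStat A a b τ z.1 z.2.1 z.2.2 ∈ T} =
      (((base n d).prod coins).prod (gaussPi (Pos n d))).real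
        {z | validation A a b τ lam z ∈ T} := by
  have h1 : MeasurePreserving (observation lam) (base n d) (planted n d lam) :=
    ⟨measurable_observation lam, rfl⟩
  have h2 := h1.prod (MeasurePreserving.id ((gaussPi (Pos n d)).prod coins))
  have h3 : MeasurableSet {z : (Pos n d → ℝ) × ((Pos n d → ℝ) × (ℕ → ℝ)) |
      splitStat A a b τ z.1 z.2.1 z.2.2 ∈ T} :=
    (measurable_splitStat A a b τ measurable_fst (by fun_prop) (by fun_prop)) hT
  have h4 : MeasurableSet {z | validation A a b τ lam z ∈ T} :=
    measurable_validation A a b τ lam hT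
  rw [← h2.measureReal_preimage h3.nullMeasurableSet,
    ← (measurePreserving_split hab).measureReal_preimage h4.nullMeasurableSet]
  congr 1
  ext z
  exact iff_of_eq (congrArg (· ∈ T) (splitStat_observation A a b τ lam z))

/-- Under the null law the statistic of one sample is rarely positive. -/
lemma null_splitStat_le (hd : 1 ≤ d) (hab : a ^ 2 + b ^ 2 = 1) (hτ : 0 ≤ τ) :
    ((null n d).prod ((gaussPi (Pos n d)).prod coins)).real
        {z | 0 < splitStat A a b τ z.1 z.2.1 z.2.2} ≤ Real.exp (-(τ ^ 2 * d / 4)) := by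
  rw [← planted_zero]
  refine (measureReal_splitStat A hab 0 (T := Set.Ioi 0) measurableSet_Ioi).le.trans ?_
  refine (measureReal_prod_le (measurable_validation A a b τ 0 measurableSet_Ioi)
    MeasurableSet.empty (Real.exp_pos (-(τ ^ 2 * d / 4))).le fun x _ => ?_).trans
      (by rw [measureReal_empty, zero_add])
  have hset : ∀ h, h ∈ Prod.mk x ⁻¹' (validation A a b τ 0 ⁻¹' Set.Ioi 0) ↔
      0 < frob (A.output (observation (a * 0) x.1) x.2) (noise h) -
        τ * Real.sqrt (frob (A.output (observation (a * 0) x.1) x.2)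
          (A.output (observation (a * 0) x.1) x.2)) := by
    intro h
    simp only [Set.mem_preimage, validation, signal_zero, smul_zero, zero_add, Set.mem_Ioi]
  generalize A.output (observation (a * 0) x.1) x.2 = X at hset
  -- A zero output has statistic exactly `0`, which the strict inequality rejects; the tail bound
  -- needs `X ≠ 0`.
  rcases (frob_self_nonneg X).eq_or_lt with h0 | h0
  · have hX : X = 0 := by
      funext i
      have := (Finset.sum_eq_zero_iff_of_nonneg fun i _ => mul_self_nonneg (X i)).1 h0.symm i
        (Finset.mem_univ i)
      simpa using this
    have : Prod.mk x ⁻¹' (validation A a b τ 0 ⁻¹' Set.Ioi 0) = ∅ := by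
      ext h
      rw [hset, hX]
      simp [frob]
    rw [this, measureReal_empty]
    exact (Real.exp_pos _).le
  · refine (measureReal_mono fun h hh => ?_).trans (gaussPi_real_frob_noise_le hd h0 hτ)
    have := (hset h).1 hh
    show τ * Real.sqrt (frob X X) ≤ frob X (noise h)
    linarith

/-- Under the planted law the statistic of one sample is positive with probability bounded away
from zero, if the algorithm achieves a positive correlation. -/
lemma planted_splitStat_le (hd : 1 ≤ d) (hab : a ^ 2 + b ^ 2 = 1) (hτ : 0 ≤ τ) {lam c : ℝ}
    (ha : 0 < a) (hb : 0 ≤ b) (hlam : 0 < lam) (hc0 : 0 < c) (hc : c ≤ correlation n d (a * lam) A)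
    (hτc : 2 * τ ≤ b * (c / 2) * lam * Real.sqrt (n * d)) :
    ((planted n d lam).prod ((gaussPi (Pos n d)).prod coins)).real
        {z | ¬ 0 < splitStat A a b τ z.1 z.2.1 z.2.2} ≤
      1 - c / 2 + Real.exp (-(τ ^ 2 * d / 4)) := by
  have h1 : Measurable fun z : ((Fin n → O d) × (Pos n d → ℝ)) × (ℕ → ℝ) =>
      A.output (observation (a * lam) z.1) z.2 :=
    measurable_output A ((measurable_observation _).comp measurable_fst) measurable_snd
  have h2 : Measurable fun z : ((Fin n → O d) × (Pos n d → ℝ)) × (ℕ → ℝ) =>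
      signal (a * lam) z.1.1 := (measurable_signal _).comp (by fun_prop)
  have hG := measureReal_lt_half_le (μ := (base n d).prod coins) (measurable_cosine h1 h2)
    (fun _ => abs_cosine_le _ _) hc hc0.le
  have hGm : MeasurableSet {z : ((Fin n → O d) × (Pos n d → ℝ)) × (ℕ → ℝ) |
      cosine (A.output (observation (a * lam) z.1) z.2) (signal (a * lam) z.1.1) < c / 2} :=
    measurableSet_lt (measurable_cosine h1 h2) measurable_const
  have e : {z : (Pos n d → ℝ) × ((Pos n d → ℝ) × (ℕ → ℝ)) |
      ¬ 0 < splitStat A a b τ z.1 z.2.1 z.2.2} =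
      {z | splitStat A a b τ z.1 z.2.1 z.2.2 ∈ Set.Iic 0} := by
    ext z
    simp
  rw [e, measureReal_splitStat A hab lam measurableSet_Iic]
  refine (measureReal_prod_le (measurable_validation A a b τ lam measurableSet_Iic) hGm
    (Real.exp_pos _).le fun x hx => ?_).trans (add_le_add_left hG _)
  have hx' : c / 2 ≤ cosine (A.output (observation (a * lam) x.1) x.2) (signal (a * lam) x.1.1) :=
    not_lt.1 hx
  have hset : ∀ h, h ∈ Prod.mk x ⁻¹' (validation A a b τ lam ⁻¹' Set.Iic 0) →
      frob (A.output (observation (a * lam) x.1) x.2) (b • signal lam x.1.1 + noise h) -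
        τ * Real.sqrt (frob (A.output (observation (a * lam) x.1) x.2)
          (A.output (observation (a * lam) x.1) x.2)) ≤ 0 := fun h hh => hh
  generalize A.output (observation (a * lam) x.1) x.2 = X at hset hx'
  -- A zero norm would give cosine `0` by the convention for division, below `c / 2`.
  have hpos : 0 < Real.sqrt (frob X X) *
      Real.sqrt (frob (signal (a * lam) x.1.1) (signal (a * lam) x.1.1)) := by
    refine lt_of_le_of_ne (by positivity) fun h0 => ?_
    rw [cosine, ← h0, div_zero] at hx'
    linarith
  have hX : 0 < frob X X := by
    by_contra h0
    rw [Real.sqrt_eq_zero_of_nonpos (not_lt.1 h0), zero_mul] at hpos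
    exact lt_irrefl _ hpos
  rw [cosine, le_div_iff₀ hpos, ← signal_smul, signal_smul, frob_signal_self, ← signal_smul,
    Real.sqrt_mul (by positivity), Real.sqrt_sq (by positivity)] at hx'
  have hsm : ∀ (t : ℝ) (Y : Pos n d → ℝ), frob X (t • Y) = t * frob X Y := by
    intro t Y
    simp only [frob, Pi.smul_apply, smul_eq_mul, Finset.mul_sum]
    exact Finset.sum_congr rfl fun _ _ => by ring
  have hadd : ∀ Y Z : Pos n d → ℝ, frob X (Y + Z) = frob X Y + frob X Z := by
    intro Y Z
    simp only [frob, Pi.add_apply, mul_add, Finset.sum_add_distrib]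
  have hneg : frob (-X) (-X) = frob X X := by simp [frob]
  rw [hsm] at hx'
  have h3 : c / 2 * (Real.sqrt (frob X X) * (lam * Real.sqrt (n * d))) ≤
      frob X (signal lam x.1.1) := by
    refine le_of_mul_le_mul_left ?_ ha
    linarith
  have h4 : 2 * τ * Real.sqrt (frob X X) ≤ b * frob X (signal lam x.1.1) := by
    calc 2 * τ * Real.sqrt (frob X X)
        ≤ b * (c / 2) * lam * Real.sqrt (n * d) * Real.sqrt (frob X X) := by gcongr
      _ = b * (c / 2 * (Real.sqrt (frob X X) * (lam * Real.sqrt (n * d)))) := by ring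
      _ ≤ b * frob X (signal lam x.1.1) := by gcongr
  -- The signal contributes at least twice the threshold, so rejection forces the noise to reach `τ
  -- ‖X‖` in the direction `-X`.
  refine (measureReal_mono fun h hh => ?_).trans
    (gaussPi_real_frob_noise_le hd (X := -X) (by rwa [hneg]) hτ)
  have h5 := hset h hh
  rw [hadd, hsm] at h5
  have h6 : frob (-X) (noise h) = -frob X (noise h) := by simp [frob]
  show τ * Real.sqrt (frob (-X) (-X)) ≤ frob (-X) (noise h)
  rw [hneg, h6]
  linarith

end ErrorBounds


/-! ### The test on all samples -/

section HiddenTest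

variable {n d M : ℕ}

lemma measurePreserving_sample {Q : Fin M → Measure (Pos n d → ℝ)}
    [∀ j, IsProbabilityMeasure (Q j)] (j : Fin M) {o o' : ℕ}
    (ho : o + Fintype.card (Pos n d) ≤ o') :
    MeasurePreserving (fun z : (Fin M × Pos n d → ℝ) × (ℕ → ℝ) =>
      ((fun p => z.1 (j, p)), ((fun p => z.2 (o + Fintype.equivFin (Pos n d) p)),
        fun k => z.2 (o' + k))))
      (((Measure.pi Q).map (fun y p => y p.1 p.2)).prod coins)
      ((Q j).prod ((gaussPi (Pos n d)).prod coins)) := by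
  have h1 : MeasurePreserving (fun (x : Fin M × Pos n d → ℝ) p => x (j, p))
      ((Measure.pi Q).map (fun y p => y p.1 p.2)) (Q j) := by
    refine ⟨by fun_prop, ?_⟩
    rw [Measure.map_map (by fun_prop) (by fun_prop)]
    exact (measurePreserving_eval Q j).map_eq
  have : IsProbabilityMeasure
      ((Measure.pi Q).map (fun (y : Fin M → Pos n d → ℝ) (p : Fin M × Pos n d) => y p.1 p.2)) :=
    Measure.isProbabilityMeasure_map (Measurable.aemeasurable (by fun_prop))
  exact h1.prod (measurePreserving_coins (Fintype.equivFin (Pos n d)) ho)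

lemma hiddenPlanted_prod_le {P Q : Measure (Pos n d → ℝ)} [IsProbabilityMeasure P]
    [IsProbabilityMeasure Q] {S : Set ((Fin M × Pos n d → ℝ) × (ℕ → ℝ))} (hS : MeasurableSet S)
    {e : ℝ} (he : 0 ≤ e) (hM : 1 ≤ M)
    (h : ∀ κ : Fin M, (((Measure.pi (Function.update (fun _ : Fin M => Q) κ P)).map
      (fun y (p : Fin M × Pos n d) => y p.1 p.2)).prod coins).real S ≤ e) :
    ((hiddenPlanted M P Q).prod coins).real S ≤ e := by
  have hM0 : (M : ℝ≥0∞) ≠ 0 := by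
    rw [Nat.cast_ne_zero]
    omega
  have hi : ∀ κ : Fin M, ∀ j, IsProbabilityMeasure (Function.update (fun _ : Fin M => Q) κ P j) := by
    intro κ j
    rcases eq_or_ne j κ with rfl | hj
    · rwa [Function.update_self]
    · rwa [Function.update_of_ne hj]
  have hp : ∀ κ : Fin M, IsProbabilityMeasure ((Measure.pi (Function.update (fun _ : Fin M => Q) κ
      P)).map (fun y (p : Fin M × Pos n d) => y p.1 p.2)) := fun κ =>
    Measure.isProbabilityMeasure_map (Measurable.aemeasurable (by fun_prop))
  have h1 : ((hiddenPlanted M P Q).prod coins) S ≤ ENNReal.ofReal e := by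
    rw [Measure.prod_apply hS, hiddenPlanted, lintegral_smul_measure, lintegral_finsetSum_measure]
    calc (M : ℝ≥0∞)⁻¹ • ∑ κ : Fin M, ∫⁻ x, coins (Prod.mk x ⁻¹' S)
          ∂((Measure.pi (Function.update (fun _ : Fin M => Q) κ P)).map
            (fun y (p : Fin M × Pos n d) => y p.1 p.2))
        ≤ (M : ℝ≥0∞)⁻¹ • ∑ _κ : Fin M, ENNReal.ofReal e := by
          refine smul_le_smul_of_nonneg_left (Finset.sum_le_sum fun κ _ => ?_) zero_le
          rw [← Measure.prod_apply hS, ← ofReal_measureReal]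
          exact ENNReal.ofReal_le_ofReal (h κ)
      _ = ENNReal.ofReal e := by
          rw [Finset.sum_const, Finset.card_univ, Fintype.card_fin, nsmul_eq_mul, smul_eq_mul,
            ← mul_assoc, ENNReal.inv_mul_cancel hM0 (ENNReal.natCast_ne_top M), one_mul]
  rw [measureReal_def, ← ENNReal.toReal_ofReal he]
  exact ENNReal.toReal_mono ENNReal.ofReal_ne_top h1

/-- From an estimator to a test in the hidden informative sample problem. -/
lemma exists_test_of_correlation (A : Algorithm (Pos n d) (Pos n d)) (hd : 1 ≤ d) (hM : 1 ≤ M)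
    {a b τ lam c : ℝ} (hab : a ^ 2 + b ^ 2 = 1) (hτ : 0 ≤ τ) (ha : 0 < a) (hb : 0 ≤ b)
    (hlam : 0 < lam) (hc0 : 0 < c) (hc : c ≤ correlation n d (a * lam) A)
    (hτc : 2 * τ ≤ b * (c / 2) * lam * Real.sqrt (n * d)) :
    ∃ B : Algorithm (Fin M × Pos n d) Unit,
      B.time ≤ M * (A.time + 21 * Fintype.card (Pos n d) + 7) + 1 ∧
      testError (hiddenPlanted M (planted n d lam) (null n d)) (hiddenNull M (null n d)) B ≤
        1 - c / 2 + (M + 1) * Real.exp (-(τ ^ 2 * d / 4)) := by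
  obtain ⟨B, o, o', hB, ho, hacc⟩ := exists_test A a b τ M
  refine ⟨B, hB, ?_⟩
  have hSm : MeasurableSet {z : (Pos n d → ℝ) × ((Pos n d → ℝ) × (ℕ → ℝ)) |
      0 < splitStat A a b τ z.1 z.2.1 z.2.2} :=
    measurableSet_lt measurable_const
      (measurable_splitStat A a b τ measurable_fst (by fun_prop) (by fun_prop))
  have hBm : MeasurableSet {z : (Fin M × Pos n d → ℝ) × (ℕ → ℝ) | B.Accepts z.1 z.2} :=
    measurableSet_lt measurable_const ((measurable_pi_apply ()).comp
      (measurable_output B measurable_fst measurable_snd))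
  set e := Real.exp (-(τ ^ 2 * d / 4)) with he
  -- Union bound over the samples.
  have hQ : ((hiddenNull M (null n d)).prod coins).real {z | B.Accepts z.1 z.2} ≤ M * e := by
    have h1 : {z : (Fin M × Pos n d → ℝ) × (ℕ → ℝ) | B.Accepts z.1 z.2} = ⋃ j : Fin M,
        (fun z : (Fin M × Pos n d → ℝ) × (ℕ → ℝ) => ((fun p => z.1 (j, p)),
          ((fun p => z.2 (o j + Fintype.equivFin (Pos n d) p)), fun k => z.2 (o' j + k)))) ⁻¹'
        {z | 0 < splitStat A a b τ z.1 z.2.1 z.2.2} := by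
      ext z
      rw [Set.mem_iUnion]
      exact hacc z.1 z.2
    rw [h1]
    refine (measureReal_iUnion_fintype_le _).trans ?_
    refine (Finset.sum_le_sum (g := fun _ => e) fun j _ => ?_).trans (by simp)
    rw [hiddenNull, (measurePreserving_sample (Q := fun _ => null n d) j (ho j)).measureReal_preimage
      hSm.nullMeasurableSet]
    exact null_splitStat_le A hd hab hτ
  -- Only the informative sample is examined; the others can only help acceptance.
  have hP : ((hiddenPlanted M (planted n d lam) (null n d)).prod coins).real
      {z | ¬ B.Accepts z.1 z.2} ≤ 1 - c / 2 + e := by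
    have hb1 : ∀ κ : Fin M, ((planted n d lam).prod ((gaussPi (Pos n d)).prod coins)).real
        {z | ¬ 0 < splitStat A a b τ z.1 z.2.1 z.2.2} ≤ 1 - c / 2 + e := fun κ =>
      planted_splitStat_le A hd hab hτ ha hb hlam hc0 hc hτc
    refine hiddenPlanted_prod_le hBm.compl (measureReal_nonneg.trans (hb1 ⟨0, hM⟩)) hM fun κ => ?_
    have hi : ∀ j, IsProbabilityMeasure
        (Function.update (fun _ : Fin M => null n d) κ (planted n d lam) j) := by
      intro j
      rcases eq_or_ne j κ with rfl | hj
      · rw [Function.update_self]; infer_instance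
      · rw [Function.update_of_ne hj]; infer_instance
    have hmp := measurePreserving_sample
      (Q := Function.update (fun _ : Fin M => null n d) κ (planted n d lam)) κ (ho κ)
    rw [Function.update_self] at hmp
    have : IsProbabilityMeasure ((Measure.pi (Function.update (fun _ : Fin M => null n d) κ
        (planted n d lam))).map (fun y (p : Fin M × Pos n d) => y p.1 p.2)) :=
      Measure.isProbabilityMeasure_map (Measurable.aemeasurable (by fun_prop))
    refine (le_trans ?_ (hmp.measureReal_preimage hSm.compl.nullMeasurableSet).le).trans (hb1 κ)
    refine measureReal_mono fun z hz => ?_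
    exact fun h => hz ((hacc z.1 z.2).2 ⟨κ, h⟩)
  rw [testError]
  linarith

end HiddenTest


/-! ### Asymptotics -/

section Asymptotics

/-- The dimension cancels; `N ≥ 2` keeps `log N` away from zero. -/
lemma heuristicTime_eq {N : ℕ} (hN : 2 ≤ N) (D : ℕ) (C : ℝ) :
    heuristicTime N D C = Real.exp (D / C) := by
  have hN1 : (1 : ℝ) < N := by exact_mod_cast hN
  have hlog : 0 < Real.log N := Real.log_pos hN1
  rw [heuristicTime, Real.rpow_def_of_pos (by linarith)]
  congr 1
  rcases eq_or_ne C 0 with rfl | hC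
  · simp
  · field_simp

/-- The exponent is shared out: `d² + 1 ≤ 2 n^{ε/2}` and `log (n + 1) ≤ n^{ε/2} / 2`. -/
lemma Subpolynomial.log_pow {d : ℕ → ℕ} (hd_pos : ∀ n, 1 ≤ d n)
    (hd : Subpolynomial (fun n => (d n : ℝ))) :
    Subpolynomial (fun n => Real.log (((n + 1) ^ (d n ^ 2 + 1) : ℕ) : ℝ)) := by
  intro ε hε
  have h1 := hd (ε / 4) (by positivity)
  have h2 : ∀ᶠ n : ℕ in atTop, Real.log n ≤ 1 / 4 * (n : ℝ) ^ (ε / 2) := by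
    have := ((isLittleO_log_rpow_atTop (half_pos hε)).comp_tendsto tendsto_natCast_atTop_atTop).bound
      (by norm_num : (0 : ℝ) < 1 / 4)
    filter_upwards [this] with n hn
    simp only [Function.comp_apply, Real.norm_eq_abs] at hn
    rw [abs_of_nonneg (by positivity : (0 : ℝ) ≤ (n : ℝ) ^ (ε / 2))] at hn
    exact (le_abs_self _).trans hn
  filter_upwards [h1, h2, eventually_ge_atTop 2] with n h1 h2 hn
  have hn0 : (0 : ℝ) < n := by exact_mod_cast (by omega : 0 < n)
  have hd1 : (1 : ℝ) ≤ d n := by exact_mod_cast hd_pos n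
  have h3 : Real.log (n + 1) ≤ 2 * Real.log n := by
    rw [← Real.log_rpow hn0, ← Nat.cast_ofNat, Real.rpow_natCast]
    have : (2 : ℝ) ≤ n := by exact_mod_cast hn
    exact Real.log_le_log (by positivity) (by nlinarith)
  have h4 : ((n : ℝ) ^ (ε / 4)) ^ 2 = (n : ℝ) ^ (ε / 2) := by
    rw [← Real.rpow_natCast, ← Real.rpow_mul hn0.le]
    congr 1
    push_cast
    ring
  have h5 : (d n : ℝ) ^ 2 + 1 ≤ 2 * (n : ℝ) ^ (ε / 2) := by
    have : (d n : ℝ) ^ 2 ≤ (n : ℝ) ^ (ε / 2) := by rw [← h4]; gcongr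
    nlinarith
  have h6 : 0 ≤ Real.log (n + 1) := Real.log_nonneg (by linarith)
  push_cast
  rw [Real.log_pow]
  push_cast
  calc ((d n : ℝ) ^ 2 + 1) * Real.log (n + 1)
      ≤ (2 * (n : ℝ) ^ (ε / 2)) * (2 * (1 / 4 * (n : ℝ) ^ (ε / 2))) := by
        gcongr
        linarith
    _ = (n : ℝ) ^ ε := by
        have : (n : ℝ) ^ ε = (n : ℝ) ^ (ε / 2) * (n : ℝ) ^ (ε / 2) := by
          rw [← Real.rpow_add hn0]; ring_nf
        rw [this]; ring

/-- The choice of `M`: the power `(n + 1) ^ d²` absorbs `(1 - lam)^{-d²/2}`, and the extra factor `n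
+ 1` beats `D²`, from `D` terms each linear in `D`. -/
lemma lowDegAdv_hidden_pow_le {n d D : ℕ} {lam : ℝ} (hd : 1 ≤ d) (hn : 8 * d ^ 2 * D ^ 3 ≤ n)
    (h0 : 0 < lam) (h1 : lam < 1) (hK : (Real.sqrt (1 - lam))⁻¹ ≤ n + 1) :
    lowDegAdv D (hiddenPlanted ((n + 1) ^ (d ^ 2 + 1)) (planted n d lam) (null n d))
      (hiddenNull ((n + 1) ^ (d ^ 2 + 1)) (null n d)) ≤
        ENNReal.ofReal (Real.sqrt (1 + 2 * Real.exp 1 ^ 2 * (D ^ 2 / (n + 1)))) := by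
  refine (lowDegAdv_hidden_le (Nat.one_le_pow _ _ n.succ_pos) hd lam D).trans ?_
  refine ENNReal.ofReal_le_ofReal (Real.sqrt_le_sqrt (add_le_add_right ?_ _))
  set K := (Real.sqrt (1 - lam))⁻¹
  have hK0 : 0 ≤ K := by positivity
  have h2 : ∑ k ∈ Finset.range D, overlapMoment n d lam (k + 1) / ((k + 1).factorial : ℝ) ≤
      ∑ _k ∈ Finset.range D, 2 * Real.exp 1 ^ 2 * D * (n + 1 : ℝ) ^ (d ^ 2) := by
    refine Finset.sum_le_sum fun k hk => ?_
    have hk' : k + 1 ≤ D := Finset.mem_range.1 hk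
    have hkn : 8 * d ^ 2 * (k + 1) ^ 3 ≤ n := le_trans (by gcongr) hn
    refine (overlapMoment_le hd (Nat.succ_pos k) hkn h0 h1).trans ?_
    have : ((k + 1 : ℕ) : ℝ) ≤ D := by exact_mod_cast hk'
    rw [← pow_two]
    gcongr
  rw [Finset.sum_const, Finset.card_range, nsmul_eq_mul] at h2
  have hn1 : (0 : ℝ) < n + 1 := by positivity
  push_cast
  rw [div_le_iff₀ (by positivity)]
  refine h2.trans (le_of_eq ?_)
  field_simp
  ring

/-- The exponent of the running times that are excluded. -/
def eighthRoot (n : ℕ) : ℝ := (n : ℝ) ^ (1 / 8 : ℝ)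

lemma eighthRoot_nonneg (n : ℕ) : 0 ≤ eighthRoot n := Real.rpow_nonneg n.cast_nonneg _

lemma eighthRoot_pow (n : ℕ) : eighthRoot n ^ 8 = n := by
  rw [eighthRoot, ← Real.rpow_natCast, ← Real.rpow_mul n.cast_nonneg]
  norm_num

lemma eighthRoot_le {n : ℕ} (h : 1 ≤ eighthRoot n) : eighthRoot n ≤ n := by
  have : eighthRoot n ≤ eighthRoot n ^ 8 := le_self_pow₀ h (by norm_num)
  rwa [eighthRoot_pow] at this

lemma tendsto_eighthRoot {l : Filter ℕ} (hl : l ≤ atTop) : Tendsto eighthRoot l atTop :=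
  ((tendsto_rpow_atTop (by norm_num)).comp tendsto_natCast_atTop_atTop).mono_left hl

lemma Subpolynomial.sq_le_eighthRoot {d : ℕ → ℕ} (hd : Subpolynomial (fun n => (d n : ℝ))) :
    ∀ᶠ n in atTop, (d n : ℝ) ^ 2 ≤ eighthRoot n := by
  filter_upwards [hd (1 / 16) (by norm_num)] with n hn
  calc (d n : ℝ) ^ 2 ≤ ((n : ℝ) ^ (1 / 16 : ℝ)) ^ 2 := by gcongr
    _ = eighthRoot n := by
      rw [eighthRoot, ← Real.rpow_natCast, ← Real.rpow_mul n.cast_nonneg]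
      norm_num

lemma tendsto_lowDegAdv_hidden {l : Filter ℕ} (hl : l ≤ atTop) {d : ℕ → ℕ}
    (hd_pos : ∀ n, 1 ≤ d n) (hd : Subpolynomial (fun n => (d n : ℝ))) {lam : ℝ} (h0 : 0 < lam)
    (h1 : lam < 1) :
    Tendsto (fun n => lowDegAdv ⌊eighthRoot n ^ 2⌋₊
      (hiddenPlanted ((n + 1) ^ (d n ^ 2 + 1)) (planted n (d n) lam) (null n (d n)))
      (hiddenNull ((n + 1) ^ (d n ^ 2 + 1)) (null n (d n)))) l (𝓝 1) := by
  have htop := tendsto_eighthRoot hl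
  have hlim : Tendsto (fun n => ENNReal.ofReal
      (Real.sqrt (1 + 2 * Real.exp 1 ^ 2 * (eighthRoot n)⁻¹))) l (𝓝 1) := by
    have h := ((htop.inv_tendsto_atTop.const_mul (2 * Real.exp 1 ^ 2)).const_add 1).sqrt
    rw [mul_zero, add_zero, Real.sqrt_one] at h
    simpa using ENNReal.tendsto_ofReal h
  refine tendsto_of_tendsto_of_tendsto_of_le_of_le' tendsto_const_nhds hlim ?_ ?_
  · refine Eventually.of_forall fun n => ?_
    have : NeZero ((n + 1) ^ (d n ^ 2 + 1)) := ⟨pow_ne_zero _ n.succ_ne_zero⟩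
    exact one_le_lowDegAdv _ _ _
  · filter_upwards [hd.sq_le_eighthRoot.filter_mono hl, htop.eventually_ge_atTop 8,
      htop.eventually_ge_atTop (Real.sqrt (1 - lam))⁻¹] with n h2 h3 h4
    have hpow := eighthRoot_pow n
    have hle := eighthRoot_le (n := n) (by linarith)
    set t := eighthRoot n
    have ht1 : 1 ≤ t := by linarith
    have hDle : (⌊t ^ 2⌋₊ : ℝ) ≤ t ^ 2 := Nat.floor_le (by positivity)
    -- With `t = n^{1/8}`, the bounds `8 ≤ t`, `d² ≤ t` and `D ≤ t²` give `t · t · t⁶ = n`; this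
    -- fixes the degree `n^{1/4}`.
    have h5 : 8 * d n ^ 2 * ⌊t ^ 2⌋₊ ^ 3 ≤ n := by
      have : 8 * (d n : ℝ) ^ 2 * (⌊t ^ 2⌋₊ : ℝ) ^ 3 ≤ (n : ℝ) := by
        calc 8 * (d n : ℝ) ^ 2 * (⌊t ^ 2⌋₊ : ℝ) ^ 3 ≤ t * t * (t ^ 2) ^ 3 := by gcongr
          _ = (n : ℝ) := by rw [← hpow]; ring
      exact_mod_cast this
    refine (lowDegAdv_hidden_pow_le (hd_pos n) h5 h0 h1 (by linarith)).trans ?_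
    refine ENNReal.ofReal_le_ofReal (Real.sqrt_le_sqrt ?_)
    gcongr
    rw [div_le_iff₀ (by positivity), ← hpow]
    have h6 : (⌊t ^ 2⌋₊ : ℝ) ^ 2 ≤ t ^ 4 := by
      calc (⌊t ^ 2⌋₊ : ℝ) ^ 2 ≤ (t ^ 2) ^ 2 := by gcongr
        _ = t ^ 4 := by ring
    have h7 : t ^ 4 ≤ t ^ 7 := pow_le_pow_right₀ ht1 (by norm_num)
    have h8 : t⁻¹ * t ^ 8 = t ^ 7 := by
      have : t ≠ 0 := by linarith
      field_simp
    have h9 : 0 ≤ t⁻¹ := by positivity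
    linarith [mul_add t⁻¹ (t ^ 8) 1]

lemma eventually_eighthRoot_pow_le {l : Filter ℕ} (hl : l ≤ atTop) :
    ∀ᶠ n in l, 28 * eighthRoot n ^ 18 ≤ Real.exp (eighthRoot n) := by
  have h := (Real.isLittleO_pow_exp_atTop (n := 18)).bound (by norm_num : (0 : ℝ) < 1 / 28)
  filter_upwards [(tendsto_eighthRoot hl).eventually h] with n hn
  rw [Real.norm_of_nonneg (pow_nonneg (eighthRoot_nonneg n) _),
    Real.norm_of_nonneg (Real.exp_pos _).le] at hn
  linarith

/-- The test that is built from an estimator meets the time bound of the heuristic. -/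
lemma test_time_le {n d M T B : ℕ} {C : ℝ} (hC : 0 < C) (hd : 1 ≤ d) (hM : n + 1 ≤ M)
    (hB : B ≤ M * (T + 21 * Fintype.card (Pos n d) + 7) + 1)
    (hT : (T : ℝ) ≤ Real.exp (eighthRoot n)) (hM' : (M : ℝ) ≤ Real.exp (eighthRoot n))
    (hpoly : 28 * eighthRoot n ^ 18 ≤ Real.exp (eighthRoot n))
    (hdt : (d : ℝ) ^ 2 ≤ eighthRoot n) (h2 : 2 ≤ eighthRoot n)
    (h3 : 3 * C + 1 ≤ eighthRoot n) :
    (B : ℝ) ≤ heuristicTime (Fintype.card (Fin M × Pos n d)) ⌊eighthRoot n ^ 2⌋₊ C := by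
  have hpow := eighthRoot_pow n
  have hle := eighthRoot_le (n := n) (by linarith)
  set t := eighthRoot n
  have hn2 : 2 ≤ n := by exact_mod_cast h2.trans hle
  have hcard : 2 ≤ Fintype.card (Fin M × Pos n d) := by
    have : NeZero n := ⟨by omega⟩
    have : NeZero d := ⟨by omega⟩
    have h9 : 1 ≤ Fintype.card (Pos n d) := Fintype.card_pos
    rw [Fintype.card_prod, Fintype.card_fin]
    nlinarith
  rw [heuristicTime_eq hcard]
  have h8 : (Fintype.card (Pos n d) : ℝ) ≤ t ^ 18 := by
    have : (Fintype.card (Pos n d) : ℝ) = n * d * (n * d) := by simp [Pos]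
    rw [this]
    calc (n : ℝ) * d * (n * d) = n * n * (d : ℝ) ^ 2 := by ring
      _ ≤ n * n * t := by gcongr
      _ = t ^ 17 := by rw [← hpow]; ring
      _ ≤ t ^ 18 := pow_le_pow_right₀ (by linarith) (by norm_num)
  have h9 : (1 : ℝ) ≤ t ^ 18 := one_le_pow₀ (by linarith)
  have h10 : (B : ℝ) ≤ M * (T + 21 * Fintype.card (Pos n d) + 7) + 1 := by exact_mod_cast hB
  have hE1 : (3 : ℝ) ≤ Real.exp t := by linarith [Real.add_one_le_exp t]
  have h12 : t ^ 2 - 1 < ⌊t ^ 2⌋₊ := by linarith [Nat.lt_floor_add_one (t ^ 2)]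
  -- From `t ≥ 3C + 1` one gets `t² - 1 ≥ 3Ct`. The test needs only about `2 exp(t)²` steps.
  have h13 : Real.exp t ^ 3 ≤ Real.exp (⌊t ^ 2⌋₊ / C) := by
    rw [← Real.exp_nat_mul]
    refine Real.exp_le_exp.2 ?_
    rw [le_div_iff₀ hC]
    push_cast
    nlinarith
  refine le_trans ?_ h13
  set E := Real.exp t
  have h14 : (T : ℝ) + 21 * Fintype.card (Pos n d) + 7 ≤ E + E := by linarith
  calc (B : ℝ) ≤ M * (T + 21 * Fintype.card (Pos n d) + 7) + 1 := h10
    _ ≤ E * (E + E) + 1 := by gcongr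
    _ ≤ E ^ 3 := by nlinarith [sq_nonneg E]

/-- The union bound over all samples is negligible. -/
lemma mul_exp_neg_le {n : ℕ} {M c κ s : ℝ} (hM : M ≤ Real.exp (eighthRoot n)) (hc : 0 < c)
    (hκ : 0 < κ) (hs : κ * n ≤ s) (h1 : 1 ≤ eighthRoot n) (h2 : 2 / κ ≤ eighthRoot n)
    (h3 : 8 / c ≤ eighthRoot n) : (M + 1) * Real.exp (-s) ≤ c / 4 := by
  have hpow := eighthRoot_pow n
  set t := eighthRoot n
  have h6 : 2 * t ≤ κ * n := by
    rw [div_le_iff₀ hκ] at h2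
    have h7 : t ^ 2 ≤ n := by
      rw [← hpow]
      exact pow_le_pow_right₀ h1 (by norm_num)
    calc 2 * t ≤ t * κ * t := by gcongr
      _ = κ * t ^ 2 := by ring
      _ ≤ κ * n := by gcongr
  have h8 : M + 1 ≤ 2 * Real.exp t := by
    have := Real.one_le_exp (zero_le_one.trans h1)
    linarith
  have h10 : Real.exp (-t) ≤ c / 8 := by
    rw [Real.exp_neg, inv_le_comm₀ (Real.exp_pos _) (by positivity), inv_div]
    linarith [Real.add_one_le_exp t]
  calc (M + 1) * Real.exp (-s)
      ≤ 2 * Real.exp t * Real.exp (-(2 * t)) := by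
        gcongr
        linarith
    _ = 2 * Real.exp (-t) := by
        rw [mul_assoc, ← Real.exp_add]
        ring_nf
    _ ≤ c / 4 := by linarith

/-- An estimator that achieves weak recovery in time `exp (n ^ (1 / 8))` contradicts the
heuristic. -/
lemma not_heuristicForSync {l : Filter ℕ} (hl : l ≤ atTop) {d : ℕ → ℕ} {lam : ℕ → ℝ} {δ : ℝ}
    (hd_pos : ∀ n, 1 ≤ d n) (hd : Subpolynomial (fun n => (d n : ℝ)))
    (hδ : 0 < δ) (hlam_pos : ∀ n, 0 < lam n) (hlam : ∀ n, lam n < 1 - δ)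
    (A : ∀ n, Algorithm (Pos n (d n)) (Pos n (d n))) (hA : WeakRecovery d lam A)
    (hT : ∀ᶠ n : ℕ in l, ((A n).time : ℝ) ≤ Real.exp ((n : ℝ) ^ (1 / 8 : ℝ))) :
    ¬ HeuristicForSync l d := by
  intro H
  obtain ⟨c, hc0, hc⟩ := hA
  have hδ1 : δ < 1 := by linarith [hlam_pos 0, hlam 0]
  obtain ⟨lam', hlam'⟩ : ∃ lam', lam' = 1 - δ / 2 := ⟨_, rfl⟩
  have hl0 : 0 < lam' := by linarith
  have hl1 : lam' < 1 := by linarith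
  have hM1 : ∀ n, 1 ≤ (n + 1) ^ (d n ^ 2 + 1) := fun n => Nat.one_le_pow _ _ n.succ_pos
  have hMsub := hd.log_pow hd_pos
  have htop := tendsto_eighthRoot hl
  -- The weak detection clause is needed, because the error of the test is only bounded away from
  -- one.
  obtain ⟨C, hC, hno⟩ := (H lam' _ hl0 hl1 hM1 hMsub).2 _
    (tendsto_lowDegAdv_hidden hl hd_pos hd hl0 hl1)
  have ha0 : ∀ n, 0 < lam n / lam' := fun n => div_pos (hlam_pos n) hl0
  -- `lam'² ≥ 1 - δ > lam n`. Hence `b² ≥ 1 - lam'²` uniformly in `n`, even if `lam n` varies.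
  have ha2 : ∀ n, (lam n / lam') ^ 2 ≤ lam' ^ 2 := fun n => by
    refine pow_le_pow_left₀ (ha0 n).le ?_ 2
    rw [div_le_iff₀ hl0]
    have := hlam n
    nlinarith
  have hl2 : 0 < 1 - lam' ^ 2 := by nlinarith
  have hex : ∀ n, ∃ B : Algorithm (Fin ((n + 1) ^ (d n ^ 2 + 1)) × Pos n (d n)) Unit,
      c ≤ correlation n (d n) (lam n) (A n) →
      B.time ≤ (n + 1) ^ (d n ^ 2 + 1) * ((A n).time + 21 * Fintype.card (Pos n (d n)) + 7) + 1 ∧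
      ∃ s, (1 - lam' ^ 2) * (c / 4) ^ 2 * lam' ^ 2 / 4 * n ≤ s ∧
        testError
          (hiddenPlanted ((n + 1) ^ (d n ^ 2 + 1)) (planted n (d n) lam') (null n (d n)))
          (hiddenNull ((n + 1) ^ (d n ^ 2 + 1)) (null n (d n))) B ≤
          1 - c / 2 + (((n + 1) ^ (d n ^ 2 + 1) : ℕ) + 1) * Real.exp (-s) := by
    intro n
    by_cases hcn : c ≤ correlation n (d n) (lam n) (A n)
    · have hb : Real.sqrt (1 - (lam n / lam') ^ 2) ^ 2 = 1 - (lam n / lam') ^ 2 :=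
        Real.sq_sqrt (by linarith [ha2 n])
      -- `τ` is half the guaranteed contribution of the signal, so `τ² d / 4` is at least a constant
      -- times `n`.
      obtain ⟨B, hB, hB'⟩ := exists_test_of_correlation (A n) (hd_pos n) (hM1 n)
        (a := lam n / lam') (b := Real.sqrt (1 - (lam n / lam') ^ 2))
        (τ := Real.sqrt (1 - (lam n / lam') ^ 2) * (c / 4) * lam' * Real.sqrt (n * d n))
        (lam := lam') (c := c) (by rw [hb]; ring) (by positivity) (ha0 n)
        (Real.sqrt_nonneg _) hl0 hc0 (by rwa [div_mul_cancel₀ _ hl0.ne']) (le_of_eq (by ring))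
      refine ⟨B, fun _ => ⟨hB, _, ?_, hB'⟩⟩
      have h2 : (1 : ℝ) ≤ d n := by exact_mod_cast hd_pos n
      have h3 : (1 : ℝ) ≤ d n * d n := by nlinarith
      have h5 : 0 ≤ 1 - (lam n / lam') ^ 2 := by linarith [ha2 n]
      rw [mul_pow, mul_pow, mul_pow, hb, Real.sq_sqrt (by positivity)]
      calc (1 - lam' ^ 2) * (c / 4) ^ 2 * lam' ^ 2 / 4 * n
          = (1 - lam' ^ 2) * ((c / 4) ^ 2 * lam' ^ 2 / 4 * n * 1) := by ring
        _ ≤ (1 - (lam n / lam') ^ 2) * ((c / 4) ^ 2 * lam' ^ 2 / 4 * n * (d n * d n)) := by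
            refine mul_le_mul (by linarith [ha2 n]) ?_ (by positivity) h5
            gcongr
        _ = _ := by ring
    -- An arbitrary test at the sizes, eventually absent, where the correlation bound fails.
    · exact ⟨⟨[], fun _ => .reg 0⟩, fun h => absurd h hcn⟩
  choose B hB using hex
  have hMexp : ∀ᶠ n in l, (((n + 1) ^ (d n ^ 2 + 1) : ℕ) : ℝ) ≤ Real.exp (eighthRoot n) := by
    filter_upwards [(hMsub (1 / 8) (by norm_num)).filter_mono hl] with n hn
    have h1 : (0 : ℝ) < ((n + 1) ^ (d n ^ 2 + 1) : ℕ) := by exact_mod_cast hM1 n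
    exact (Real.log_le_iff_le_exp h1).1 hn
  refine hno B ?_ ⟨c / 4, by positivity, ?_⟩
  · filter_upwards [hc.filter_mono hl, hT, hMexp, eventually_eighthRoot_pow_le hl,
      hd.sq_le_eighthRoot.filter_mono hl, htop.eventually_ge_atTop 2,
      htop.eventually_ge_atTop (3 * C + 1)] with n h1 h2 h3 h4 h5 h6 h7
    exact test_time_le hC (hd_pos n) (Nat.le_self_pow (Nat.succ_ne_zero _) _) (hB n h1).1 h2 h3 h4
      h5 h6 h7
  · have hκ : 0 < (1 - lam' ^ 2) * (c / 4) ^ 2 * lam' ^ 2 / 4 := by positivity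
    filter_upwards [hc.filter_mono hl, hMexp, htop.eventually_ge_atTop 1,
      htop.eventually_ge_atTop (2 / ((1 - lam' ^ 2) * (c / 4) ^ 2 * lam' ^ 2 / 4)),
      htop.eventually_ge_atTop (8 / c)] with n h1 h2 h3 h4 h5
    obtain ⟨-, s, hs, hB'⟩ := hB n h1
    refine hB'.trans ?_
    linarith [mul_exp_neg_le h2 hc0 hκ hs h3 h4 h5]

end Asymptotics

end OrthSync

end

theorem mainTheorem6 (d : ℕ → ℕ) (lam : ℕ → ℝ) (δ : ℝ)
    (hd_pos : ∀ n, 1 ≤ d n) (hd : OrthSync.Subpolynomial (fun n => (d n : ℝ)))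
    (hδ : 0 < δ) (hlam_pos : ∀ n, 0 < lam n) (hlam : ∀ n, lam n < 1 - δ) :
    -- Heuristic as `n → ∞`: no weak recovery in time `exp (n^{o(1)})`.
    (OrthSync.HeuristicForSync atTop d →
      ∀ A : ∀ n, OrthSync.Algorithm (OrthSync.Pos n (d n)) (OrthSync.Pos n (d n)),
        OrthSync.WeakRecovery d lam A →
        ∃ ε : ℝ, 0 < ε ∧
          ∃ᶠ n : ℕ in atTop, Real.exp ((n : ℝ) ^ ε) < ((A n).time : ℝ)) ∧
    -- Heuristic as `n → ∞` along every infinite set of sizes: time at least `exp (n^ε)` for all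
    -- large `n`.
    ((∀ S : Set ℕ, S.Infinite → OrthSync.HeuristicForSync (atTop ⊓ 𝓟 S) d) →
      ∀ A : ∀ n, OrthSync.Algorithm (OrthSync.Pos n (d n)) (OrthSync.Pos n (d n)),
        OrthSync.WeakRecovery d lam A →
        ∃ ε : ℝ, 0 < ε ∧
          ∀ᶠ n : ℕ in atTop, Real.exp ((n : ℝ) ^ ε) ≤ ((A n).time : ℝ)) := by
  refine ⟨fun H A hA => ⟨1 / 8, by norm_num, ?_⟩, fun H A hA => ⟨1 / 8, by norm_num, ?_⟩⟩
  · by_contra hT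
    rw [not_frequently] at hT
    exact OrthSync.not_heuristicForSync le_rfl hd_pos hd hδ hlam_pos hlam A hA
      (hT.mono fun n hn => not_lt.1 hn) H
  · by_contra hT
    rw [not_eventually] at hT
    -- The heuristic is applied along the sizes at which the algorithm is fast; there are infinitely
    -- many if the claim fails.
    refine OrthSync.not_heuristicForSync (l := atTop ⊓ 𝓟 {n : ℕ |
      ¬ Real.exp ((n : ℝ) ^ (1 / 8 : ℝ)) ≤ ((A n).time : ℝ)}) inf_le_left hd_pos hd hδ hlam_pos
      hlam A hA ?_ (H _ (Nat.frequently_atTop_iff_infinite.1 hT))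
    rw [eventually_inf_principal]
    exact Eventually.of_forall fun n hn => (not_le.1 hn).le
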